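/- Let $\mathbf{k}$ be a field of characteristic zero and let $\mathsf{CDGA}_{\mathbf{k}}$ be the category of unital commutative differential $\mathbf{N}$-graded $\mathbf{k}$-algebras, with differential of degree $+1$. Let $t\geq 0$ be an integer and let $\mathcal{P}^{op}$ be the linear poset $\{0,\dots,t\}$ with the reverse order, $t\to t-1\to\cdots\to 1\to 0$ (the $n$-coperverse case is $t=2n-2$). A coperverse cdga is a functor $A_{\overline{\bullet}}\colon\mathcal{P}^{op}\to\mathsf{CDGA}_{\mathbf{k}}$. For $n\geq 0$ let $S(n)=(\wedge(z),0)$ with $|z|=n$. Let $D(0)=\mathbf{k}$, and for $n>0$ let $D(n)=(\wedge(x,y),d)$ with $|x|=n-1$, $|y|=n$, $dx=y$, $dy=0$. Let $i_n\colon S(n)\to D(n)$ send $z$ to $y$ for $n>0$, and let $i_0\colon S(0)\to\mathbf{k}$ send $z$ to $0$. Let $j_n\colon\mathbf{k}\to D(n)$ be the unit for $n>0$. Put $I=\{i_n\}_{n\geq 0}$ and $J=\{j_n\}_{n>0}$. For $\overline{p}\in\mathcal{P}^{op}$ let $F_{\overline{p}}$ be the left adjoint of the evaluation $A_{\overline{\bullet}}\mapsto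 A_{\overline{p}}$; thus $F_{\overline{p}}(A)_{\overline{q}}$ is $A$ if $\overline{p}\leq\overline{q}$ in $\mathcal{P}^{op}$, and the initial algebra $\mathbf{k}$ otherwise. Then $\mathsf{CDGA}_{\mathbf{k}}$ has all small limits and colimits and a model structure whose weak equivalences are the quasi-isomorphisms and whose fibrations are the degreewise surjections, and the category $\mathrm{Fun}(\mathcal{P}^{op},\mathsf{CDGA}_{\mathbf{k}})$ of coperverse cdga's has a model structure (the projective model structure) such that: 1. the weak equivalences are the pointwise quasi-isomorphisms and the fibrations are the pointwise degreewise surjections; 2. it is the Reedy model structure for the Reedy structure on $\mathcal{P}^{op}$ in which all maps belong to the direct subcategory, only the identities belong to the inverse subcategory, and $\deg\overline{p}=t-p$: the weak equivalences are pointwise, a map is a cofibration (resp. fibration) if and only if all its relative latching (resp. matching) maps are cofibrations (resp. fibrations) in $\mathsf{CDGA}_{\mathbf{k}}$; 3. it is cofibrantly generated, with generating cofibrations $\{F_{\overline{p}}(i)\}_{i\in I,\,\overline{p}\in\mathcal{P}^{op}}$ and generating acyclic cofibrations $\{F_{\overline{p}}(j)\}_{j\in J,\,\overline{p}\in\mathcal{P}^{op}}$: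 both sets permit the small object argument, the fibrations are the maps with the right lifting property with respect to the second set, the acyclic fibrations are those with the right lifting property with respect to the first, and the category has all small limits and colimits and functorial factorizations. -/

import Mathlib

open CategoryTheory CategoryTheory.Limits HomotopicalAlgebra

universe u v w

/-! ## Commutative differential graded algebras -/

/-- A (unital) commutative differential graded algebra over `k`, graded by `ℕ`, with differential
of degree `+1`.  The algebra is the internal direct sum of its homogeneous parts `gr n`. -/
structure CDGA (k : Type u) [Field k] where
  /-- the total algebra `⨁ n, A^n` -/
  carrier : Type u
  [ring : Ring carrier]
  [algebra : Algebra k carrier]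
  /-- `gr n` is the degree `n` part `A^n` -/
  gr : ℕ → Submodule k carrier
  [graded : GradedAlgebra gr]
  /-- the differential -/
  d : carrier →ₗ[k] carrier
  d_mem : ∀ {n : ℕ} {a : carrier}, a ∈ gr n → d a ∈ gr (n + 1)
  d_d : ∀ a : carrier, d (d a) = 0
  leibniz : ∀ {n : ℕ} {a : carrier}, a ∈ gr n → ∀ b : carrier,
    d (a * b) = d a * b + (-1) ^ n * (a * d b)
  graded_comm : ∀ {m n : ℕ} {a b : carrier}, a ∈ gr m → b ∈ gr n →
    a * b = (-1) ^ (m * n) * (b * a)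

namespace CDGA

attribute [instance] CDGA.ring CDGA.algebra CDGA.graded

variable {k : Type u} [Field k]

/-- A morphism of cdga's: a morphism of unital algebras that preserves degrees and commutes with
the differentials. -/
@[ext]
structure Hom (A B : CDGA k) where
  toAlgHom : A.carrier →ₐ[k] B.carrier
  map_gr : ∀ {n : ℕ} {a : A.carrier}, a ∈ A.gr n → toAlgHom a ∈ B.gr n
  map_d : ∀ a : A.carrier, toAlgHom (A.d a) = B.d (toAlgHom a)

/-- The category `CDGA_k`. -/
instance : Category (CDGA k) where
  Hom := Hom
  id A := ⟨AlgHom.id k A.carrier, fun h => h, fun _ => rfl⟩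
  comp f g := ⟨g.toAlgHom.comp f.toAlgHom, fun h => g.map_gr (f.map_gr h), fun a => by
    simp [f.map_d, g.map_d]⟩

@[ext]
lemma hom_ext {A B : CDGA k} {f g : A ⟶ B} (h : f.toAlgHom = g.toAlgHom) : f = g :=
  Hom.ext h

/-- The cocycles of degree `n`. -/
def cocycles (A : CDGA k) (n : ℕ) : Submodule k A.carrier := A.gr n ⊓ LinearMap.ker A.d

/-- The coboundaries of degree `n`, as a subspace of the cocycles of degree `n`. -/
def coboundaries (A : CDGA k) (n : ℕ) : Submodule k (A.cocycles n) :=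
  (LinearMap.range A.d).submoduleOf (A.cocycles n)

/-- The cohomology `H^n(A)`. -/
abbrev cohomology (A : CDGA k) (n : ℕ) : Type u := A.cocycles n ⧸ A.coboundaries n

/-- The map induced on cocycles of degree `n`. -/
def cocyclesMap {A B : CDGA k} (f : A ⟶ B) (n : ℕ) : A.cocycles n →ₗ[k] B.cocycles n :=
  f.toAlgHom.toLinearMap.restrict fun a ha =>
    ⟨f.map_gr ha.1, by
      have h : A.d a = 0 := ha.2
      change B.d (f.toAlgHom a) = 0
      rw [← f.map_d, h, map_zero]⟩

/-- The map `H^n(f)` induced on cohomology. -/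
def cohomologyMap {A B : CDGA k} (f : A ⟶ B) (n : ℕ) : A.cohomology n →ₗ[k] B.cohomology n :=
  Submodule.mapQ _ _ (cocyclesMap f n) (by
    rintro ⟨a, ha⟩ ⟨b, hb⟩
    exact ⟨f.toAlgHom b, (f.map_d b).symm.trans (congrArg f.toAlgHom hb)⟩)

variable (k) in
/-- The quasi-isomorphisms of cdga's. -/
def quasiIsos : MorphismProperty (CDGA k) := fun _ _ f =>
  ∀ n : ℕ, Function.Bijective (cohomologyMap f n)

variable (k) in
/-- The degreewise surjective morphisms of cdga's. -/
def surjections : MorphismProperty (CDGA k) := fun A B f =>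
  ∀ n : ℕ, ∀ b ∈ B.gr n, ∃ a ∈ A.gr n, f.toAlgHom a = b

end CDGA

/-! ## Free graded commutative algebras and semifree cdga's -/

section Free

variable (k : Type u) [Field k] {X : Type} (deg : X → ℕ)

/-- The relations `x y = (-1)^(|x| |y|) y x` between generators.  (In characteristic different
from two they contain `x ^ 2 = 0` for `x` of odd degree.) -/
inductive FreeGCA.Rel : FreeAlgebra k X → FreeAlgebra k X → Prop
  | comm (x y : X) : FreeGCA.Rel
      (FreeAlgebra.ι k x * FreeAlgebra.ι k y)
      ((-1) ^ (deg x * deg y) * (FreeAlgebra.ι k y * FreeAlgebra.ι k x))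

/-- The free graded commutative algebra `∧ V` on the graded vector space `V` with basis `X`,
the basis element `x` being of degree `deg x`. -/
def FreeGCA : Type u := RingQuot (FreeGCA.Rel k deg)

namespace FreeGCA

instance : Ring (FreeGCA k deg) := inferInstanceAs (Ring (RingQuot (FreeGCA.Rel k deg)))

instance : Algebra k (FreeGCA k deg) :=
  inferInstanceAs (Algebra k (RingQuot (FreeGCA.Rel k deg)))

/-- The generators. -/
def gen (x : X) : FreeGCA k deg := RingQuot.mkAlgHom k (FreeGCA.Rel k deg) (FreeAlgebra.ι k x)

lemma gen_mul_gen (x y : X) :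
    gen k deg x * gen k deg y = (-1) ^ (deg x * deg y) * (gen k deg y * gen k deg x) := by
  have h := RingQuot.mkAlgHom_rel k (Rel.comm (k := k) (deg := deg) x y)
  simp only [map_mul, map_pow, map_neg, map_one] at h
  exact h

variable {k deg}

/-- An algebra morphism out of `∧ V` is given by the images of the generators. -/
def lift {B : Type v} [Ring B] [Algebra k B] (φ : X → B)
    (h : ∀ x y, φ x * φ y = (-1) ^ (deg x * deg y) * (φ y * φ x)) : FreeGCA k deg →ₐ[k] B :=
  RingQuot.liftAlgHom k ⟨FreeAlgebra.lift k φ, by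
    rintro _ _ ⟨x, y⟩
    simpa using h x y⟩

@[simp]
lemma lift_gen {B : Type v} [Ring B] [Algebra k B] (φ : X → B)
    (h : ∀ x y, φ x * φ y = (-1) ^ (deg x * deg y) * (φ y * φ x)) (x : X) :
    lift φ h (gen k deg x) = φ x := by
  unfold lift gen
  erw [RingQuot.liftAlgHom_mkAlgHom_apply]
  simp

lemma algHom_ext {B : Type v} [Ring B] [Algebra k B] {f g : FreeGCA k deg →ₐ[k] B}
    (h : ∀ x, f (gen k deg x) = g (gen k deg x)) : f = g := by
  apply RingQuot.ringQuot_ext'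
  apply FreeAlgebra.hom_ext
  funext x
  exact h x

variable (k deg)

/-- The degree `n` part, spanned by the monomials `x₁ ⋯ x_r` with `|x₁| + ⋯ + |x_r| = n`. -/
def gr (n : ℕ) : Submodule k (FreeGCA k deg) :=
  Submodule.span k {a | ∃ l : List X, (l.map deg).sum = n ∧ (l.map (gen k deg)).prod = a}

variable {k deg}

lemma gen_mem (x : X) : gen k deg x ∈ gr k deg (deg x) :=
  Submodule.subset_span ⟨[x], by simp, by simp⟩

instance : SetLike.GradedMonoid (gr k deg) where
  one_mem := Submodule.subset_span ⟨[], by simp, by simp⟩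
  mul_mem m n a b ha hb := by
    have h : a * b ∈ gr k deg m * gr k deg n := Submodule.mul_mem_mul ha hb
    rw [gr, gr, Submodule.span_mul_span] at h
    refine Submodule.span_mono ?_ h
    rintro _ ⟨_, ⟨l, hl, rfl⟩, _, ⟨l', hl', rfl⟩, rfl⟩
    exact ⟨l ++ l', by simp [hl, hl'], by simp⟩

/-- A sign does not change the degree. -/
lemma sign_mul_mem (e : ℕ) {n : ℕ} {a : FreeGCA k deg} (ha : a ∈ gr k deg n) :
    (-1) ^ e * a ∈ gr k deg n := by
  rcases neg_one_pow_eq_or (FreeGCA k deg) e with h | h <;> simp [h, ha]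

lemma sign_comm {B : Type v} [Ring B] (e : ℕ) (a : B) : a * (-1) ^ e = (-1) ^ e * a := by
  rcases neg_one_pow_eq_or B e with h | h <;> simp [h]

/-- Induction on homogeneous elements. -/
lemma gr_induction {n : ℕ} {P : FreeGCA k deg → Prop} {a : FreeGCA k deg} (ha : a ∈ gr k deg n)
    (zero : P 0) (add : ∀ a b, P a → P b → P (a + b)) (smul : ∀ (c : k) a, P a → P (c • a))
    (mon : ∀ l : List X, (l.map deg).sum = n → P (l.map (gen k deg)).prod) : P a := by
  induction ha using Submodule.span_induction with
  | mem x h => obtain ⟨l, hl, rfl⟩ := h; exact mon l hl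
  | zero => exact zero
  | add x y _ _ hx hy => exact add _ _ hx hy
  | smul c x _ hx => exact smul _ _ hx

/-- Induction on all elements. -/
lemma mon_induction {P : FreeGCA k deg → Prop} (a : FreeGCA k deg)
    (zero : P 0) (add : ∀ a b, P a → P b → P (a + b)) (smul : ∀ (c : k) a, P a → P (c • a))
    (mon : ∀ l : List X, P (l.map (gen k deg)).prod) : P a := by
  obtain ⟨b, rfl⟩ := RingQuot.mkAlgHom_surjective k (Rel k deg) a
  let S : Submodule k (FreeGCA k deg) :=
    Submodule.span k (Set.range fun l : List X => (l.map (gen k deg)).prod)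
  have hS : ∀ b, RingQuot.mkAlgHom k (Rel k deg) b ∈ S := by
    have hmul : ∀ a ∈ S, ∀ b ∈ S, a * b ∈ S := by
      intro a ha b hb
      have h : a * b ∈ S * S := Submodule.mul_mem_mul ha hb
      rw [Submodule.span_mul_span] at h
      refine Submodule.span_mono ?_ h
      rintro _ ⟨_, ⟨l, rfl⟩, _, ⟨l', rfl⟩, rfl⟩
      exact ⟨l ++ l', by simp⟩
    have hone : (1 : FreeGCA k deg) ∈ S := Submodule.subset_span ⟨[], by simp⟩
    intro b
    induction b using FreeAlgebra.induction with
    | grade0 r =>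
      rw [AlgHom.commutes, Algebra.algebraMap_eq_smul_one]
      exact Submodule.smul_mem _ _ hone
    | grade1 x => exact Submodule.subset_span ⟨[x], by
        simp only [List.map_cons, List.map_nil, List.prod_cons, List.prod_nil, mul_one]; rfl⟩
    | mul a b ha hb => rw [map_mul]; exact hmul _ ha _ hb
    | add a b ha hb => rw [map_add]; exact add_mem ha hb
  have h := hS b
  generalize RingQuot.mkAlgHom k (Rel k deg) b = a at h
  induction h using Submodule.span_induction with
  | mem x h => obtain ⟨l, rfl⟩ := h; exact mon l
  | zero => exact zero
  | add x y _ _ hx hy => exact add _ _ hx hy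
  | smul c x _ hx => exact smul _ _ hx

lemma prod_mem (l : List X) : (l.map (gen k deg)).prod ∈ gr k deg (l.map deg).sum :=
  Submodule.subset_span ⟨l, rfl, rfl⟩

lemma gen_comm (x : X) {n : ℕ} {b : FreeGCA k deg} (hb : b ∈ gr k deg n) :
    gen k deg x * b = (-1) ^ (deg x * n) * (b * gen k deg x) := by
  refine gr_induction (P := fun b => gen k deg x * b = (-1) ^ (deg x * n) * (b * gen k deg x))
    hb (by simp) ?_ ?_ ?_
  · intro a b ha hb
    rw [mul_add, ha, hb, add_mul, mul_add]
  · intro c a ha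
    rw [mul_smul_comm, ha, smul_mul_assoc, mul_smul_comm]
  · intro l hl
    subst hl
    clear hb
    induction l with
    | nil => simp
    | cons y l ih =>
      simp only [List.map_cons, List.prod_cons, List.sum_cons]
      rw [← mul_assoc, gen_mul_gen, mul_assoc, mul_assoc, ih, ← mul_assoc (gen k deg y) (_ ^ _),
        sign_comm, mul_assoc, ← mul_assoc (_ ^ _) (_ ^ _), ← pow_add, ← mul_add]
      simp only [mul_assoc]

lemma graded_comm {m n : ℕ} {a b : FreeGCA k deg} (ha : a ∈ gr k deg m) (hb : b ∈ gr k deg n) :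
    a * b = (-1) ^ (m * n) * (b * a) := by
  refine gr_induction (P := fun a => a * b = (-1) ^ (m * n) * (b * a)) ha (by simp) ?_ ?_ ?_
  · intro a c ha hb
    rw [add_mul, ha, hb, mul_add, mul_add]
  · intro c a ha
    rw [smul_mul_assoc, ha, mul_smul_comm, mul_smul_comm]
  · intro l hl
    subst hl
    clear ha
    induction l with
    | nil => simp
    | cons y l ih =>
      simp only [List.map_cons, List.prod_cons, List.sum_cons]
      rw [mul_assoc, ih, ← mul_assoc, sign_comm, mul_assoc, ← mul_assoc (gen k deg y),
        gen_comm y hb, ← mul_assoc, ← mul_assoc, ← pow_add, add_comm, ← add_mul]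
      simp only [mul_assoc]

lemma map_sign {B : Type v} [Ring B] (e : ℕ) {n : ℕ} (g : gr k deg n → B)
    (hg : ∀ a b, g (a + b) = g a + g b) (a b : gr k deg n)
    (h : (a : FreeGCA k deg) = (-1) ^ e * (b : FreeGCA k deg)) : g a = (-1) ^ e * g b := by
  rcases Nat.even_or_odd e with he | he
  · rw [he.neg_one_pow, one_mul] at h
    rw [he.neg_one_pow, one_mul, Subtype.ext h]
  · rw [he.neg_one_pow, neg_one_mul] at h
    have h0 : g 0 = 0 := by simpa using hg 0 0
    have hab : a + b = 0 := Subtype.ext (by simp [h])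
    rw [he.neg_one_pow, neg_one_mul, eq_neg_iff_add_eq_zero, ← hg, hab, h0]

/-- The decomposition of `∧ V` into its homogeneous parts. -/
noncomputable def decomposeAlgHom : FreeGCA k deg →ₐ[k] DirectSum ℕ fun n => gr k deg n :=
  lift (fun x => DirectSum.of (fun n => gr k deg n) (deg x) ⟨gen k deg x, gen_mem x⟩) (by
    intro x y
    have aux : ∀ (m n : ℕ) (h : m = n) (a : gr k deg m), DirectSum.of (fun n => gr k deg n) m a =
        DirectSum.of (fun n => gr k deg n) n ⟨a, h ▸ a.2⟩ := by
      rintro m _ rfl a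
      rfl
    rw [DirectSum.of_mul_of, DirectSum.of_mul_of, aux _ _ (add_comm (deg x) (deg y))]
    refine map_sign _ (DirectSum.of (fun n => gr k deg n) (deg y + deg x))
      (DirectSum.of (fun n => gr k deg n) (deg y + deg x)).map_add _ _ ?_
    exact gen_mul_gen k deg x y)

lemma decomposeAlgHom_prod (l : List X) :
    decomposeAlgHom (l.map (gen k deg)).prod =
      DirectSum.of (fun n => gr k deg n) (l.map deg).sum ⟨_, prod_mem l⟩ := by
  induction l with
  | nil => simp only [List.map_nil, List.prod_nil, map_one]; rfl
  | cons y l ih =>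
    simp only [List.map_cons, List.prod_cons, map_mul]
    rw [ih, decomposeAlgHom, lift_gen, DirectSum.of_mul_of]
    rfl

noncomputable instance : GradedAlgebra (gr k deg) :=
  GradedAlgebra.ofAlgHom _ decomposeAlgHom
    (by
      apply algHom_ext
      intro x
      simp [decomposeAlgHom, DirectSum.coeAlgHom_of])
    (by
      rintro n ⟨a, ha⟩
      have h : ∃ h : a ∈ gr k deg n, decomposeAlgHom a =
          DirectSum.of (fun n => gr k deg n) n ⟨a, h⟩ := by
        refine gr_induction (P := fun a => ∃ h : a ∈ gr k deg n, decomposeAlgHom a =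
          DirectSum.of (fun n => gr k deg n) n ⟨a, h⟩) ha ⟨zero_mem _, ?_⟩ ?_ ?_ ?_
        · rw [map_zero]; exact (map_zero (DirectSum.of (fun n => gr k deg n) n)).symm
        · rintro a b ⟨ha, h⟩ ⟨hb, h'⟩
          exact ⟨add_mem ha hb, by rw [map_add, h, h', ← map_add]; rfl⟩
        · rintro c a ⟨ha, h⟩
          refine ⟨Submodule.smul_mem _ c ha, ?_⟩
          rw [map_smul, h]
          exact ((DirectSum.lof k ℕ (fun n => gr k deg n) n).map_smul c ⟨a, ha⟩).symm
        · rintro l rfl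
          exact ⟨prod_mem l, decomposeAlgHom_prod l⟩
      exact h.2)

section Derivation

variable (δ : X → FreeGCA k deg) (hδ : ∀ x, δ x ∈ gr k deg (deg x + 1))

/-- The morphism of algebras `a ↦ (σ a, d a; 0, a)` to upper triangular matrices, where
`σ a = (-1)^|a| a` and where `d` is the derivation with `d x = δ x` for each generator `x`. -/
def derivMatrix : FreeGCA k deg →ₐ[k] Matrix (Fin 2) (Fin 2) (FreeGCA k deg) :=
  lift (fun x => !![(-1) ^ deg x * gen k deg x, δ x; 0, gen k deg x]) (by
    intro x y
    have key : (-1) ^ deg x * gen k deg x * δ y + δ x * gen k deg y =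
        (-1) ^ (deg x * deg y) *
          ((-1) ^ deg y * gen k deg y * δ x + δ y * gen k deg x) := by
      rw [graded_comm (hδ x) (gen_mem y), graded_comm (hδ y) (gen_mem x)]
      simp only [mul_add, ← mul_assoc, ← pow_add]
      rw [add_comm]
      congr 3
      · congr 1; ring
      · rw [show deg x * deg y + (deg y + 1) * deg x = 2 * (deg x * deg y) + deg x by ring,
          pow_add, pow_mul]
        simp
    have hs : ∀ e : ℕ, ((-1) ^ e : Matrix (Fin 2) (Fin 2) (FreeGCA k deg)) =
        !![(-1) ^ e, 0; 0, (-1) ^ e] := by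
      intro e
      rcases Nat.even_or_odd e with he | he
      · rw [he.neg_one_pow, he.neg_one_pow, Matrix.one_fin_two]
      · rw [he.neg_one_pow, he.neg_one_pow, Matrix.one_fin_two]
        ext i j; fin_cases i <;> fin_cases j <;> simp
    have h00 : (-1) ^ deg x * gen k deg x * ((-1) ^ deg y * gen k deg y) =
        (-1) ^ (deg x * deg y) *
          ((-1) ^ deg y * gen k deg y * ((-1) ^ deg x * gen k deg x)) := by
      have e1 := sign_comm (deg y) (gen k deg x)
      have e2 := sign_comm (deg x) (gen k deg y)
      rw [mul_assoc, ← mul_assoc (gen k deg x), e1, mul_assoc, gen_mul_gen,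
        mul_assoc (_ ^ deg y), ← mul_assoc (gen k deg y), e2]
      simp only [← mul_assoc, ← pow_add]
      congr 3
      ring
    rw [hs, Matrix.mul_fin_two, Matrix.mul_fin_two, Matrix.mul_fin_two]
    simp [h00, key, gen_mul_gen k deg x y])

/-- The derivation `d` of degree one of `∧ V` with `d x = δ x` for each generator `x`. -/
def deriv : FreeGCA k deg →ₗ[k] FreeGCA k deg where
  toFun a := derivMatrix δ hδ a 0 1
  map_add' a b := by simp
  map_smul' c a := by simp

@[simp]
lemma deriv_gen (x : X) : deriv δ hδ (gen k deg x) = δ x := by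
  simp [deriv, derivMatrix]

lemma derivMatrix_lower (a : FreeGCA k deg) :
    derivMatrix δ hδ a 1 0 = 0 ∧ derivMatrix δ hδ a 1 1 = a := by
  refine mon_induction
    (P := fun a => derivMatrix δ hδ a 1 0 = 0 ∧ derivMatrix δ hδ a 1 1 = a) a (by simp) ?_ ?_ ?_
  · rintro a b ⟨h1, h2⟩ ⟨h3, h4⟩
    simp [h1, h2, h3, h4]
  · rintro c a ⟨h1, h2⟩
    simp [h1, h2]
  · intro l
    induction l with
    | nil => simp
    | cons y l ih =>
      simp only [List.map_cons, List.prod_cons, map_mul, Matrix.mul_apply, Fin.sum_univ_two,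
        ih.1, ih.2]
      simp [derivMatrix]

lemma derivMatrix_zero_zero {n : ℕ} {a : FreeGCA k deg} (ha : a ∈ gr k deg n) :
    derivMatrix δ hδ a 0 0 = (-1) ^ n * a := by
  refine gr_induction (P := fun a => derivMatrix δ hδ a 0 0 = (-1) ^ n * a) ha (by simp) ?_ ?_ ?_
  · rintro a b h1 h2
    simp [h1, h2, mul_add]
  · rintro c a h1
    simp [h1]
  · rintro l rfl
    clear ha
    induction l with
    | nil => simp
    | cons y l ih =>
      simp only [List.map_cons, List.prod_cons, map_mul, Matrix.mul_apply, Fin.sum_univ_two,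
        ih, (derivMatrix_lower δ hδ _).1, List.sum_cons]
      simp only [derivMatrix, lift_gen, Matrix.of_apply, Matrix.cons_val_zero,
        Matrix.cons_val', mul_zero, add_zero]
      rw [mul_assoc, ← mul_assoc (gen k deg y), sign_comm, pow_add]
      simp only [mul_assoc]

lemma deriv_mul {n : ℕ} {a : FreeGCA k deg} (ha : a ∈ gr k deg n) (b : FreeGCA k deg) :
    deriv δ hδ (a * b) = deriv δ hδ a * b + (-1) ^ n * (a * deriv δ hδ b) := by
  change derivMatrix δ hδ (a * b) 0 1 =
    derivMatrix δ hδ a 0 1 * b + (-1) ^ n * (a * derivMatrix δ hδ b 0 1)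
  rw [map_mul, Matrix.mul_apply, Fin.sum_univ_two, derivMatrix_zero_zero δ hδ ha,
    (derivMatrix_lower δ hδ b).2, add_comm, mul_assoc]

lemma deriv_one : deriv δ hδ 1 = 0 := by
  simp [deriv]

lemma deriv_mem {n : ℕ} {a : FreeGCA k deg} (ha : a ∈ gr k deg n) :
    deriv δ hδ a ∈ gr k deg (n + 1) := by
  refine gr_induction (P := fun a => deriv δ hδ a ∈ gr k deg (n + 1)) ha (by simp) ?_ ?_ ?_
  · rintro a b h1 h2
    rw [map_add]; exact add_mem h1 h2
  · rintro c a h1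
    rw [map_smul]; exact Submodule.smul_mem _ _ h1
  · rintro l rfl
    clear ha
    induction l with
    | nil => simp [deriv_one]
    | cons y l ih =>
      simp only [List.map_cons, List.prod_cons, List.sum_cons]
      rw [deriv_mul δ hδ (gen_mem y), deriv_gen]
      refine add_mem ?_ (sign_mul_mem _ ?_)
      · have := SetLike.mul_mem_graded (hδ y) (prod_mem (k := k) (deg := deg) l)
        rwa [add_right_comm] at this
      · have := SetLike.mul_mem_graded (gen_mem (k := k) y) ih
        rwa [← add_assoc] at this

lemma deriv_deriv (hδδ : ∀ x, deriv δ hδ (δ x) = 0) (a : FreeGCA k deg) :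
    deriv δ hδ (deriv δ hδ a) = 0 := by
  refine mon_induction (P := fun a => deriv δ hδ (deriv δ hδ a) = 0) a (by simp) ?_ ?_ ?_
  · intro a b h1 h2
    simp [h1, h2]
  · intro c a h1
    simp [h1]
  · intro l
    induction l with
    | nil => simp [deriv_one]
    | cons y l ih =>
      simp only [List.map_cons, List.prod_cons]
      have hs : ∀ (e : ℕ) (b : FreeGCA k deg),
          deriv δ hδ ((-1) ^ e * b) = (-1) ^ e * deriv δ hδ b := by
        intro e b
        rcases neg_one_pow_eq_or (FreeGCA k deg) e with h | h <;> simp [h]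
      rw [deriv_mul δ hδ (gen_mem y), deriv_gen, map_add, deriv_mul δ hδ (hδ y), hδδ, hs,
        deriv_mul δ hδ (gen_mem y), deriv_gen, ih, pow_succ]
      simp

end Derivation

/-- The semifree cdga `(∧ V, d)` with `d x = δ x` for each generator `x`. -/
noncomputable def toCDGA (δ : X → FreeGCA k deg) (hδ : ∀ x, δ x ∈ gr k deg (deg x + 1))
    (hδδ : ∀ x, deriv δ hδ (δ x) = 0) : CDGA k where
  carrier := FreeGCA k deg
  gr := gr k deg
  d := deriv δ hδ
  d_mem := deriv_mem δ hδ
  d_d := deriv_deriv δ hδ hδδ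
  leibniz := deriv_mul δ hδ
  graded_comm := graded_comm

/-- The morphism from a semifree cdga to `B` given by images `φ x` of the generators `x`, where
`|φ x| = |x|` and `d (φ x) = φ (d x)`. -/
noncomputable def homOfGen {δ : X → FreeGCA k deg} {hδ : ∀ x, δ x ∈ gr k deg (deg x + 1)}
    {hδδ : ∀ x, deriv δ hδ (δ x) = 0} (B : CDGA k) (φ : X → B.carrier)
    (hφ : ∀ x, φ x ∈ B.gr (deg x))
    (hd : ∀ x, B.d (φ x) = lift φ (fun x y => B.graded_comm (hφ x) (hφ y)) (δ x)) :
    toCDGA δ hδ hδδ ⟶ B :=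
  let f : FreeGCA k deg →ₐ[k] B.carrier := lift φ fun x y => B.graded_comm (hφ x) (hφ y)
  have hmon : ∀ l : List X, f (l.map (gen k deg)).prod ∈ B.gr (l.map deg).sum := by
    intro l
    induction l with
    | nil => simpa using SetLike.one_mem_graded B.gr
    | cons y l ih =>
      simp only [List.map_cons, List.prod_cons, List.sum_cons, map_mul]
      refine SetLike.mul_mem_graded ?_ ih
      simpa [f] using hφ y
  have hgr : ∀ {n : ℕ} {a : FreeGCA k deg}, a ∈ gr k deg n → f a ∈ B.gr n := by
    intro n a ha
    refine gr_induction (P := fun a => f a ∈ B.gr n) ha (by simp) ?_ ?_ ?_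
    · intro a b h1 h2; rw [map_add]; exact add_mem h1 h2
    · intro c a h1; rw [map_smul]; exact Submodule.smul_mem _ _ h1
    · rintro l rfl; exact hmon l
  have hone : B.d 1 = 0 := by
    have h := B.leibniz (SetLike.one_mem_graded B.gr) 1
    simpa using h
  { toAlgHom := f
    map_gr := hgr
    map_d := by
      intro a
      change f (deriv δ hδ a) = B.d (f a)
      refine mon_induction (P := fun a => f (deriv δ hδ a) = B.d (f a)) a (by simp) ?_ ?_ ?_
      · intro a b h1 h2
        simp [h1, h2]
      · intro c a h1
        simp [h1]
      · intro l
        induction l with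
        | nil => simp [deriv_one, hone]
        | cons y l ih =>
          simp only [List.map_cons, List.prod_cons]
          have hy : f (gen k deg y) = φ y := by simp [f]
          rw [deriv_mul δ hδ (gen_mem y), deriv_gen, map_mul, hy, B.leibniz (hφ y), ← ih, hd]
          simp [f] }

end FreeGCA

end Free

/-! ## The generating (acyclic) cofibrations of `CDGA_k` -/

namespace CDGA

variable (k : Type u) [Field k]

/-- The ground field `k`, i.e. the free graded commutative algebra on the zero vector space.  This
is the initial object of `CDGA_k`. -/
noncomputable def ground : CDGA k :=
  FreeGCA.toCDGA (k := k) (X := Empty) (deg := fun x => x.elim) (fun x => x.elim)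
    (fun x => x.elim) (fun x => x.elim)

/-- The unique morphism `k ⟶ A`. -/
noncomputable def fromGround (A : CDGA k) : ground k ⟶ A :=
  FreeGCA.homOfGen A (fun x => x.elim) (fun x => x.elim) (fun x => x.elim)

/-- `S(n) = (∧ k[n], d = 0)`, with one generator, of degree `n`. -/
noncomputable def S (n : ℕ) : CDGA k :=
  FreeGCA.toCDGA (k := k) (X := Unit) (deg := fun _ => n) (fun _ => 0)
    (fun _ => Submodule.zero_mem _) (fun _ => map_zero _)

/-- The degrees of the two generators `x = false` and `y = true` of `D(m + 1)`. -/
def diskDeg (m : ℕ) : Bool → ℕ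
  | false => m
  | true => m + 1

/-- The differential of `D(m + 1)` on generators: `d x = y` and `d y = 0`. -/
noncomputable def diskD (m : ℕ) : Bool → FreeGCA k (diskDeg m)
  | false => FreeGCA.gen k (diskDeg m) true
  | true => 0

lemma diskD_mem (m : ℕ) (x : Bool) :
    diskD k m x ∈ FreeGCA.gr k (diskDeg m) (diskDeg m x + 1) := by
  cases x
  · exact FreeGCA.gen_mem true
  · exact Submodule.zero_mem _

/-- `D(0) = k`, and `D(n) = ∧ (x, y)` with `|x| = n - 1`, `|y| = n` and `d x = y` for `n > 0`. -/
noncomputable def D : ℕ → CDGA k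
  | 0 => ground k
  | m + 1 => FreeGCA.toCDGA (k := k) (X := Bool) (deg := diskDeg m) (diskD k m) (diskD_mem k m) (by
      intro x
      cases x
      · change FreeGCA.deriv _ _ (FreeGCA.gen k (diskDeg m) true) = 0
        rw [FreeGCA.deriv_gen]; rfl
      · exact map_zero _)

/-- `i_n : S(n) ⟶ D(n)` sends the generator of degree `n` to the generator `y` of degree `n` if
`n > 0`, and `i_0 : S(0) ⟶ k` sends the generator to zero. -/
noncomputable def i : ∀ n : ℕ, S k n ⟶ D k n
  | 0 => FreeGCA.homOfGen (ground k) (fun _ => 0) (fun _ => Submodule.zero_mem _)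
      (fun _ => by rw [map_zero, map_zero])
  | m + 1 => FreeGCA.homOfGen (D k (m + 1)) (fun _ => FreeGCA.gen k (diskDeg m) true)
      (fun _ => FreeGCA.gen_mem (k := k) (deg := diskDeg m) true) (fun _ => by
        rw [map_zero]
        change FreeGCA.deriv (diskD k m) (diskD_mem k m) (FreeGCA.gen k (diskDeg m) true) = 0
        rw [FreeGCA.deriv_gen]; rfl)

/-- `j_n : k ⟶ D(n)`. -/
noncomputable def j (n : ℕ) : ground k ⟶ D k n := fromGround k (D k n)

end CDGA

/-! ## Reedy (co)fibrations

The latching and the matching objects of a functor on a small category `C` with a Reedy structure,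
with inverse category `W₁` and direct category `W₂`. -/

section Reedy

variable {C : Type w} [Category.{w} C] {E : Type u} [Category.{v} E]

/-- The category `∂ (W / c)`: the non-identity morphisms `c' ⟶ c` in `W`. -/
abbrev LatchingCategory (W : MorphismProperty C) [W.IsMultiplicative] (c : C) :=
  ObjectProperty.FullSubcategory (fun f : Over (⟨c⟩ : WideSubcategory W) =>
    ¬ MorphismProperty.identities C f.hom.hom)

/-- The category `∂ (c / W)`: the non-identity morphisms `c ⟶ c'` in `W`. -/
abbrev MatchingCategory (W : MorphismProperty C) [W.IsMultiplicative] (c : C) :=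
  ObjectProperty.FullSubcategory (fun f : Under (⟨c⟩ : WideSubcategory W) =>
    ¬ MorphismProperty.identities C f.hom.hom)

/-- The functor `∂ (W / c) ⥤ C` that sends `c' ⟶ c` to `c'`. -/
def latchingFunctor (W : MorphismProperty C) [W.IsMultiplicative] (c : C) :
    LatchingCategory W c ⥤ C :=
  ObjectProperty.ι _ ⋙ Over.forget _ ⋙ wideSubcategoryInclusion W

/-- The functor `∂ (c / W) ⥤ C` that sends `c ⟶ c'` to `c'`. -/
def matchingFunctor (W : MorphismProperty C) [W.IsMultiplicative] (c : C) :
    MatchingCategory W c ⥤ C :=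
  ObjectProperty.ι _ ⋙ Under.forget _ ⋙ wideSubcategoryInclusion W

section Latching

variable (W : MorphismProperty C) [W.IsMultiplicative] [HasColimitsOfSize.{w, w} E]

/-- The latching object `L^c F`. -/
noncomputable def latchingObj (F : C ⥤ E) (c : C) : E := colimit (latchingFunctor W c ⋙ F)

/-- The latching map `L^c F ⟶ F(c)`. -/
noncomputable def latchingMap (F : C ⥤ E) (c : C) : latchingObj W F c ⟶ F.obj c :=
  colimit.desc (latchingFunctor W c ⋙ F)
    { pt := F.obj c
      ι :=
        { app := fun f => F.map f.obj.hom.hom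
          naturality := by
            intro f g φ
            have h := congrArg InducedWideCategory.Hom.hom (Over.w φ.hom)
            change F.map φ.hom.left.hom ≫ F.map g.obj.hom.hom = F.map f.obj.hom.hom ≫ 𝟙 _
            rw [Category.comp_id, ← F.map_comp]
            exact congrArg F.map h } }

/-- The map `L^c F ⟶ L^c G` induced by `φ : F ⟶ G`. -/
noncomputable def latchingObjMap {F G : C ⥤ E} (φ : F ⟶ G) (c : C) :
    latchingObj W F c ⟶ latchingObj W G c :=
  colimMap (Functor.whiskerLeft (latchingFunctor W c) φ)

lemma latchingMap_naturality {F G : C ⥤ E} (φ : F ⟶ G) (c : C) :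
    latchingMap W F c ≫ φ.app c = latchingObjMap W φ c ≫ latchingMap W G c := by
  apply colimit.hom_ext
  intro f
  unfold latchingMap latchingObjMap latchingObj
  rw [colimit.ι_desc_assoc, ι_colimMap_assoc, colimit.ι_desc]
  exact φ.naturality f.obj.hom.hom

/-- The relative latching map `F(c) ⨿_{L^c F} L^c G ⟶ G(c)`. -/
noncomputable def relativeLatchingMap [HasPushouts E] {F G : C ⥤ E} (φ : F ⟶ G) (c : C) :
    pushout (latchingMap W F c) (latchingObjMap W φ c) ⟶ G.obj c :=
  pushout.desc (φ.app c) (latchingMap W G c) (latchingMap_naturality W φ c)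

end Latching

section Matching

variable (W : MorphismProperty C) [W.IsMultiplicative] [HasLimitsOfSize.{w, w} E]

/-- The matching object `M^c F`. -/
noncomputable def matchingObj (F : C ⥤ E) (c : C) : E := limit (matchingFunctor W c ⋙ F)

/-- The matching map `F(c) ⟶ M^c F`. -/
noncomputable def matchingMap (F : C ⥤ E) (c : C) : F.obj c ⟶ matchingObj W F c :=
  limit.lift (matchingFunctor W c ⋙ F)
    { pt := F.obj c
      π :=
        { app := fun f => F.map f.obj.hom.hom
          naturality := by
            intro f g φ
            have h := congrArg InducedWideCategory.Hom.hom (Under.w φ.hom)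
            change 𝟙 _ ≫ F.map g.obj.hom.hom = F.map f.obj.hom.hom ≫ F.map φ.hom.right.hom
            rw [Category.id_comp, ← F.map_comp]
            exact congrArg F.map h.symm } }

/-- The map `M^c F ⟶ M^c G` induced by `φ : F ⟶ G`. -/
noncomputable def matchingObjMap {F G : C ⥤ E} (φ : F ⟶ G) (c : C) :
    matchingObj W F c ⟶ matchingObj W G c :=
  limMap (Functor.whiskerLeft (matchingFunctor W c) φ)

lemma matchingMap_naturality {F G : C ⥤ E} (φ : F ⟶ G) (c : C) :
    φ.app c ≫ matchingMap W G c = matchingMap W F c ≫ matchingObjMap W φ c := by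
  apply limit.hom_ext
  intro f
  unfold matchingMap matchingObjMap matchingObj
  rw [Category.assoc, Category.assoc, limit.lift_π, limMap_π, limit.lift_π_assoc]
  exact (φ.naturality f.obj.hom.hom).symm

/-- The relative matching map `F(c) ⟶ G(c) ×_{M^c G} M^c F`. -/
noncomputable def relativeMatchingMap [HasPullbacks E] {F G : C ⥤ E} (φ : F ⟶ G) (c : C) :
    F.obj c ⟶ pullback (matchingMap W G c) (matchingObjMap W φ c) :=
  pullback.lift (φ.app c) (matchingMap W F c) (matchingMap_naturality W φ c)

end Matching

variable {W₁ W₂ : MorphismProperty C} [W₁.IsMultiplicative] [W₂.IsMultiplicative]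

/-- The model structure on `C ⥤ E` is the Reedy model structure, for the Reedy structure `r` on
`C` and the model structure on `E`: weak equivalences are pointwise, cofibrations are the maps whose
relative latching maps are cofibrations, and fibrations are the maps whose relative matching maps
are fibrations. -/
structure IsReedyModelStructure [HasLimitsOfSize.{w, w} E] [HasColimitsOfSize.{w, w} E]
    [ModelCategory E] [ModelCategory (C ⥤ E)] (_r : ReedyStructure W₁ W₂ ℕ) : Prop where
  weakEquivalence_iff : ∀ {F G : C ⥤ E} (φ : F ⟶ G),
    WeakEquivalence φ ↔ ∀ c : C, WeakEquivalence (φ.app c)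
  cofibration_iff : ∀ {F G : C ⥤ E} (φ : F ⟶ G),
    Cofibration φ ↔ ∀ c : C, Cofibration (relativeLatchingMap W₂ φ c)
  fibration_iff : ∀ {F G : C ⥤ E} (φ : F ⟶ G),
    Fibration φ ↔ ∀ c : C, Fibration (relativeMatchingMap W₁ φ c)

end Reedy

/-! ## Cofibrantly generated model categories -/

/-- The model category `C` is cofibrantly generated, `I` and `J` being sets of generating
cofibrations and of generating acyclic cofibrations: both sets permit the small object argument,
the fibrations are the maps with the right lifting property with respect to `J`, and the acyclic
fibrations are those with the right lifting property with respect to `I`.  As usual in this context,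
`C` is required to have all small limits and colimits and functorial factorizations. -/
structure IsCofibrantlyGenerated (C : Type u) [Category.{v} C] [ModelCategory C]
    (I J : MorphismProperty C) : Prop where
  hasLimits : HasLimits C
  hasColimits : HasColimits C
  isSmall_I : MorphismProperty.IsSmall.{v} I
  isSmall_J : MorphismProperty.IsSmall.{v} J
  smallObjectArgument_I : MorphismProperty.HasSmallObjectArgument.{v} I
  smallObjectArgument_J : MorphismProperty.HasSmallObjectArgument.{v} J
  fibrations_eq : fibrations C = J.rlp
  trivialFibrations_eq : trivialFibrations C = I.rlp
  functorialFactorization_cof :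
    MorphismProperty.HasFunctorialFactorization (cofibrations C) (trivialFibrations C)
  functorialFactorization_fib :
    MorphismProperty.HasFunctorialFactorization (trivialCofibrations C) (fibrations C)

/-! ## Coperverse cdga's -/

/-- The linear poset of perversities `{0, …, t}` with the reverse order
`t → t - 1 → ⋯ → 1 → 0`, where `t` is the top perversity (`t = 2 n - 2` for complex varieties of
complex dimension `n`). -/
abbrev Perversity (t : ℕ) : Type := (Fin (t + 1))ᵒᵈ

/-- The Reedy structure on the poset of perversities: all maps are in the direct category, only the
identities are in the inverse category, and the degree of `p` is the length `t - p` of the longest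
chain of non-identity maps from the minimal element `t` to `p`. -/
def perversityReedy (t : ℕ) :
    ReedyStructure (MorphismProperty.identities (Perversity t)) ⊤ ℕ where
  deg p := t - (OrderDual.ofDual p).val
  lt₁ f hf hf' := absurd hf hf'
  lt₂ {p q} f _ hf' := by
    have hle : OrderDual.ofDual q ≤ OrderDual.ofDual p := leOfHom f
    have hne : OrderDual.ofDual q ≠ OrderDual.ofDual p := by
      intro h
      obtain rfl : q = p := h
      exact hf' (by rw [Subsingleton.elim f (𝟙 q)]; exact MorphismProperty.id_mem _ q)
    have hlt : (OrderDual.ofDual q).val < (OrderDual.ofDual p).val := lt_of_le_of_ne hle (fun h => hne (Fin.ext h))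
    have := (OrderDual.ofDual p).isLt
    omega
  nonempty_unique {p q} f := by
    refine ⟨⟨⟨.mk p (𝟙 p) f (by simp) (MorphismProperty.id_mem _ p) trivial⟩, ?_⟩⟩
    rintro ⟨Z, i, p', fac, hi, hp⟩
    cases hi
    obtain rfl : p' = f := by simpa using fac
    rfl

/-- The category of coperverse cdga's: functors from the poset of perversities to `CDGA_k`. -/
abbrev CoperverseCDGA (k : Type u) [Field k] (t : ℕ) := Perversity t ⥤ CDGA k

namespace CoperverseCDGA

variable (k : Type u) [Field k] (t : ℕ)

/-- The pointwise quasi-isomorphisms. -/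
def quasiIsos : MorphismProperty (CoperverseCDGA k t) := fun _ _ f =>
  ∀ p : Perversity t, CDGA.quasiIsos k (f.app p)

/-- The pointwise (degreewise) surjections. -/
def surjections : MorphismProperty (CoperverseCDGA k t) := fun _ _ f =>
  ∀ p : Perversity t, CDGA.surjections k (f.app p)

variable [HasColimits (CDGA k)]

/-- The left adjoint `F_p` of the evaluation at `p` (see `evaluationAdjunctionRight`).  The cdga
`F_p(A)_q` is the coproduct of copies of `A` indexed by the maps `p ⟶ q`: it is `A` if `p ≤ q`, and
the initial object of `CDGA_k` otherwise. -/
noncomputable def F (p : Perversity t) : CDGA k ⥤ CoperverseCDGA k t :=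
  evaluationLeftAdjoint (CDGA k) p

/-- The maps `F_p(i_n)`, for all perversities `p` and all `n`. -/
def generatingCofibrations : MorphismProperty (CoperverseCDGA k t) :=
  .ofHoms fun x : Perversity t × ℕ => (F k t x.1).map (CDGA.i k x.2)

/-- The maps `F_p(j_n)`, for all perversities `p` and all `n > 0`. -/
def generatingAcyclicCofibrations : MorphismProperty (CoperverseCDGA k t) :=
  .ofHoms fun x : Perversity t × ℕ => (F k t x.1).map (CDGA.j k (x.2 + 1))

end CoperverseCDGA

/-! Spheres and disks test everything. `S(n)` corepresents cocycles of degree `n` and `D(n + 1)`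
corepresents elements of degree `n`. Hence lifting against the maps `j` means degreewise
surjectivity, and lifting against the maps `i` means being a surjective quasi-isomorphism
(`CDGA.rlp_i_iff`). A map out of a sphere is one element subject to one equation, so it already
lives at some stage of a directed colimit (`CDGA.preservesColimit_sphere`), and the small object
argument provides functorial factorizations. Limits are built from homogeneous compatible families,
colimits come from the adjoint functor theorem.

By the retract argument (`modelCategoryOfGenerators`) a model structure exists as soon as every map
with the left lifting property against fibrations is a weak equivalence. All objects are fibrant, so
Quillen's path object argument (`llp_rlp_le_of_path`) applies to the algebra `B[t, dt]` of
polynomial forms: its evaluations at `0` and `1` are jointly surjective, and integration from `0` to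
`1` is a homotopy between them (`CDGA.cohomologyMap_pathEv`). Integration needs characteristic zero.

For coperverse cdga's, the adjunction between `F_p` and evaluation at `p` turns lifting against
`F_p(i)` into lifting of the component at `p` against `i`. Smallness passes along the same
adjunction because evaluation preserves colimits, and the path object is functorial, so it can be
formed pointwise. The same argument thus gives the projective structure together with its
generators.

For the Reedy description, the inverse category has only identities, so matching objects are
terminal and Reedy fibrations are pointwise. If all relative latching maps of `φ` are cofibrations,
lifts against a pointwise acyclic fibration are built by induction on the degree
(`exists_lift_below`). Conversely, a lifting problem for the relative latching map at `c` against
`p` is equivalent to one for `φ` against a map of diagrams that is `p` at `c` and invertible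
elsewhere (`llp_relativeLatchingMap`). -/

/-! ## Constructing cdga's from homogeneous elements of an ambient algebra -/

/-- Submodules are independent as soon as there are linear maps which are the identity on one of
them and vanish on the others. -/
lemma iSupIndep_of_proj {k : Type*} [Semiring k] {R : Type*} [AddCommMonoid R] [Module k R]
    {gr : ℕ → Submodule k R} (p : ℕ → R →ₗ[k] R) (hp : ∀ n, ∀ x ∈ gr n, p n x = x)
    (hp' : ∀ n m, m ≠ n → ∀ x ∈ gr m, p n x = 0) : iSupIndep gr := by
  intro n
  rw [Submodule.disjoint_def]
  intro x hx hx'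
  have h : ⨆ m, ⨆ (_ : m ≠ n), gr m ≤ LinearMap.ker (p n) :=
    iSup₂_le fun m hm y hy => hp' n m hm y hy
  rw [← hp n x hx]
  exact h hx'

/-- Homogeneous submodules `gr n` of an algebra `R`, with the structure of a cdga on their sum. -/
structure PreCDGA (k : Type u) [Field k] (R : Type u) [Ring R] [Algebra k R] where
  gr : ℕ → Submodule k R
  indep : iSupIndep gr
  one_mem : (1 : R) ∈ gr 0
  mul_mem : ∀ {m n : ℕ} {a b : R}, a ∈ gr m → b ∈ gr n → a * b ∈ gr (m + n)
  d : R →ₗ[k] R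
  d_mem : ∀ {n : ℕ} {a : R}, a ∈ gr n → d a ∈ gr (n + 1)
  d_d : ∀ {n : ℕ} {a : R}, a ∈ gr n → d (d a) = 0
  leibniz : ∀ {m n : ℕ} {a b : R}, a ∈ gr m → b ∈ gr n →
    d (a * b) = d a * b + (-1) ^ m * (a * d b)
  graded_comm : ∀ {m n : ℕ} {a b : R}, a ∈ gr m → b ∈ gr n → a * b = (-1) ^ (m * n) * (b * a)

namespace PreCDGA

variable {k : Type u} [Field k] {R : Type u} [Ring R] [Algebra k R] (P : PreCDGA k R)

/-- The sum of the homogeneous parts. -/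
def total : Subalgebra k R where
  carrier := (⨆ n, P.gr n : Submodule k R)
  add_mem' h h' := Submodule.add_mem _ h h'
  algebraMap_mem' r := by
    rw [Algebra.algebraMap_eq_smul_one]
    exact Submodule.smul_mem _ _ (Submodule.mem_iSup_of_mem 0 P.one_mem)
  mul_mem' {a b} ha hb := by
    have h : a * b ∈ (⨆ n, P.gr n) * (⨆ n, P.gr n) := Submodule.mul_mem_mul ha hb
    rw [Submodule.iSup_mul] at h
    simp only [Submodule.mul_iSup] at h
    refine (iSup₂_le fun m n => ?_ : (⨆ m, ⨆ n, P.gr m * P.gr n) ≤ _) h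
    rw [Submodule.mul_le]
    exact fun a ha b hb => Submodule.mem_iSup_of_mem (m + n) (P.mul_mem ha hb)

lemma mem_total {n : ℕ} {a : R} (ha : a ∈ P.gr n) : a ∈ P.total :=
  (Submodule.mem_iSup_of_mem n ha : a ∈ ⨆ n, P.gr n)

@[elab_as_elim]
lemma total_induction {p : R → Prop} {a : R} (ha : a ∈ P.total)
    (mem : ∀ n, ∀ a ∈ P.gr n, p a) (add : ∀ a b, p a → p b → p (a + b)) : p a :=
  Submodule.iSup_induction P.gr (motive := p) ha mem (mem 0 0 (zero_mem _)) add

/-- The homogeneous parts of `P.total`. -/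
def totalGr (n : ℕ) : Submodule k P.total := (P.gr n).comap P.total.val.toLinearMap

/-- Independence is inherited from the ambient algebra; the parts span because `total` is by
definition their sum. -/
lemma isInternal : DirectSum.IsInternal P.totalGr := by
  rw [DirectSum.isInternal_submodule_iff_iSupIndep_and_iSup_eq_top]
  constructor
  · have h := P.indep
    intro n
    have hn := h n
    rw [Submodule.disjoint_def] at hn ⊢
    intro x hx hx'
    refine Subtype.ext (hn x hx ?_)
    have : ⨆ m, ⨆ (_ : m ≠ n), P.totalGr m ≤
        (⨆ m, ⨆ (_ : m ≠ n), P.gr m).comap P.total.val.toLinearMap :=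
      iSup₂_le fun m hm => Submodule.comap_mono (le_iSup₂_of_le m hm le_rfl)
    exact this hx'
  · rw [eq_top_iff]
    rintro ⟨x, hx⟩ -
    have : x ∈ (⨆ n, P.totalGr n).map P.total.val.toLinearMap := by
      refine P.total_induction hx ?_ (fun a b => add_mem)
      intro n a ha
      exact ⟨⟨a, P.mem_total ha⟩, Submodule.mem_iSup_of_mem n ha, rfl⟩
    obtain ⟨y, hy, h⟩ := this
    obtain rfl : y = ⟨x, hx⟩ := Subtype.ext h
    exact hy

instance : SetLike.GradedMonoid P.totalGr where
  one_mem := P.one_mem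
  mul_mem _ _ _ _ ha hb := P.mul_mem ha hb

noncomputable instance : GradedAlgebra P.totalGr where
  toDecomposition := P.isInternal.chooseDecomposition

lemma d_mem_total {a : R} (ha : a ∈ P.total) : P.d a ∈ P.total :=
  P.total_induction (p := fun a => P.d a ∈ P.total) ha
    (fun _ _ h => P.mem_total (P.d_mem h)) (fun a b h h' => by rw [map_add]; exact add_mem h h')

/-- The cdga with the given homogeneous parts. -/
noncomputable def toCDGA : CDGA k where
  carrier := P.total
  gr := P.totalGr
  d := P.d.restrict (p := Subalgebra.toSubmodule P.total) (q := Subalgebra.toSubmodule P.total)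
    fun _ => P.d_mem_total
  d_mem h := P.d_mem h
  d_d := by
    rintro ⟨a, ha⟩
    refine Subtype.ext (?_ : P.d (P.d a) = 0)
    exact P.total_induction ha (fun _ _ h => P.d_d h) (fun a b h h' => by simp [h, h'])
  leibniz := by
    rintro n ⟨a, ha⟩ ha' ⟨b, hb⟩
    refine Subtype.ext ?_
    simp only [Subalgebra.coe_add, Subalgebra.coe_mul, Subalgebra.coe_pow, Subalgebra.coe_neg,
      Subalgebra.coe_one]
    change P.d (a * b) = P.d a * b + (-1) ^ n * (a * P.d b)
    refine P.total_induction hb (fun _ _ h => P.leibniz ha' h) (fun x y h h' => ?_)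
    rw [mul_add, map_add, h, h', map_add]
    simp only [mul_add]
    abel
  graded_comm := by
    rintro m n ⟨a, ha⟩ ⟨b, hb⟩ ha' hb'
    refine Subtype.ext ?_
    simp only [Subalgebra.coe_mul, Subalgebra.coe_pow, Subalgebra.coe_neg, Subalgebra.coe_one]
    exact P.graded_comm ha' hb'

end PreCDGA

/-! ### Homogeneous components in a cdga. -/

namespace CDGA

variable {k : Type u} [Field k]

/-- Induction on homogeneous components. -/
@[elab_as_elim]
lemma homogeneous_induction (A : CDGA k) {p : A.carrier → Prop} (a : A.carrier)
    (mem : ∀ n, ∀ a ∈ A.gr n, p a) (add : ∀ a b, p a → p b → p (a + b)) : p a :=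
  DirectSum.Decomposition.inductionOn A.gr (mem 0 0 (zero_mem _)) (fun a => mem _ _ a.2)
    (fun _ _ => add _ _) a

/-- The homogeneous components. -/
noncomputable def proj (A : CDGA k) (n : ℕ) : A.carrier →ₗ[k] A.carrier :=
  GradedAlgebra.proj A.gr n

lemma proj_of_mem (A : CDGA k) {n : ℕ} {a : A.carrier} (ha : a ∈ A.gr n) : A.proj n a = a := by
  rw [proj, GradedAlgebra.proj_apply, DirectSum.decompose_of_mem_same A.gr ha]

lemma proj_of_mem_ne (A : CDGA k) {m n : ℕ} {a : A.carrier} (ha : a ∈ A.gr m) (h : m ≠ n) :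
    A.proj n a = 0 := by
  rw [proj, GradedAlgebra.proj_apply, DirectSum.decompose_of_mem_ne A.gr ha h]

lemma proj_mem (A : CDGA k) (n : ℕ) (a : A.carrier) : A.proj n a ∈ A.gr n := by
  rw [proj, GradedAlgebra.proj_apply]
  exact Subtype.prop _

lemma d_one (A : CDGA k) : A.d 1 = 0 := by
  simpa using A.leibniz (SetLike.one_mem_graded A.gr) 1

lemma d_sign (A : CDGA k) (e : ℕ) (b : A.carrier) : A.d ((-1) ^ e * b) = (-1) ^ e * A.d b := by
  rcases neg_one_pow_eq_or A.carrier e with h | h <;> simp [h]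

lemma hom_ext_of_homogeneous {A B : CDGA k} {f g : A ⟶ B}
    (h : ∀ n, ∀ a ∈ A.gr n, f.toAlgHom a = g.toAlgHom a) : f = g := by
  ext a
  exact A.homogeneous_induction a h (fun a b ha hb => by rw [map_add, map_add, ha, hb])

@[simp] lemma id_toAlgHom (A : CDGA k) (a : A.carrier) : Hom.toAlgHom (𝟙 A) a = a := rfl

@[simp] lemma comp_toAlgHom {A B C : CDGA k} (f : A ⟶ B) (g : B ⟶ C) (a : A.carrier) :
    Hom.toAlgHom (f ≫ g) a = g.toAlgHom (f.toAlgHom a) := rfl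

lemma map_proj {A B : CDGA k} (f : A ⟶ B) (n : ℕ) (a : A.carrier) :
    f.toAlgHom (A.proj n a) = B.proj n (f.toAlgHom a) := by
  refine A.homogeneous_induction a (fun m a ha => ?_) (fun a b ha hb => by simp [ha, hb])
  by_cases h : m = n
  · subst h
    rw [A.proj_of_mem ha, B.proj_of_mem (f.map_gr ha)]
  · rw [A.proj_of_mem_ne ha h, B.proj_of_mem_ne (f.map_gr ha) h, map_zero]

end CDGA

/-! ### Morphisms into and out of a cdga of homogeneous elements. -/

namespace PreCDGA

variable {k : Type u} [Field k] {R : Type u} [Ring R] [Algebra k R] (P : PreCDGA k R)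

/-- The homogeneous element of `P.toCDGA` given by a homogeneous element of `R`. -/
def elt {n : ℕ} {a : R} (ha : a ∈ P.gr n) : P.toCDGA.carrier := (⟨a, P.mem_total ha⟩ : P.total)

/-- The inclusion in the ambient algebra. -/
def val : P.toCDGA.carrier →ₐ[k] R := P.total.val

lemma val_injective : Function.Injective P.val := Subtype.val_injective

lemma val_mem {n : ℕ} {a : P.toCDGA.carrier} : P.val a ∈ P.gr n ↔ a ∈ P.toCDGA.gr n := Iff.rfl

/-- Morphisms to `P.toCDGA`. -/
noncomputable def homTo (A : CDGA k) (f : A.carrier →ₐ[k] R)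
    (hf : ∀ {n : ℕ} {a : A.carrier}, a ∈ A.gr n → f a ∈ P.gr n)
    (hd : ∀ {n : ℕ} {a : A.carrier}, a ∈ A.gr n → f (A.d a) = P.d (f a)) : A ⟶ P.toCDGA where
  toAlgHom := f.codRestrict P.total fun a =>
    A.homogeneous_induction a (fun _ _ h => P.mem_total (hf h))
      (fun a b h h' => by rw [map_add]; exact add_mem h h')
  map_gr h := hf h
  map_d a := by
    refine Subtype.ext (?_ : f (A.d a) = P.d (f a))
    exact A.homogeneous_induction a (fun _ _ h => hd h) (fun a b h h' => by simp [h, h'])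

/-- Morphisms from `P.toCDGA`. -/
noncomputable def homFrom (A : CDGA k) (f : R →ₐ[k] A.carrier)
    (hf : ∀ {n : ℕ} {a : R}, a ∈ P.gr n → f a ∈ A.gr n)
    (hd : ∀ {n : ℕ} {a : R}, a ∈ P.gr n → f (P.d a) = A.d (f a)) : P.toCDGA ⟶ A where
  toAlgHom := f.comp P.val
  map_gr h := hf h
  map_d a := by
    refine P.toCDGA.homogeneous_induction a (fun _ a h => ?_) (fun a b h h' => ?_)
    · exact hd (P.val_mem.2 h)
    · simp only [map_add, h, h']

end PreCDGA

namespace CDGA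

variable {k : Type u} [Field k]

/-! ## Limits -/

section Limits

variable {J : Type u} [Category.{u} J] (F : J ⥤ CDGA k)

/-- The compatible families of elements of degree `n`. -/
def limitGr (n : ℕ) : Submodule k (∀ j, (F.obj j).carrier) where
  carrier := {x | (∀ j, x j ∈ (F.obj j).gr n) ∧
    ∀ ⦃i j : J⦄ (f : i ⟶ j), (F.map f).toAlgHom (x i) = x j}
  add_mem' h h' := ⟨fun j => add_mem (h.1 j) (h'.1 j), fun i j f => by simp [h.2 f, h'.2 f]⟩
  zero_mem' := ⟨fun j => zero_mem _, fun i j f => by simp⟩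
  smul_mem' c x h := ⟨fun j => Submodule.smul_mem _ c (h.1 j), fun i j f => by simp [h.2 f]⟩

/-- The limit of a diagram of cdga's consists of the sums of homogeneous compatible families. -/
noncomputable def limitPre : PreCDGA k (∀ j, (F.obj j).carrier) where
  gr := limitGr F
  indep := iSupIndep_of_proj
    (fun n => LinearMap.pi fun j => (F.obj j).proj n ∘ₗ LinearMap.proj j)
    (fun n x hx => funext fun j => (F.obj j).proj_of_mem (hx.1 j))
    (fun n m h x hx => funext fun j => (F.obj j).proj_of_mem_ne (hx.1 j) h)
  one_mem := ⟨fun j => SetLike.one_mem_graded (F.obj j).gr, fun i j f => by simp⟩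
  mul_mem h h' := ⟨fun j => SetLike.mul_mem_graded (h.1 j) (h'.1 j),
    fun i j f => by simp [h.2 f, h'.2 f]⟩
  d := LinearMap.pi fun j => (F.obj j).d ∘ₗ LinearMap.proj j
  d_mem h := ⟨fun j => (F.obj j).d_mem (h.1 j), fun i j f => by
    simpa [← h.2 f] using (F.map f).map_d _⟩
  d_d h := funext fun j => (F.obj j).d_d _
  leibniz h h' := funext fun j => (F.obj j).leibniz (h.1 j) _
  graded_comm h h' := funext fun j => (F.obj j).graded_comm (h.1 j) (h'.1 j)

/-- The limit cone. -/
noncomputable def limitCone : Cone F where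
  pt := (limitPre F).toCDGA
  π :=
    { app := fun j => (limitPre F).homFrom _ (Pi.evalAlgHom k _ j) (fun h => h.1 j) (fun h => rfl)
      naturality := fun i j f => by
        refine hom_ext_of_homogeneous fun n a ha => ?_
        exact (((limitPre F).val_mem.2 ha).2 f).symm }

/-- The limit cone is a limit cone. -/
noncomputable def isLimitLimitCone : IsLimit (limitCone F) where
  lift s := (limitPre F).homTo s.pt (AlgHom.pi fun j => (s.π.app j).toAlgHom)
    (fun {n a} h => ⟨fun j => (s.π.app j).map_gr h, fun i j f => by
      exact congrArg (fun g : s.pt ⟶ F.obj j => g.toAlgHom a) (s.w f)⟩)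
    (fun {n a} h => funext fun j => (s.π.app j).map_d a)
  fac s j := rfl
  uniq s m hm := by
    ext a
    refine (limitPre F).val_injective (funext fun j => ?_)
    exact congrArg (fun g : s.pt ⟶ F.obj j => g.toAlgHom a) (hm j)

end Limits

variable (k) in
lemma hasLimits : HasLimits (CDGA k) where
  has_limits_of_shape _ _ := ⟨fun F => ⟨⟨_, isLimitLimitCone F⟩⟩⟩

/-! ## Colimits -/

/-- Preimages may be chosen arbitrarily because `g` is constant on the fibres of `f`. Working with
fibres instead of an ideal fits the equality relation recorded in `coconeData`. -/
lemma exists_algHom_of_surjective {R S T : Type*} [Ring R] [Ring S] [Ring T] [Algebra k R]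
    [Algebra k S] [Algebra k T] (f : R →ₐ[k] S) (hf : Function.Surjective f) (g : R →ₐ[k] T)
    (h : ∀ x y, f x = f y → g x = g y) : ∃ l : S →ₐ[k] T, ∀ x, l (f x) = g x := by
  have hg : ∀ x, g (Function.surjInv hf (f x)) = g x := fun x =>
    h _ _ (Function.surjInv_eq hf (f x))
  have hg' : ∀ (s : S) (x : R), f x = s → g (Function.surjInv hf s) = g x := by
    rintro _ x rfl
    exact hg x
  refine ⟨AlgHom.ofLinearMap
    { toFun := fun s => g (Function.surjInv hf s)
      map_add' := fun s t => ?_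
      map_smul' := fun c s => ?_ } ?_ ?_, hg⟩
  · rw [← map_add]
    exact hg' _ _ (by rw [map_add, Function.surjInv_eq hf, Function.surjInv_eq hf])
  · rw [RingHom.id_apply, ← map_smul]
    exact hg' _ _ (by rw [map_smul, Function.surjInv_eq hf])
  · exact (hg' 1 1 (map_one f)).trans (map_one g)
  · intro s t
    refine (hg' (s * t) _ ?_).trans (map_mul g (Function.surjInv hf s) (Function.surjInv hf t))
    rw [map_mul, Function.surjInv_eq hf, Function.surjInv_eq hf]

section Colimits

variable {J : Type u} [Category.{u} J] (F : J ⥤ CDGA k)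

/-- The algebra morphism from the free algebra on all homogeneous elements of a diagram to the
target of a cocone. -/
noncomputable def cocomparison {A : CDGA k} (φ : F ⟶ (Functor.const J).obj A) :
    FreeAlgebra k (Σ (j : J) (n : ℕ), (F.obj j).gr n) →ₐ[k] A.carrier :=
  FreeAlgebra.lift k fun x => (φ.app x.1).toAlgHom x.2.2.1

lemma cocomparison_ι {A : CDGA k} (φ : F ⟶ (Functor.const J).obj A) {j : J} {n : ℕ}
    (a : (F.obj j).gr n) :
    cocomparison F φ (FreeAlgebra.ι k ⟨j, n, a⟩) = (φ.app j).toAlgHom a.1 := by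
  simp [cocomparison]

/-- The structure which a cocone induces on the free algebra on all homogeneous elements of
the diagram. -/
abbrev CoconeData : Type u :=
  Set (FreeAlgebra k (Σ (j : J) (n : ℕ), (F.obj j).gr n) ×
    FreeAlgebra k (Σ (j : J) (n : ℕ), (F.obj j).gr n)) ×
  (ℕ → Set (FreeAlgebra k (Σ (j : J) (n : ℕ), (F.obj j).gr n))) ×
  Set (FreeAlgebra k (Σ (j : J) (n : ℕ), (F.obj j).gr n) ×
    FreeAlgebra k (Σ (j : J) (n : ℕ), (F.obj j).gr n))

/-- The structure induced by a cocone. -/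
def coconeData {A : CDGA k} (φ : F ⟶ (Functor.const J).obj A) : CoconeData F :=
  ⟨{x | cocomparison F φ x.1 = cocomparison F φ x.2},
    fun n => {x | cocomparison F φ x ∈ A.gr n},
    {x | A.d (cocomparison F φ x.1) = cocomparison F φ x.2}⟩

/-- When the comparison map is surjective, `A` is a quotient of the free algebra, and the three sets
record its kernel relation, grading and differential. Each one in turn gives the algebra map, its
degree and its compatibility with `d`. -/
lemma exists_hom_of_coconeData_eq {A B : CDGA k} (φ : F ⟶ (Functor.const J).obj A)
    (ψ : F ⟶ (Functor.const J).obj B) (hφ : Function.Surjective (cocomparison F φ))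
    (h : coconeData F φ = coconeData F ψ) :
    ∃ f : A ⟶ B, φ ≫ (Functor.const J).map f = ψ := by
  simp only [coconeData, Prod.mk.injEq] at h
  obtain ⟨h1, h2, h3⟩ := h
  have h1 : ∀ x y, cocomparison F φ x = cocomparison F φ y ↔
    cocomparison F ψ x = cocomparison F ψ y := fun x y => Set.ext_iff.1 h1 (x, y)
  have h2 : ∀ n x, cocomparison F φ x ∈ A.gr n ↔ cocomparison F ψ x ∈ B.gr n := fun n x =>
    Set.ext_iff.1 (congrFun h2 n) x
  have h3 : ∀ x y, A.d (cocomparison F φ x) = cocomparison F φ y ↔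
    B.d (cocomparison F ψ x) = cocomparison F ψ y := fun x y => Set.ext_iff.1 h3 (x, y)
  obtain ⟨f, hf⟩ := exists_algHom_of_surjective (cocomparison F φ) hφ (cocomparison F ψ)
    (fun x y => (h1 x y).1)
  refine ⟨⟨f, ?_, ?_⟩, ?_⟩
  · intro n a ha
    obtain ⟨x, rfl⟩ := hφ a
    rw [hf]
    exact (h2 n x).1 ha
  · intro a
    obtain ⟨x, rfl⟩ := hφ a
    obtain ⟨y, hy⟩ := hφ (A.d (cocomparison F φ x))
    rw [hf, ← hy, hf]
    exact ((h3 x y).1 hy.symm).symm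
  · ext j : 2
    refine hom_ext_of_homogeneous fun n a ha => ?_
    have := hf (FreeAlgebra.ι k ⟨j, n, ⟨a, ha⟩⟩)
    rw [cocomparison_ι, cocomparison_ι] at this
    exact this

/-- The homogeneous elements in the image of a cocone. -/
def coconeImage {A : CDGA k} (φ : F ⟶ (Functor.const J).obj A) : Set A.carrier :=
  {a | ∃ (j : J) (n : ℕ), ∃ b ∈ (F.obj j).gr n, (φ.app j).toAlgHom b = a}

lemma adjoin_coconeImage_d {A : CDGA k} (φ : F ⟶ (Functor.const J).obj A) {a : A.carrier}
    (ha : a ∈ Algebra.adjoin k (coconeImage F φ)) :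
    A.d a ∈ Algebra.adjoin k (coconeImage F φ) := by
  rw [← Subalgebra.mem_toSubmodule, Algebra.adjoin_eq_span] at ha
  induction ha using Submodule.span_induction with
  | zero => simp
  | add x y _ _ hx hy => rw [map_add]; exact add_mem hx hy
  | smul c x _ hx => rw [map_smul]; exact Subalgebra.smul_mem _ hx c
  | mem x hx =>
    -- Homogeneity is carried through the induction because the Leibniz rule requires the degree of
    -- the left factor.
    have : A.d x ∈ Algebra.adjoin k (coconeImage F φ) ∧ ∃ n, x ∈ A.gr n := by
      induction hx using Submonoid.closure_induction with
      | mem x hx =>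
        obtain ⟨j, n, b, hb, rfl⟩ := hx
        refine ⟨Algebra.subset_adjoin ⟨j, n + 1, _, (F.obj j).d_mem hb, (φ.app j).map_d b⟩,
          n, (φ.app j).map_gr hb⟩
      | one => exact ⟨by rw [d_one]; exact zero_mem _, 0, SetLike.one_mem_graded A.gr⟩
      | mul x y hx hy ihx ihy =>
        obtain ⟨hdx, m, hm⟩ := ihx
        obtain ⟨hdy, n, hn⟩ := ihy
        have hs : ∀ {z}, z ∈ Submonoid.closure (coconeImage F φ) →
            z ∈ Algebra.adjoin k (coconeImage F φ) := fun hz => by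
          rw [← Subalgebra.mem_toSubmodule, Algebra.adjoin_eq_span]
          exact Submodule.subset_span hz
        refine ⟨?_, m + n, SetLike.mul_mem_graded hm hn⟩
        rw [A.leibniz hm]
        refine add_mem (mul_mem hdx (hs hy)) (mul_mem ?_ (mul_mem (hs hx) hdy))
        exact pow_mem (neg_mem (one_mem _)) _
    exact this.1

/-- The cdga generated by the image of a cocone. -/
noncomputable def coconePre {A : CDGA k} (φ : F ⟶ (Functor.const J).obj A) :
    PreCDGA k A.carrier where
  gr n := A.gr n ⊓ Subalgebra.toSubmodule (Algebra.adjoin k (coconeImage F φ))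
  indep := iSupIndep_of_proj A.proj (fun _ _ hx => A.proj_of_mem hx.1)
    (fun _ _ h _ hx => A.proj_of_mem_ne hx.1 h)
  one_mem := ⟨SetLike.one_mem_graded A.gr, one_mem (Algebra.adjoin k (coconeImage F φ))⟩
  mul_mem h h' := ⟨SetLike.mul_mem_graded h.1 h'.1,
    mul_mem (S := Subalgebra k A.carrier) h.2 h'.2⟩
  d := A.d
  d_mem h := ⟨A.d_mem h.1, adjoin_coconeImage_d F φ h.2⟩
  d_d _ := A.d_d _
  leibniz h _ := A.leibniz h.1 _
  graded_comm h h' := A.graded_comm h.1 h'.1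

/-- Every cocone factors through the sub-cdga generated by its image, and for that cocone the
comparison map is onto. -/
lemma exists_surjective_cocomparison {A : CDGA k} (φ : F ⟶ (Functor.const J).obj A) :
    ∃ (B : CDGA k) (ψ : F ⟶ (Functor.const J).obj B) (f : B ⟶ A),
      Function.Surjective (cocomparison F ψ) ∧ ψ ≫ (Functor.const J).map f = φ := by
  let P := coconePre F φ
  have hmem : ∀ (j : J) {n : ℕ} {a : (F.obj j).carrier}, a ∈ (F.obj j).gr n →
      (φ.app j).toAlgHom a ∈ P.gr n := fun j n a ha =>
    ⟨(φ.app j).map_gr ha, Algebra.subset_adjoin ⟨j, n, a, ha, rfl⟩⟩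
  let ψ : F ⟶ (Functor.const J).obj P.toCDGA :=
    { app := fun j => P.homTo (F.obj j) (φ.app j).toAlgHom (hmem j)
        (fun {n a} _ => (φ.app j).map_d a)
      naturality := fun i j f => by
        ext a
        refine P.val_injective ?_
        exact congrArg (fun g : F.obj i ⟶ A => g.toAlgHom a) (φ.naturality f) }
  let f : P.toCDGA ⟶ A := P.homFrom A (AlgHom.id k _) (fun h => h.1) (fun _ => rfl)
  refine ⟨P.toCDGA, ψ, f, ?_, ?_⟩
  · have hval : ∀ x, P.val (cocomparison F ψ x) = cocomparison F φ x := by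
      intro x
      change (P.val.comp (cocomparison F ψ)) x = _
      congr 1
      apply FreeAlgebra.hom_ext
      funext x
      simp only [Function.comp_apply, AlgHom.comp_apply]
      rw [cocomparison_ι, cocomparison_ι]
      rfl
    intro b
    suffices h : ∃ x, cocomparison F φ x = P.val b by
      obtain ⟨x, hx⟩ := h
      exact ⟨x, P.val_injective (by rw [hval, hx])⟩
    refine P.toCDGA.homogeneous_induction b (fun n b hb => ?_) ?_
    · have hb' : P.val b ∈ Algebra.adjoin k (coconeImage F φ) := hb.2
      refine (Algebra.adjoin_le (S := (cocomparison F φ).range) ?_ hb' :)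
      rintro _ ⟨j, n, a, ha, rfl⟩
      exact ⟨FreeAlgebra.ι k ⟨j, n, ⟨a, ha⟩⟩, cocomparison_ι F φ _⟩
    · rintro a b ⟨x, hx⟩ ⟨y, hy⟩
      exact ⟨x + y, by rw [map_add, map_add, hx, hy]⟩
  · ext j : 2
    rfl

/-- The data that a cocone induces on the free algebra range over a type in universe `u`. One
representative for each datum realized by a surjective comparison map is therefore a solution set.
-/
lemma solutionSetCondition_const (J : Type u) [Category.{u} J] :
    SolutionSetCondition.{u} (Functor.const J : CDGA k ⥤ J ⥤ CDGA k) := by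
  intro F
  let ι : Type u := {d : CoconeData F // ∃ (B : CDGA k) (ψ : F ⟶ (Functor.const J).obj B),
    Function.Surjective (cocomparison F ψ) ∧ coconeData F ψ = d}
  refine ⟨ι, fun d => d.2.choose, fun d => d.2.choose_spec.choose, fun A φ => ?_⟩
  obtain ⟨B, ψ, f, hψ, rfl⟩ := exists_surjective_cocomparison F φ
  let d : ι := ⟨coconeData F ψ, B, ψ, hψ, rfl⟩
  obtain ⟨h1, h2⟩ := d.2.choose_spec.choose_spec
  obtain ⟨g, hg⟩ := exists_hom_of_coconeData_eq F _ ψ h1 h2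
  exact ⟨d, g ≫ f, by rw [Functor.map_comp, reassoc_of% hg]⟩

end Colimits

-- Colimits of shape `J` amount to a left adjoint of the constant diagram functor, which the general
-- adjoint functor theorem supplies: all limits exist and this functor preserves them.
variable (k) in
lemma hasColimits : HasColimits (CDGA k) where
  has_colimits_of_shape J _ := by
    have := hasLimits k
    rw [hasColimitsOfShape_iff_isRightAdjoint_const]
    exact isRightAdjoint_of_preservesLimits_of_solutionSetCondition _
      (solutionSetCondition_const J)

end CDGA

/-! ### The universal property of semifree cdga's. -/

namespace FreeGCA

variable {k : Type u} [Field k] {X : Type} {deg : X → ℕ} {δ : X → FreeGCA k deg}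
  {hδ : ∀ x, δ x ∈ gr k deg (deg x + 1)} {hδδ : ∀ x, deriv δ hδ (δ x) = 0}

lemma homOfGen_gen (B : CDGA k) (φ : X → B.carrier) (hφ : ∀ x, φ x ∈ B.gr (deg x))
    (hd : ∀ x, B.d (φ x) = lift φ (fun x y => B.graded_comm (hφ x) (hφ y)) (δ x)) (x : X) :
    (homOfGen (hδδ := hδδ) B φ hφ hd).toAlgHom (gen k deg x) = φ x :=
  lift_gen φ (fun x y => B.graded_comm (hφ x) (hφ y)) x

lemma toCDGA_hom_ext {B : CDGA k} {f g : toCDGA δ hδ hδδ ⟶ B}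
    (h : ∀ x, f.toAlgHom (gen k deg x) = g.toAlgHom (gen k deg x)) : f = g :=
  CDGA.hom_ext (algHom_ext h)

end FreeGCA

namespace CDGA

variable {k : Type u} [Field k]

/-! ## Morphisms from spheres and disks -/

variable (k) in
/-- The ground field is the initial cdga. -/
noncomputable def groundIsInitial : IsInitial (ground k) :=
  IsInitial.ofUniqueHom (fun A => fromGround k A)
    (fun _ _ => FreeGCA.toCDGA_hom_ext fun x => x.elim)

variable (k) in
/-- `D(0)` is the initial cdga. -/
noncomputable def diskZeroIsInitial : IsInitial (D k 0) := groundIsInitial k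

variable (k) in
lemma deriv_diskD (n : ℕ) (x : Bool) :
    FreeGCA.deriv (diskD k n) (diskD_mem k n) (diskD k n x) = 0 := by
  cases x
  · change FreeGCA.deriv _ _ (FreeGCA.gen k (diskDeg n) true) = 0
    rw [FreeGCA.deriv_gen]
    rfl
  · exact map_zero _

variable (k) in
/-- The generator of `S(n)`. -/
noncomputable def sphereGen (n : ℕ) : (S k n).carrier := FreeGCA.gen k (fun _ : Unit => n) ()

variable (k) in
/-- The generator of degree `n` of `D(n + 1)`. -/
noncomputable def diskGen (n : ℕ) : (D k (n + 1)).carrier := FreeGCA.gen k (diskDeg n) false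

lemma sphereGen_mem (n : ℕ) : sphereGen k n ∈ (S k n).gr n :=
  FreeGCA.gen_mem (k := k) (deg := fun _ : Unit => n) ()

lemma d_sphereGen (n : ℕ) : (S k n).d (sphereGen k n) = 0 :=
  FreeGCA.deriv_gen _ _ _

lemma diskGen_mem (n : ℕ) : diskGen k n ∈ (D k (n + 1)).gr n :=
  FreeGCA.gen_mem (k := k) (deg := diskDeg n) false

lemma d_diskGen (n : ℕ) :
    (D k (n + 1)).d (diskGen k n) = FreeGCA.gen k (diskDeg n) true :=
  FreeGCA.deriv_gen _ _ _

lemma i_succ_sphereGen (n : ℕ) :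
    (i k (n + 1)).toAlgHom (sphereGen k (n + 1)) = (D k (n + 1)).d (diskGen k n) := by
  rw [d_diskGen]
  exact FreeGCA.lift_gen (fun _ : Unit => FreeGCA.gen k (diskDeg n) true)
    (fun _ _ => FreeGCA.gen_mul_gen k (diskDeg n) true true) ()

lemma i_zero_sphereGen : (i k 0).toAlgHom (sphereGen k 0) = 0 :=
  FreeGCA.lift_gen (fun _ : Unit => (0 : (ground k).carrier))
    (fun _ _ => by simp) ()

lemma sphere_hom_ext {n : ℕ} {A : CDGA k} {f g : S k n ⟶ A}
    (h : f.toAlgHom (sphereGen k n) = g.toAlgHom (sphereGen k n)) : f = g :=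
  FreeGCA.toCDGA_hom_ext fun _ => h

lemma disk_hom_ext {n : ℕ} {A : CDGA k} {f g : D k (n + 1) ⟶ A}
    (h : f.toAlgHom (diskGen k n) = g.toAlgHom (diskGen k n)) : f = g := by
  refine FreeGCA.toCDGA_hom_ext (hδδ := deriv_diskD k n) fun x => ?_
  cases x
  · exact h
  · have := congrArg A.d h
    rw [← f.map_d, ← g.map_d, d_diskGen] at this
    exact this

/-- The morphism `S(n) ⟶ A` given by a cocycle of degree `n`. -/
noncomputable def sphereHom {n : ℕ} (A : CDGA k) (a : A.carrier) (ha : a ∈ A.gr n)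
    (hd : A.d a = 0) : S k n ⟶ A :=
  FreeGCA.homOfGen A (fun _ => a) (fun _ => ha) (fun _ => by rw [map_zero, hd])

@[simp]
lemma sphereHom_gen {n : ℕ} (A : CDGA k) (a : A.carrier) (ha : a ∈ A.gr n) (hd : A.d a = 0) :
    (sphereHom A a ha hd).toAlgHom (sphereGen k n) = a :=
  FreeGCA.homOfGen_gen _ _ _ _ _

/-- The images of the generators under the morphism `D(n + 1) ⟶ A` given by `a`. -/
def diskImage (A : CDGA k) (a : A.carrier) (x : Bool) : A.carrier := cond x (A.d a) a

lemma diskImage_mem {n : ℕ} (A : CDGA k) {a : A.carrier} (ha : a ∈ A.gr n) (x : Bool) :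
    A.diskImage a x ∈ A.gr (diskDeg n x) := by
  cases x
  · exact ha
  · exact A.d_mem ha

lemma d_diskImage {n : ℕ} (A : CDGA k) {a : A.carrier} (ha : a ∈ A.gr n) (x : Bool) :
    A.d (A.diskImage a x) = FreeGCA.lift (A.diskImage a)
      (fun x y => A.graded_comm (A.diskImage_mem ha x) (A.diskImage_mem ha y)) (diskD k n x) := by
  cases x
  · exact (FreeGCA.lift_gen (A.diskImage a) _ true).symm
  · exact (A.d_d a).trans (map_zero _).symm

/-- The morphism `D(n + 1) ⟶ A` given by an element of degree `n`. -/
noncomputable def diskHom {n : ℕ} (A : CDGA k) (a : A.carrier) (ha : a ∈ A.gr n) :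
    D k (n + 1) ⟶ A :=
  FreeGCA.homOfGen (hδδ := deriv_diskD k n) A (A.diskImage a) (A.diskImage_mem ha)
    (A.d_diskImage ha)

@[simp]
lemma diskHom_gen {n : ℕ} (A : CDGA k) (a : A.carrier) (ha : a ∈ A.gr n) :
    (diskHom A a ha).toAlgHom (diskGen k n) = a :=
  FreeGCA.lift_gen (deg := diskDeg n) (A.diskImage a)
    (fun x y => A.graded_comm (A.diskImage_mem ha x) (A.diskImage_mem ha y)) false

/-! ## The lifting properties -/

/-- The source of `j` is initial, so a square is just an element `b` of degree `n`, and a lift is a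
preimage of it. -/
lemma hasLiftingProperty_j_iff {A B : CDGA k} (f : A ⟶ B) (n : ℕ) :
    HasLiftingProperty (j k (n + 1)) f ↔ ∀ b ∈ B.gr n, ∃ a ∈ A.gr n, f.toAlgHom a = b := by
  constructor
  · intro h b hb
    have sq : CommSq (fromGround k A) (j k (n + 1)) f (diskHom B b hb) :=
      ⟨(groundIsInitial k).hom_ext _ _⟩
    refine ⟨sq.lift.toAlgHom (diskGen k n), sq.lift.map_gr (diskGen_mem n), ?_⟩
    rw [← comp_toAlgHom, sq.fac_right, diskHom_gen]
  · intro h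
    refine ⟨fun {s t} sq => ?_⟩
    obtain ⟨a, ha, hab⟩ := h _ (t.map_gr (diskGen_mem n))
    refine ⟨⟨⟨diskHom A a ha, (groundIsInitial k).hom_ext _ _, disk_hom_ext ?_⟩⟩⟩
    rw [comp_toAlgHom, diskHom_gen, hab]

/-- Since `D(0)` is initial, a square is a cocycle of degree `0` killed by `f`, and a lift exists
exactly when that cocycle vanishes. -/
lemma hasLiftingProperty_i_zero_iff {A B : CDGA k} (f : A ⟶ B) :
    HasLiftingProperty (i k 0) f ↔
      ∀ a ∈ A.gr 0, A.d a = 0 → f.toAlgHom a = 0 → a = 0 := by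
  constructor
  · intro h a ha hd h0
    have sq : CommSq (sphereHom A a ha hd) (i k 0) f
        ((diskZeroIsInitial k).to B) := ⟨sphere_hom_ext (by
      rw [comp_toAlgHom, comp_toAlgHom, i_zero_sphereGen, sphereHom_gen, h0, map_zero])⟩
    have := congrArg (fun g : S k 0 ⟶ A => g.toAlgHom (sphereGen k 0)) sq.fac_left
    simpa only [comp_toAlgHom, i_zero_sphereGen, sphereHom_gen, map_zero, eq_comm] using this
  · intro h
    refine ⟨fun {s t} sq => ?_⟩
    have h0 := congrArg (fun g : S k 0 ⟶ B => g.toAlgHom (sphereGen k 0)) sq.w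
    simp only [comp_toAlgHom, i_zero_sphereGen, map_zero] at h0
    have := h _ (s.map_gr (sphereGen_mem 0)) (by rw [← s.map_d, d_sphereGen, map_zero]) h0
    refine ⟨⟨⟨(diskZeroIsInitial k).to A, sphere_hom_ext ?_, (diskZeroIsInitial k).hom_ext _ _⟩⟩⟩
    rw [comp_toAlgHom, i_zero_sphereGen, map_zero, this]

/-- A square is a cocycle `a` with a primitive `b` of its image; a lift is a primitive of `a` lying
over `b`. -/
lemma hasLiftingProperty_i_succ_iff {A B : CDGA k} (f : A ⟶ B) (n : ℕ) :
    HasLiftingProperty (i k (n + 1)) f ↔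
      ∀ a ∈ A.gr (n + 1), A.d a = 0 → ∀ b ∈ B.gr n, B.d b = f.toAlgHom a →
        ∃ x ∈ A.gr n, A.d x = a ∧ f.toAlgHom x = b := by
  constructor
  · intro h a ha hd b hb hab
    have sq : CommSq (sphereHom A a ha hd) (i k (n + 1)) f (diskHom B b hb) :=
      ⟨sphere_hom_ext (by
        rw [comp_toAlgHom, comp_toAlgHom, i_succ_sphereGen, sphereHom_gen, Hom.map_d,
          diskHom_gen, hab])⟩
    refine ⟨sq.lift.toAlgHom (diskGen k n), sq.lift.map_gr (diskGen_mem n), ?_, ?_⟩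
    · rw [← Hom.map_d, ← i_succ_sphereGen, ← comp_toAlgHom, sq.fac_left, sphereHom_gen]
    · rw [← comp_toAlgHom, sq.fac_right, diskHom_gen]
  · intro h
    refine ⟨fun {s t} sq => ?_⟩
    have h0 := congrArg (fun g : S k (n + 1) ⟶ B => g.toAlgHom (sphereGen k (n + 1))) sq.w
    simp only [comp_toAlgHom, i_succ_sphereGen, Hom.map_d] at h0
    obtain ⟨x, hx, hxa, hxb⟩ := h _ (s.map_gr (sphereGen_mem (n + 1)))
      (by rw [← s.map_d, d_sphereGen, map_zero]) _ (t.map_gr (diskGen_mem n)) h0.symm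
    refine ⟨⟨⟨diskHom A x hx, sphere_hom_ext ?_, disk_hom_ext ?_⟩⟩⟩
    · rw [comp_toAlgHom, i_succ_sphereGen, Hom.map_d, diskHom_gen, hxa]
    · rw [comp_toAlgHom, diskHom_gen, hxb]

/-! ## Quasi-isomorphisms -/

lemma d_proj (A : CDGA k) (n : ℕ) (a : A.carrier) : A.d (A.proj n a) = A.proj (n + 1) (A.d a) := by
  refine A.homogeneous_induction a (fun m a ha => ?_) (fun a b ha hb => by simp [ha, hb])
  by_cases h : m = n
  · subst h
    rw [A.proj_of_mem ha, A.proj_of_mem (A.d_mem ha)]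
  · rw [A.proj_of_mem_ne ha h, A.proj_of_mem_ne (A.d_mem ha) (by simpa using h), map_zero]

/-- The definition of coboundaries admits primitives of mixed degree. Their component of degree `n`
is still a primitive. -/
lemma exists_mem_of_d_eq (A : CDGA k) {n : ℕ} {a b : A.carrier} (hb : b ∈ A.gr (n + 1))
    (h : A.d a = b) : ∃ a' ∈ A.gr n, A.d a' = b :=
  ⟨A.proj n a, A.proj_mem n a, by rw [d_proj, h, A.proj_of_mem hb]⟩

/-- There is nothing in degree `-1`, so degree `0` contains no nonzero coboundary. This is what
makes degree zero special in `rlp_i_iff`. -/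
lemma eq_zero_of_d_eq (A : CDGA k) {a b : A.carrier} (hb : b ∈ A.gr 0) (h : A.d a = b) :
    b = 0 := by
  rw [← A.proj_of_mem hb, ← h]
  refine A.homogeneous_induction a (fun m a ha => ?_) (fun a b ha hb => by simp [ha, hb])
  exact A.proj_of_mem_ne (A.d_mem ha) (by simp)

lemma cohomologyMap_mk {A B : CDGA k} (f : A ⟶ B) (n : ℕ) (a : A.cocycles n) :
    cohomologyMap f n (Submodule.Quotient.mk a) = Submodule.Quotient.mk (cocyclesMap f n a) := rfl

lemma injective_cohomologyMap_iff {A B : CDGA k} (f : A ⟶ B) (n : ℕ) :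
    Function.Injective (cohomologyMap f n) ↔ ∀ a ∈ A.gr n, A.d a = 0 →
      (∃ b, B.d b = f.toAlgHom a) → ∃ a', A.d a' = a := by
  rw [injective_iff_map_eq_zero]
  constructor
  · intro h a ha hd hb
    have := h (Submodule.Quotient.mk ⟨a, ha, hd⟩) (by
      rw [cohomologyMap_mk, Submodule.Quotient.mk_eq_zero]
      exact hb)
    rwa [Submodule.Quotient.mk_eq_zero] at this
  · intro h x
    obtain ⟨⟨a, ha, hd⟩, rfl⟩ := Submodule.Quotient.mk_surjective _ x
    rw [cohomologyMap_mk, Submodule.Quotient.mk_eq_zero, Submodule.Quotient.mk_eq_zero]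
    exact h a ha hd

lemma surjective_cohomologyMap_iff {A B : CDGA k} (f : A ⟶ B) (n : ℕ) :
    Function.Surjective (cohomologyMap f n) ↔ ∀ b ∈ B.gr n, B.d b = 0 →
      ∃ a ∈ A.gr n, A.d a = 0 ∧ ∃ b', B.d b' = f.toAlgHom a - b := by
  constructor
  · intro h b hb hd
    obtain ⟨x, hx⟩ := h (Submodule.Quotient.mk ⟨b, hb, hd⟩)
    obtain ⟨⟨a, ha, hda⟩, rfl⟩ := Submodule.Quotient.mk_surjective _ x
    rw [cohomologyMap_mk, Submodule.Quotient.eq] at hx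
    exact ⟨a, ha, hda, hx⟩
  · intro h x
    obtain ⟨⟨b, hb, hd⟩, rfl⟩ := Submodule.Quotient.mk_surjective _ x
    obtain ⟨a, ha, hda, hab⟩ := h b hb hd
    refine ⟨Submodule.Quotient.mk ⟨a, ha, hda⟩, ?_⟩
    rw [cohomologyMap_mk, Submodule.Quotient.eq]
    exact hab

lemma cohomologyMap_id (A : CDGA k) (n : ℕ) : cohomologyMap (𝟙 A) n = LinearMap.id := by
  ext x
  rfl

lemma cohomologyMap_comp {A B C : CDGA k} (f : A ⟶ B) (g : B ⟶ C) (n : ℕ) :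
    cohomologyMap (f ≫ g) n = cohomologyMap g n ∘ₗ cohomologyMap f n := by
  ext x
  rfl

instance : (quasiIsos k).HasTwoOutOfThreeProperty where
  comp_mem f g hf hg n := by
    rw [cohomologyMap_comp, LinearMap.coe_comp]
    exact (hg n).comp (hf n)
  of_postcomp f g hg h n := by
    have := h n
    rw [cohomologyMap_comp, LinearMap.coe_comp] at this
    exact (Function.Bijective.of_comp_iff' (hg n) _).1 this
  of_precomp f g hf h n := by
    have := h n
    rw [cohomologyMap_comp, LinearMap.coe_comp] at this
    exact (Function.Bijective.of_comp_iff _ (hf n)).1 this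

/-- Degree by degree, lifting a primitive of a cocycle combines injectivity and surjectivity on
cohomology with surjectivity of `f`. Conversely, lifting over the zero cocycle already gives
surjectivity on cocycles. -/
lemma rlp_i_iff {A B : CDGA k} (f : A ⟶ B) :
    (∀ n, HasLiftingProperty (i k n) f) ↔ quasiIsos k f ∧ surjections k f := by
  constructor
  · intro h
    have h0 := (hasLiftingProperty_i_zero_iff f).1 (h 0)
    have h1 := fun n => (hasLiftingProperty_i_succ_iff f n).1 (h (n + 1))
    have hcocycle : ∀ n, ∀ b ∈ B.gr n, B.d b = 0 →
        ∃ a ∈ A.gr n, A.d a = 0 ∧ f.toAlgHom a = b := fun n b hb hd =>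
      h1 n 0 (zero_mem _) (map_zero _) b hb (by rw [hd, map_zero])
    refine ⟨fun n => ⟨?_, ?_⟩, fun n b hb => ?_⟩
    · rw [injective_cohomologyMap_iff]
      rintro a ha hd ⟨b, hb⟩
      cases n with
      | zero =>
        have := B.eq_zero_of_d_eq (f.map_gr ha) hb
        exact ⟨0, by rw [map_zero, h0 a ha hd this]⟩
      | succ n =>
        obtain ⟨b', hb', h'⟩ := B.exists_mem_of_d_eq (f.map_gr ha) hb
        obtain ⟨x, -, hx, -⟩ := h1 n a ha hd b' hb' h'
        exact ⟨x, hx⟩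
    · rw [surjective_cohomologyMap_iff]
      intro b hb hd
      obtain ⟨a, ha, hda, hab⟩ := hcocycle n b hb hd
      exact ⟨a, ha, hda, 0, by rw [hab, map_zero, sub_self]⟩
    -- An arbitrary `b` is lifted in two steps: first its differential to a cocycle `a`, then `b`
    -- itself to a primitive of `a`.
    · obtain ⟨a, ha, hda, hab⟩ := hcocycle (n + 1) (B.d b) (B.d_mem hb) (B.d_d b)
      obtain ⟨x, hx, -, hxb⟩ := h1 n a ha hda b hb hab.symm
      exact ⟨x, hx, hxb⟩
  · rintro ⟨hq, hs⟩ n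
    cases n with
    | zero =>
      rw [hasLiftingProperty_i_zero_iff]
      intro a ha hd h
      obtain ⟨a', ha'⟩ := (injective_cohomologyMap_iff f 0).1 (hq 0).1 a ha hd
        ⟨0, by rw [h, map_zero]⟩
      exact A.eq_zero_of_d_eq ha ha'
    | succ n =>
      rw [hasLiftingProperty_i_succ_iff]
      intro a ha hd b hb hab
      obtain ⟨a₀, ha₀⟩ := (injective_cohomologyMap_iff f (n + 1)).1 (hq (n + 1)).1 a ha hd ⟨b, hab⟩
      obtain ⟨a₁, hm₁, ha₁⟩ := A.exists_mem_of_d_eq ha ha₀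
      -- The primitive `a₁` of `a` need not lie over `b`, but the error is a cocycle, so it suffices
      -- to lift that error to a cocycle.
      have hdb : B.d (b - f.toAlgHom a₁) = 0 := by
        rw [map_sub, ← f.map_d, ha₁, hab, sub_self]
      have hmb : b - f.toAlgHom a₁ ∈ B.gr n := sub_mem hb (f.map_gr hm₁)
      obtain ⟨c, hc, hdc, e, he⟩ := (surjective_cohomologyMap_iff f n).1 (hq n).2 _ hmb hdb
      have hme : f.toAlgHom c - (b - f.toAlgHom a₁) ∈ B.gr n := sub_mem (f.map_gr hc) hmb
      -- Cohomology provides a lift `c` up to a coboundary. In degree `0` that coboundary is zero;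
      -- otherwise its primitive is lifted by surjectivity and `c` is corrected.
      have key : ∃ y ∈ A.gr n, A.d y = 0 ∧ f.toAlgHom y = b - f.toAlgHom a₁ := by
        cases n with
        | zero =>
          have := B.eq_zero_of_d_eq hme he
          exact ⟨c, hc, hdc, sub_eq_zero.1 this⟩
        | succ n =>
          obtain ⟨e', hme', he'⟩ := B.exists_mem_of_d_eq hme he
          obtain ⟨z, hz, rfl⟩ := hs n e' hme'
          refine ⟨c - A.d z, sub_mem hc (A.d_mem hz), ?_, ?_⟩
          · rw [map_sub, hdc, A.d_d, sub_zero]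
          · rw [map_sub, f.map_d, he', sub_sub_cancel]
      obtain ⟨y, hy, hdy, hfy⟩ := key
      refine ⟨a₁ + y, add_mem hm₁ hy, ?_, ?_⟩
      · rw [map_add, ha₁, hdy, add_zero]
      · rw [map_add, hfy, add_sub_cancel]

end CDGA

namespace CDGA

variable {k : Type u} [Field k]

/-! ## Directed colimits -/

section DirectedColimits

variable {J : Type u} [Preorder J] (F : J ⥤ CDGA k)

/-- The transition maps of a directed system of cdga's. -/
def transition (i j : J) (h : i ≤ j) : (F.obj i).carrier →ₐ[k] (F.obj j).carrier :=
  (F.map (homOfLE h)).toAlgHom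

lemma transition_mem {i j : J} (h : i ≤ j) {n : ℕ} {a : (F.obj i).carrier}
    (ha : a ∈ (F.obj i).gr n) : transition F i j h a ∈ (F.obj j).gr n :=
  (F.map (homOfLE h)).map_gr ha

instance : DirectedSystem (fun j => (F.obj j).carrier) (fun i j h => transition F i j h) where
  map_self i x := by
    change (F.map (𝟙 i)).toAlgHom x = x
    rw [F.map_id]
    rfl
  map_map l j i h h' x := by
    change (F.map (homOfLE h) ≫ F.map (homOfLE h')).toAlgHom x = _
    rw [← F.map_comp]
    rfl

variable [IsDirectedOrder J] [Nonempty J]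

/-- The colimit of the underlying algebras. -/
abbrev DirLim : Type u := DirectLimit (fun j => (F.obj j).carrier) (transition F)

/-- The canonical morphisms to the colimit of the underlying algebras. -/
noncomputable def dirLimOf (j : J) : (F.obj j).carrier →ₐ[k] DirLim F :=
  DirectLimit.Algebra.of (fun j => (F.obj j).carrier) (transition F) j

lemma dirLimOf_transition {i j : J} (h : i ≤ j) (a : (F.obj i).carrier) :
    dirLimOf F j (transition F i j h a) = dirLimOf F i a :=
  DirectLimit.Algebra.of_f (G := fun j => (F.obj j).carrier) (f := transition F) h a

lemma dirLimOf_eq_zero {j : J} {a : (F.obj j).carrier} (h : dirLimOf F j a = 0) :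
    ∃ (l : J) (hl : j ≤ l), transition F j l hl a = 0 := by
  rw [← map_zero (dirLimOf F j)] at h
  obtain ⟨l, h1, h2, hl⟩ := Quotient.eq.mp h
  exact ⟨l, h1, by simpa using hl⟩

/-- The homogeneous elements of degree `n` of the colimit. -/
def dirLimGr (n : ℕ) : Submodule k (DirLim F) where
  carrier := {x | ∃ (j : J), ∃ a ∈ (F.obj j).gr n, dirLimOf F j a = x}
  zero_mem' := ⟨Classical.arbitrary J, 0, zero_mem _, map_zero _⟩
  add_mem' := by
    rintro _ _ ⟨i, a, ha, rfl⟩ ⟨j, b, hb, rfl⟩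
    obtain ⟨l, hi, hj⟩ := exists_ge_ge i j
    refine ⟨l, _, add_mem (transition_mem F hi ha) (transition_mem F hj hb), ?_⟩
    rw [map_add, dirLimOf_transition, dirLimOf_transition]
  smul_mem' := by
    rintro c _ ⟨i, a, ha, rfl⟩
    exact ⟨i, c • a, Submodule.smul_mem _ c ha, map_smul _ _ _⟩

lemma dirLimOf_mem {j : J} {n : ℕ} {a : (F.obj j).carrier} (ha : a ∈ (F.obj j).gr n) :
    dirLimOf F j a ∈ dirLimGr F n := ⟨j, a, ha, rfl⟩

lemma exists_dirLimOf₂ {m n : ℕ} {x y : DirLim F} (hx : x ∈ dirLimGr F m)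
    (hy : y ∈ dirLimGr F n) : ∃ (j : J) (a b : (F.obj j).carrier), a ∈ (F.obj j).gr m ∧
      b ∈ (F.obj j).gr n ∧ dirLimOf F j a = x ∧ dirLimOf F j b = y := by
  obtain ⟨i, a, ha, rfl⟩ := hx
  obtain ⟨j, b, hb, rfl⟩ := hy
  obtain ⟨l, hi, hj⟩ := exists_ge_ge i j
  exact ⟨l, _, _, transition_mem F hi ha, transition_mem F hj hb, dirLimOf_transition F hi a,
    dirLimOf_transition F hj b⟩

/-- The endomorphism of the colimit induced by compatible endomorphisms. -/
noncomputable def dirLimMap (f : ∀ j, (F.obj j).carrier →ₗ[k] (F.obj j).carrier)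
    (hf : ∀ (i j : J) (h : i ≤ j) (a : (F.obj i).carrier),
      f j (transition F i j h a) = transition F i j h (f i a)) : DirLim F →ₗ[k] DirLim F :=
  DirectLimit.Module.lift k J (fun j => (F.obj j).carrier) (transition F)
    (fun j => (dirLimOf F j).toLinearMap ∘ₗ f j) (fun i j h a => by
      change dirLimOf F j (f j _) = dirLimOf F i (f i a)
      rw [hf, dirLimOf_transition])

/-- The differential of the colimit. -/
noncomputable def dirLimD : DirLim F →ₗ[k] DirLim F :=
  dirLimMap F (fun j => (F.obj j).d) (fun _ _ h a => ((F.map (homOfLE h)).map_d a).symm)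

lemma dirLimD_of {j : J} (a : (F.obj j).carrier) :
    dirLimD F (dirLimOf F j a) = dirLimOf F j ((F.obj j).d a) := rfl

/-- The homogeneous components in the colimit. -/
noncomputable def dirLimProj (n : ℕ) : DirLim F →ₗ[k] DirLim F :=
  dirLimMap F (fun j => (F.obj j).proj n)
    (fun _ _ h a => (map_proj (F.map (homOfLE h)) n a).symm)

lemma dirLimProj_of (n : ℕ) {j : J} (a : (F.obj j).carrier) :
    dirLimProj F n (dirLimOf F j a) = dirLimOf F j ((F.obj j).proj n a) := rfl

/-- The colimit of a directed system of cdga's. -/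
noncomputable def dirLimPre : PreCDGA k (DirLim F) where
  gr := dirLimGr F
  indep := iSupIndep_of_proj
    (dirLimProj F)
    (by
      rintro n _ ⟨j, a, ha, rfl⟩
      rw [dirLimProj_of, proj_of_mem _ ha])
    (by
      rintro n m h _ ⟨j, a, ha, rfl⟩
      rw [dirLimProj_of, proj_of_mem_ne _ ha h, map_zero])
  one_mem := ⟨Classical.arbitrary J, 1, SetLike.one_mem_graded (F.obj _).gr, map_one _⟩
  mul_mem hx hy := by
    obtain ⟨j, a, b, ha, hb, rfl, rfl⟩ := exists_dirLimOf₂ F hx hy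
    exact ⟨j, a * b, SetLike.mul_mem_graded ha hb, map_mul _ _ _⟩
  d := dirLimD F
  d_mem := by
    rintro n _ ⟨j, a, ha, rfl⟩
    exact ⟨j, _, (F.obj j).d_mem ha, rfl⟩
  d_d := by
    rintro n _ ⟨j, a, ha, rfl⟩
    rw [dirLimD_of, dirLimD_of, (F.obj j).d_d, map_zero]
  leibniz {m n _ _} hx hy := by
    obtain ⟨j, a, b, ha, hb, rfl, rfl⟩ := exists_dirLimOf₂ F hx hy
    rw [← map_mul, dirLimD_of, (F.obj j).leibniz ha, dirLimD_of, dirLimD_of]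
    simp
  graded_comm {m n _ _} hx hy := by
    obtain ⟨j, a, b, ha, hb, rfl, rfl⟩ := exists_dirLimOf₂ F hx hy
    rw [← map_mul, (F.obj j).graded_comm ha hb]
    simp

/-- The colimit cocone of a directed system of cdga's. -/
noncomputable def dirLimCocone : Cocone F where
  pt := (dirLimPre F).toCDGA
  ι :=
    { app := fun j => (dirLimPre F).homTo (F.obj j) (dirLimOf F j) (dirLimOf_mem F)
        (fun _ => rfl)
      naturality := fun i j f => by
        ext a
        exact (dirLimPre F).val_injective (dirLimOf_transition F (leOfHom f) a) }

/-- The cocone is a colimit cocone. -/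
noncomputable def isColimitDirLimCocone : IsColimit (dirLimCocone F) where
  desc s := (dirLimPre F).homFrom s.pt
    (DirectLimit.Algebra.lift (fun j => (F.obj j).carrier) (transition F) s.pt.carrier
      (fun j => (s.ι.app j).toAlgHom) (fun i j h a =>
        congrArg (fun g : F.obj i ⟶ s.pt => g.toAlgHom a) (s.w (homOfLE h))))
    (by
      rintro n _ ⟨j, a, ha, rfl⟩
      exact (s.ι.app j).map_gr ha)
    (by
      rintro n _ ⟨j, a, ha, rfl⟩
      exact (s.ι.app j).map_d a)
  fac s j := rfl
  uniq s m hm := by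
    refine hom_ext_of_homogeneous fun n x hx => ?_
    obtain ⟨j, a, ha, hax⟩ := hx
    obtain rfl : ((dirLimCocone F).ι.app j).toAlgHom a = x := (dirLimPre F).val_injective hax
    exact congrArg (fun g : F.obj j ⟶ s.pt => g.toAlgHom a) (hm j)

/-- Morphisms from a sphere commute with directed colimits. -/
lemma preservesColimit_sphere (n : ℕ) :
    PreservesColimit F (coyoneda.obj (Opposite.op (S k n))) := by
  refine preservesColimit_of_preserves_colimit_cocone (isColimitDirLimCocone F)
    (Types.FilteredColimit.isColimitOf' _ _ ?_ ?_)
  · intro (f : S k n ⟶ (dirLimPre F).toCDGA)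
    obtain ⟨j, a, ha, hax⟩ := f.map_gr (sphereGen_mem n)
    change dirLimOf F j a = _ at hax
    -- A representative of a cocycle need not be closed at stage `j`, but its differential vanishes
    -- in the colimit, hence at some later stage `l`.
    have hd : dirLimOf F j ((F.obj j).d a) = 0 := by
      rw [← dirLimD_of, hax]
      change (dirLimPre F).val ((dirLimPre F).toCDGA.d (f.toAlgHom (sphereGen k n))) = 0
      rw [← f.map_d, d_sphereGen, map_zero, map_zero]
    obtain ⟨l, hl, h0⟩ := dirLimOf_eq_zero F hd
    refine ⟨l, sphereHom (F.obj l) (transition F j l hl a) (transition_mem F hl ha) ?_, ?_⟩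
    · rw [← h0]
      exact ((F.map (homOfLE hl)).map_d a).symm
    · refine sphere_hom_ext ((dirLimPre F).val_injective ?_)
      refine hax.symm.trans ?_
      rw [← dirLimOf_transition F hl]
      exact congrArg (dirLimOf F l) (sphereHom_gen _ _ _ _).symm
  · intro i (x : S k n ⟶ F.obj i) (y : S k n ⟶ F.obj i) h
    have h' : x ≫ (dirLimCocone F).ι.app i = y ≫ (dirLimCocone F).ι.app i := h
    have h0 : dirLimOf F i (x.toAlgHom (sphereGen k n) - y.toAlgHom (sphereGen k n)) = 0 := by
      rw [map_sub, sub_eq_zero]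
      exact congrArg (fun g : S k n ⟶ (dirLimPre F).toCDGA =>
        (dirLimPre F).val (g.toAlgHom (sphereGen k n))) h'
    obtain ⟨l, hl, h0⟩ := dirLimOf_eq_zero F h0
    refine ⟨l, homOfLE hl, sphere_hom_ext ?_⟩
    rw [map_sub, sub_eq_zero] at h0
    exact h0

end DirectedColimits

end CDGA

/-- Morphisms from an initial object commute with filtered colimits. -/
lemma preservesColimit_of_isInitial {C : Type u} [Category.{v} C] {X : C} (hX : IsInitial X)
    {J : Type w} [Category.{w} J] [IsFiltered J] (F : J ⥤ C) :
    PreservesColimit F (coyoneda.obj (Opposite.op X)) where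
  preserves _ := ⟨Types.FilteredColimit.isColimitOf' _ _
    (fun _ => ⟨IsFiltered.nonempty.some, hX.to _, hX.hom_ext _ _⟩)
    (fun j _ _ _ => ⟨j, 𝟙 j, hX.hom_ext _ _⟩)⟩

open scoped TensorProduct Polynomial

namespace CDGA

variable {k : Type u} [Field k]

/-! ## Polynomials with coefficients in a cdga -/

section Poly

variable (B : CDGA k)

/-- The polynomials `B[t]`. -/
def Poly : Type u := B.carrier ⊗[k] k[X]

noncomputable instance : Ring B.Poly := inferInstanceAs (Ring (B.carrier ⊗[k] k[X]))

noncomputable instance : Algebra k B.Poly := inferInstanceAs (Algebra k (B.carrier ⊗[k] k[X]))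

variable {B} in
/-- The product of a coefficient and a polynomial. -/
noncomputable def tmul (a : B.carrier) (p : k[X]) : B.Poly := a ⊗ₜ[k] p

lemma tmul_mul_tmul (a b : B.carrier) (p q : k[X]) :
    tmul a p * tmul b q = tmul (a * b) (p * q) := Algebra.TensorProduct.tmul_mul_tmul a b p q

lemma one_eq_tmul : (1 : B.Poly) = tmul 1 1 := Algebra.TensorProduct.one_def

lemma add_tmul (a b : B.carrier) (p : k[X]) : tmul (a + b) p = tmul a p + tmul b p :=
  TensorProduct.add_tmul a b p

lemma tmul_add (a : B.carrier) (p q : k[X]) : tmul a (p + q) = tmul a p + tmul a q :=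
  TensorProduct.tmul_add a p q

lemma neg_tmul (a : B.carrier) (p : k[X]) : tmul (-a) p = -tmul a p :=
  TensorProduct.neg_tmul a p

lemma zero_tmul (p : k[X]) : (tmul 0 p : B.Poly) = 0 :=
  TensorProduct.zero_tmul _ p

lemma smul_tmul (c : k) (a : B.carrier) (p : k[X]) : c • tmul a p = tmul (c • a) p :=
  TensorProduct.smul_tmul' c a p

variable {B} in
@[elab_as_elim]
lemma poly_induction {P : B.Poly → Prop} (x : B.Poly) (zero : P 0)
    (tmul : ∀ a p, P (tmul a p)) (add : ∀ x y, P x → P y → P (x + y)) : P x :=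
  TensorProduct.induction_on x zero tmul add

/-- The polynomials with coefficients in degree `n`. -/
noncomputable def polyGr (n : ℕ) : Submodule k B.Poly :=
  Submodule.span k {x | ∃ a ∈ B.gr n, ∃ p : k[X], tmul a p = x}

/-- The linear map induced by linear maps on coefficients and on polynomials. -/
noncomputable def polyMap {B B' : CDGA k} (f : B.carrier →ₗ[k] B'.carrier)
    (g : k[X] →ₗ[k] k[X]) : B.Poly →ₗ[k] B'.Poly :=
  (TensorProduct.map f g : B.carrier ⊗[k] k[X] →ₗ[k] B'.carrier ⊗[k] k[X])

/-- The coefficientwise differential. -/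
noncomputable def polyD : B.Poly →ₗ[k] B.Poly := polyMap B.d LinearMap.id

/-- The derivative with respect to the variable. -/
noncomputable def polyDeriv : B.Poly →ₗ[k] B.Poly :=
  polyMap LinearMap.id Polynomial.derivative

/-- The coefficientwise homogeneous components. -/
noncomputable def polyProj (n : ℕ) : B.Poly →ₗ[k] B.Poly := polyMap (B.proj n) LinearMap.id

@[simp] lemma polyD_tmul (a : B.carrier) (p : k[X]) : B.polyD (tmul a p) = tmul (B.d a) p := rfl

@[simp] lemma polyDeriv_tmul (a : B.carrier) (p : k[X]) :
    B.polyDeriv (tmul a p) = tmul a (Polynomial.derivative p) := rfl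

@[simp] lemma polyProj_tmul (n : ℕ) (a : B.carrier) (p : k[X]) :
    B.polyProj n (tmul a p) = tmul (B.proj n a) p := rfl

variable {B}

lemma tmul_mem {n : ℕ} {a : B.carrier} (ha : a ∈ B.gr n) (p : k[X]) :
    tmul a p ∈ B.polyGr n := Submodule.subset_span ⟨a, ha, p, rfl⟩

@[elab_as_elim]
lemma polyGr_induction {n : ℕ} {P : B.Poly → Prop} {x : B.Poly} (hx : x ∈ B.polyGr n)
    (zero : P 0) (tmul : ∀ a ∈ B.gr n, ∀ p : k[X], P (CDGA.tmul a p))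
    (add : ∀ x y, P x → P y → P (x + y)) : P x := by
  -- Scalars can be absorbed into the coefficient, so proving the claim for all multiples at once
  -- removes the need for a scalar case.
  suffices h : ∀ c : k, P (c • x) by simpa using h 1
  induction hx using Submodule.span_induction with
  | mem x h =>
    obtain ⟨a, ha, p, rfl⟩ := h
    intro c
    rw [smul_tmul]
    exact tmul _ (Submodule.smul_mem _ c ha) p
  | zero => simpa using zero
  | add x y _ _ hx hy => exact fun c => by rw [smul_add]; exact add _ _ (hx c) (hy c)
  | smul c x _ hx => exact fun e => by rw [smul_smul]; exact hx _

lemma polyGr_mul {m n : ℕ} {x y : B.Poly} (hx : x ∈ B.polyGr m) (hy : y ∈ B.polyGr n) :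
    x * y ∈ B.polyGr (m + n) := by
  refine polyGr_induction hx (by simp) (fun a ha p => ?_)
    (fun x x' h h' => by rw [add_mul]; exact add_mem h h')
  refine polyGr_induction hy (by simp) (fun b hb q => ?_)
    (fun x x' h h' => by rw [mul_add]; exact add_mem h h')
  rw [tmul_mul_tmul]
  exact tmul_mem (SetLike.mul_mem_graded ha hb) _

lemma sign_mul_mem {R : Type*} [Ring R] [Module k R] (S : Submodule k R) (e : ℕ) {x : R}
    (hx : x ∈ S) : (-1) ^ e * x ∈ S := by
  rcases neg_one_pow_eq_or R e with h | h <;> simp [h, hx]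

lemma polyD_mem {n : ℕ} {x : B.Poly} (hx : x ∈ B.polyGr n) : B.polyD x ∈ B.polyGr (n + 1) :=
  polyGr_induction (P := fun x => B.polyD x ∈ B.polyGr (n + 1)) hx (by simp)
    (fun a ha p => tmul_mem (B.d_mem ha) p)
    (fun x x' h h' => by rw [map_add]; exact add_mem h h')

lemma polyDeriv_mem {n : ℕ} {x : B.Poly} (hx : x ∈ B.polyGr n) : B.polyDeriv x ∈ B.polyGr n :=
  polyGr_induction (P := fun x => B.polyDeriv x ∈ B.polyGr n) hx (by simp)
    (fun a ha p => tmul_mem ha _)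
    (fun x x' h h' => by rw [map_add]; exact add_mem h h')

lemma polyProj_of_mem {n : ℕ} {x : B.Poly} (hx : x ∈ B.polyGr n) : B.polyProj n x = x :=
  polyGr_induction (P := fun x => B.polyProj n x = x) hx (by simp)
    (fun a ha p => by rw [polyProj_tmul, B.proj_of_mem ha])
    (fun x x' h h' => by rw [map_add, h, h'])

lemma polyProj_of_mem_ne {m n : ℕ} {x : B.Poly} (hx : x ∈ B.polyGr m) (hmn : m ≠ n) :
    B.polyProj n x = 0 :=
  polyGr_induction (P := fun x => B.polyProj n x = 0) hx (by simp)
    (fun a ha p => by rw [polyProj_tmul, B.proj_of_mem_ne ha hmn, zero_tmul])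
    (fun x x' h h' => by rw [map_add, h, h', add_zero])

lemma polyD_polyD (x : B.Poly) : B.polyD (B.polyD x) = 0 := by
  induction x using poly_induction with
  | zero => simp
  | tmul a p => simp [B.d_d, zero_tmul]
  | add x y hx hy => simp [hx, hy]

lemma polyD_polyDeriv (x : B.Poly) : B.polyD (B.polyDeriv x) = B.polyDeriv (B.polyD x) := by
  induction x using poly_induction with
  | zero => simp
  | tmul a p => simp
  | add x y hx hy => simp [hx, hy]

lemma polyDeriv_mul (x y : B.Poly) :
    B.polyDeriv (x * y) = B.polyDeriv x * y + x * B.polyDeriv y := by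
  induction x using poly_induction with
  | zero => simp
  | add x x' hx hx' => simp only [add_mul, map_add, hx, hx']; abel
  | tmul a p =>
    induction y using poly_induction with
    | zero => simp
    | add x x' hx hx' => simp only [mul_add, map_add, hx, hx']; abel
    | tmul b q =>
      simp [tmul_add, tmul_mul_tmul]

lemma neg_one_pow_mul_tmul (e : ℕ) (a : B.carrier) (p : k[X]) :
    tmul ((-1) ^ e * a) p = (-1) ^ e * (tmul a p : B.Poly) := by
  rcases Nat.even_or_odd e with h | h
  · rw [h.neg_one_pow, h.neg_one_pow, one_mul, one_mul]
  · rw [h.neg_one_pow, h.neg_one_pow, neg_one_mul, neg_one_mul, neg_tmul]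

lemma polyD_mul {m : ℕ} {x : B.Poly} (hx : x ∈ B.polyGr m) (y : B.Poly) :
    B.polyD (x * y) = B.polyD x * y + (-1) ^ m * (x * B.polyD y) := by
  refine polyGr_induction hx (by simp) (fun a ha p => ?_)
    (fun x x' h h' => by simp only [add_mul, mul_add, map_add, h, h']; abel)
  induction y using poly_induction with
  | zero => simp
  | add x x' hx hx' => simp only [mul_add, map_add, hx, hx']; abel
  | tmul b q =>
    simp [B.leibniz ha, add_tmul, tmul_mul_tmul, neg_one_pow_mul_tmul]

lemma polyGr_comm {m n : ℕ} {x y : B.Poly} (hx : x ∈ B.polyGr m) (hy : y ∈ B.polyGr n) :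
    x * y = (-1) ^ (m * n) * (y * x) := by
  refine polyGr_induction hx (by simp) (fun a ha p => ?_)
    (fun x x' h h' => by simp only [add_mul, mul_add, h, h'])
  refine polyGr_induction hy (by simp) (fun b hb q => ?_)
    (fun x x' h h' => by simp only [add_mul, mul_add, h, h'])
  simp only [tmul_mul_tmul]
  rw [B.graded_comm ha hb, neg_one_pow_mul_tmul, mul_comm p q]

variable (B) in
/-- The polynomials with coefficients in degree `n - 1`. -/
noncomputable def polyGrPred : ℕ → Submodule k B.Poly
  | 0 => ⊥
  | n + 1 => B.polyGr n

variable (B) in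
/-- The components of degree `n - 1`. -/
noncomputable def polyProjPred : ℕ → (B.Poly →ₗ[k] B.Poly)
  | 0 => 0
  | n + 1 => B.polyProj n

lemma polyProjPred_of_mem {n : ℕ} {x : B.Poly} (hx : x ∈ B.polyGrPred n) :
    B.polyProjPred n x = x := by
  cases n with
  | zero =>
    obtain rfl : x = 0 := hx
    exact map_zero _
  | succ n => exact polyProj_of_mem hx

lemma polyProjPred_of_mem_ne {m n : ℕ} {x : B.Poly} (hx : x ∈ B.polyGrPred m) (hmn : m ≠ n) :
    B.polyProjPred n x = 0 := by
  cases n with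
  | zero => rfl
  | succ n =>
    cases m with
    | zero =>
      obtain rfl : x = 0 := hx
      exact map_zero _
    | succ m => exact polyProj_of_mem_ne hx (by simpa using hmn)

lemma polyGr_mul_polyGrPred {m n : ℕ} {x y : B.Poly} (hx : x ∈ B.polyGr m)
    (hy : y ∈ B.polyGrPred n) : x * y ∈ B.polyGrPred (m + n) := by
  cases n with
  | zero =>
    obtain rfl : y = 0 := hy
    rw [mul_zero]
    exact zero_mem _
  | succ n => exact polyGr_mul hx hy

lemma polyGrPred_mul_polyGr {m n : ℕ} {x y : B.Poly} (hx : x ∈ B.polyGrPred m)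
    (hy : y ∈ B.polyGr n) : x * y ∈ B.polyGrPred (m + n) := by
  cases m with
  | zero =>
    obtain rfl : x = 0 := hx
    rw [zero_mul]
    exact zero_mem _
  | succ m =>
    rw [add_right_comm]
    exact polyGr_mul hx hy

lemma polyD_mem_of_mem_pred {n : ℕ} {x : B.Poly} (hx : x ∈ B.polyGrPred n) :
    B.polyD x ∈ B.polyGr n := by
  cases n with
  | zero =>
    obtain rfl : x = 0 := hx
    rw [map_zero]
    exact zero_mem _
  | succ n => exact polyD_mem hx

/-- The true degree of `x` is `m - 1`, so the Leibniz sign is written as `-(-1) ^ m`. This form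
avoids truncated subtraction; for `m = 0` the element is zero. -/
lemma polyD_mul_of_mem_pred {m : ℕ} {x : B.Poly} (hx : x ∈ B.polyGrPred m) (y : B.Poly) :
    B.polyD (x * y) = B.polyD x * y - (-1) ^ m * (x * B.polyD y) := by
  cases m with
  | zero =>
    obtain rfl : x = 0 := hx
    simp
  | succ m =>
    rw [polyD_mul hx, pow_succ]
    simp

/-- The Koszul sign `(-1) ^ (m (n - 1))`, again written without subtraction. -/
lemma polyGr_comm_pred {m n : ℕ} {x y : B.Poly} (hx : x ∈ B.polyGr m)
    (hy : y ∈ B.polyGrPred n) : x * y = (-1) ^ (m * n) * ((-1) ^ m * (y * x)) := by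
  cases n with
  | zero =>
    obtain rfl : y = 0 := hy
    simp
  | succ n =>
    rw [polyGr_comm hx hy, ← mul_assoc ((-1) ^ (m * (n + 1))), ← pow_add,
      show m * (n + 1) + m = m * n + 2 * m by ring, pow_add, pow_mul (-1 : B.Poly) 2]
    simp

lemma polyGrPred_comm {m n : ℕ} {x y : B.Poly} (hx : x ∈ B.polyGrPred m)
    (hy : y ∈ B.polyGr n) : x * y = (-1) ^ (m * n) * ((-1) ^ n * (y * x)) := by
  cases m with
  | zero =>
    obtain rfl : x = 0 := hx
    simp
  | succ m =>
    rw [polyGr_comm hx hy, ← mul_assoc ((-1) ^ ((m + 1) * n)), ← pow_add,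
      show (m + 1) * n + n = m * n + 2 * n by ring, pow_add, pow_mul (-1 : B.Poly) 2]
    simp

end Poly

end CDGA

namespace CDGA

variable {k : Type u} [Field k]

/-! ## Path objects -/

section Path

variable (B : CDGA k)

/-- The ambient algebra of the path object: the matrix `(P, Q; 0, (-1) ^ n P)` represents the
element `P + Q dt` of degree `n`. -/
abbrev PathMatrix : Type u := Matrix (Fin 2) (Fin 2) B.Poly

/-- The matrices which represent the polynomial forms of degree `n`. -/
noncomputable def pathGr (n : ℕ) : Submodule k B.PathMatrix where
  carrier := {M | M 0 0 ∈ B.polyGr n ∧ M 0 1 ∈ B.polyGrPred n ∧ M 1 0 = 0 ∧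
    M 1 1 = (-1) ^ n * M 0 0}
  zero_mem' := ⟨zero_mem _, zero_mem _, rfl, by simp⟩
  add_mem' := by
    rintro M N ⟨h1, h2, h3, h4⟩ ⟨h5, h6, h7, h8⟩
    exact ⟨add_mem h1 h5, add_mem h2 h6, by simp [h3, h7], by simp [h4, h8, mul_add]⟩
  smul_mem' := by
    rintro c M ⟨h1, h2, h3, h4⟩
    exact ⟨Submodule.smul_mem _ c h1, Submodule.smul_mem _ c h2, by simp [h3], by simp [h4]⟩

/-- The differential of the path object. -/
noncomputable def pathD : B.PathMatrix →ₗ[k] B.PathMatrix where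
  -- With `M 1 1 = (-1) ^ n P`, the top row encodes `d (P + Q dt) = d P + ((-1) ^ n P' + d Q) dt`,
  -- where the sign comes from moving `dt` to the right of `P'`. The last entry must be `(-1) ^ (n +
  -- 1) d P`.
  toFun M := !![B.polyD (M 0 0), B.polyDeriv (M 1 1) + B.polyD (M 0 1); 0, -B.polyD (M 1 1)]
  map_add' M N := by
    ext i j
    fin_cases i <;> fin_cases j <;> simp <;> abel
  map_smul' c M := by
    ext i j
    fin_cases i <;> fin_cases j <;> simp

/-- The homogeneous components of a matrix. -/
noncomputable def pathProj (n : ℕ) : B.PathMatrix →ₗ[k] B.PathMatrix where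
  toFun M := !![B.polyProj n (M 0 0), B.polyProjPred n (M 0 1);
    0, (-1) ^ n * B.polyProj n (M 0 0)]
  map_add' M N := by
    ext i j
    fin_cases i <;> fin_cases j <;> simp [mul_add]
  map_smul' c M := by
    ext i j
    fin_cases i <;> fin_cases j <;> simp

lemma sign_mul_matrix {R : Type*} [Ring R] (e : ℕ) (M : Matrix (Fin 2) (Fin 2) R) (i j : Fin 2) :
    ((-1) ^ e * M) i j = (-1) ^ e * M i j := by
  rcases Nat.even_or_odd e with h | h
  · rw [h.neg_one_pow, h.neg_one_pow, one_mul, one_mul]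
  · rw [h.neg_one_pow, h.neg_one_pow, neg_one_mul, neg_one_mul, Matrix.neg_apply]

lemma map_sign_mul {R S F : Type*} [Ring R] [Ring S] [FunLike F R S] [AddMonoidHomClass F R S]
    (f : F) (e : ℕ) (x : R) : f ((-1) ^ e * x) = (-1) ^ e * f x := by
  rcases Nat.even_or_odd e with h | h <;> simp [h.neg_one_pow]

lemma matrix_ext {R : Type*} {M N : Matrix (Fin 2) (Fin 2) R} (h : M 0 0 = N 0 0)
    (h' : M 0 1 = N 0 1) (h'' : M 1 0 = N 1 0) (h''' : M 1 1 = N 1 1) : M = N := by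
  ext i j
  fin_cases i <;> fin_cases j <;> assumption

-- The sign in the lower right entry of `N` is the one produced by moving `dt` past a form of degree
-- `n`, and triangularity encodes `dt ^ 2 = 0`. Matrix multiplication is thus multiplication of
-- forms.
variable {B} in
lemma pathGr_mul {m n : ℕ} {M N : B.PathMatrix} (hM : M ∈ B.pathGr m) (hN : N ∈ B.pathGr n) :
    M * N ∈ B.pathGr (m + n) := by
  obtain ⟨h1, h2, h3, h4⟩ := hM
  obtain ⟨h5, h6, h7, h8⟩ := hN
  have e00 : (M * N) 0 0 = M 0 0 * N 0 0 := by simp [Matrix.mul_apply, h7]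
  have e01 : (M * N) 0 1 = M 0 0 * N 0 1 + M 0 1 * N 1 1 := by simp [Matrix.mul_apply]
  refine ⟨?_, ?_, ?_, ?_⟩
  · rw [e00]
    exact polyGr_mul h1 h5
  · rw [e01, h8]
    exact add_mem (polyGr_mul_polyGrPred h1 h6) (polyGrPred_mul_polyGr h2 (sign_mul_mem _ _ h5))
  · simp [Matrix.mul_apply, h3, h7]
  · rw [e00]
    simp only [Matrix.mul_apply, Fin.sum_univ_two, h3, zero_mul, zero_add, h4, h8]
    rw [mul_assoc, ← mul_assoc (M 0 0), FreeGCA.sign_comm, mul_assoc, ← mul_assoc, ← pow_add]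

-- The content is in the upper right entry, where the Leibniz rule for coefficients, shifted by one
-- for the `dt` part, meets the ordinary product rule for the derivative in the variable.
variable {B} in
lemma pathGr_leibniz {m n : ℕ} {M N : B.PathMatrix} (hM : M ∈ B.pathGr m)
    (hN : N ∈ B.pathGr n) :
    B.pathD (M * N) = B.pathD M * N + (-1) ^ m * (M * B.pathD N) := by
  obtain ⟨h1, h2, h3, h4⟩ := hM
  obtain ⟨h5, h6, h7, h8⟩ := hN
  apply matrix_ext
  · simp only [pathD, LinearMap.coe_mk, AddHom.coe_mk, Matrix.add_apply, sign_mul_matrix]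
    simp [Matrix.mul_apply, h7, polyD_mul h1]
  · simp only [pathD, LinearMap.coe_mk, AddHom.coe_mk, Matrix.add_apply, sign_mul_matrix]
    simp only [Matrix.mul_apply, Fin.sum_univ_two, h3, zero_mul, zero_add, map_add,
      polyD_mul h1, polyD_mul_of_mem_pred h2, polyDeriv_mul]
    simp [mul_add, h4, map_sign_mul, add_mul]
    simp only [← mul_assoc]
    abel
  · simp only [pathD, LinearMap.coe_mk, AddHom.coe_mk, Matrix.add_apply, sign_mul_matrix]
    simp [Matrix.mul_apply, h3, h7]
  · simp only [pathD, LinearMap.coe_mk, AddHom.coe_mk, Matrix.add_apply, sign_mul_matrix]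
    simp only [Matrix.mul_apply, Fin.sum_univ_two, h3, zero_mul, zero_add]
    have h11 : M 1 1 ∈ B.polyGr m := by rw [h4]; exact sign_mul_mem _ _ h1
    simp [polyD_mul h11]
    abel

variable {B} in
lemma pathGr_comm {m n : ℕ} {M N : B.PathMatrix} (hM : M ∈ B.pathGr m)
    (hN : N ∈ B.pathGr n) : M * N = (-1) ^ (m * n) * (N * M) := by
  obtain ⟨h1, h2, h3, h4⟩ := hM
  obtain ⟨h5, h6, h7, h8⟩ := hN
  apply matrix_ext
  · rw [sign_mul_matrix]
    simp [Matrix.mul_apply, h7, h3, polyGr_comm h1 h5]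
  · rw [sign_mul_matrix]
    simp only [Matrix.mul_apply, Fin.sum_univ_two, h4, h8]
    rw [polyGr_comm_pred h1 h6, ← mul_assoc (M 0 1), FreeGCA.sign_comm, mul_assoc,
      polyGrPred_comm h2 h5, ← mul_assoc (N 0 1), FreeGCA.sign_comm, mul_assoc]
    simp only [mul_add, ← mul_assoc, ← pow_add]
    rw [add_comm, show n + (m * n + n) = m * n + 2 * n by ring, pow_add _ (m * n) (2 * n),
      pow_mul (-1 : B.Poly) 2 n, neg_one_sq, one_pow, mul_one]
  · rw [sign_mul_matrix]
    simp [Matrix.mul_apply, h3, h7]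
  · rw [sign_mul_matrix]
    have h11 : M 1 1 ∈ B.polyGr m := by rw [h4]; exact sign_mul_mem _ _ h1
    have h11' : N 1 1 ∈ B.polyGr n := by rw [h8]; exact sign_mul_mem _ _ h5
    simp [Matrix.mul_apply, h7, h3, polyGr_comm h11 h11']

/-- The path object `B[t, dt]`. -/
noncomputable def pathPre : PreCDGA k B.PathMatrix where
  gr := B.pathGr
  indep := iSupIndep_of_proj B.pathProj
    (by
      rintro n M ⟨h1, h2, h3, h4⟩
      apply matrix_ext <;>
        simp [pathProj, polyProj_of_mem h1, polyProjPred_of_mem h2, h3, h4])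
    (by
      rintro n m h M ⟨h1, h2, h3, h4⟩
      apply matrix_ext <;>
        simp [pathProj, polyProj_of_mem_ne h1 h, polyProjPred_of_mem_ne h2 h])
  one_mem := by
    refine ⟨?_, by simp, by simp, by simp⟩
    rw [Matrix.one_apply_eq, one_eq_tmul]
    exact tmul_mem (SetLike.one_mem_graded B.gr) _
  mul_mem := pathGr_mul
  d := B.pathD
  d_mem := by
    rintro n M ⟨h1, h2, h3, h4⟩
    refine ⟨polyD_mem h1, ?_, rfl, ?_⟩
    · refine add_mem (polyDeriv_mem ?_) (polyD_mem_of_mem_pred h2)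
      rw [h4]
      exact sign_mul_mem _ _ h1
    · simp [pathD, h4, map_sign_mul, pow_succ]
  d_d := by
    rintro n M ⟨h1, h2, h3, h4⟩
    apply matrix_ext <;> simp [pathD, polyD_polyD, polyD_polyDeriv]
  leibniz := pathGr_leibniz
  graded_comm := pathGr_comm

end Path

end CDGA

/-! ### Evaluation, integration and constant paths. -/

namespace CDGA

variable {k : Type u} [Field k]

section PathMaps

variable (B : CDGA k)

/-- The linear involution `a ↦ (-1) ^ |a| a`. -/
noncomputable def signLinearMap : B.carrier →ₗ[k] B.carrier :=
  DirectSum.toModule k ℕ B.carrier (fun n => (-1 : k) ^ n • (B.gr n).subtype) ∘ₗ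
    (DirectSum.decomposeLinearEquiv B.gr).toLinearMap

lemma signLinearMap_of_mem {n : ℕ} {a : B.carrier} (ha : a ∈ B.gr n) :
    B.signLinearMap a = (-1) ^ n * a := by
  have h : B.signLinearMap a = (-1 : k) ^ n • a := by
    simp only [signLinearMap, LinearMap.comp_apply, LinearEquiv.coe_coe,
      DirectSum.decomposeLinearEquiv_apply]
    rw [DirectSum.decompose_of_mem B.gr ha]
    exact DirectSum.toModule_lof k n _
  rw [h]
  rcases Nat.even_or_odd n with h | h
  · rw [h.neg_one_pow, h.neg_one_pow, one_smul, one_mul]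
  · rw [h.neg_one_pow, h.neg_one_pow, neg_smul, one_smul, neg_one_mul]

/-- The involution `a ↦ (-1) ^ |a| a`. -/
noncomputable def signHom : B.carrier →ₐ[k] B.carrier :=
  AlgHom.ofLinearMap B.signLinearMap
    (by simpa using B.signLinearMap_of_mem (SetLike.one_mem_graded B.gr))
    (by
      intro a b
      refine B.homogeneous_induction a (fun m a ha => ?_)
        (fun a a' h h' => by simp only [add_mul, map_add, h, h'])
      refine B.homogeneous_induction b (fun n b hb => ?_)
        (fun a a' h h' => by simp only [mul_add, map_add, h, h'])
      rw [B.signLinearMap_of_mem (SetLike.mul_mem_graded ha hb), B.signLinearMap_of_mem ha,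
        B.signLinearMap_of_mem hb, mul_assoc, ← mul_assoc a, FreeGCA.sign_comm, mul_assoc,
        ← mul_assoc ((-1) ^ m), ← pow_add])

lemma signHom_of_mem {n : ℕ} {a : B.carrier} (ha : a ∈ B.gr n) : B.signHom a = (-1) ^ n * a :=
  B.signLinearMap_of_mem ha

/-- The constant polynomials. -/
noncomputable def polyC : B.carrier →ₐ[k] B.Poly :=
  (Algebra.TensorProduct.includeLeft : B.carrier →ₐ[k] B.carrier ⊗[k] k[X])

lemma polyC_apply (a : B.carrier) : B.polyC a = tmul a 1 := rfl

/-- The evaluation of polynomials at `c`. -/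
noncomputable def polyEv (c : k) : B.Poly →ₐ[k] B.carrier :=
  (Algebra.TensorProduct.lift (AlgHom.id k B.carrier)
    ((Algebra.ofId k B.carrier).comp (Polynomial.aeval c))
    (fun a p => (Algebra.commutes (Polynomial.aeval c p) a).symm) :
      B.carrier ⊗[k] k[X] →ₐ[k] B.carrier)

lemma polyEv_tmul (c : k) (a : B.carrier) (p : k[X]) :
    B.polyEv c (tmul a p) = p.eval c • a := by
  refine (Algebra.TensorProduct.lift_tmul _ _ _ a p).trans ?_
  rw [AlgHom.comp_apply, Polynomial.coe_aeval_eq_eval, Algebra.ofId_apply, AlgHom.id_apply,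
    ← Algebra.commutes, ← Algebra.smul_def]

lemma polyEv_mem (c : k) {n : ℕ} {x : B.Poly} (hx : x ∈ B.polyGr n) :
    B.polyEv c x ∈ B.gr n :=
  polyGr_induction (P := fun x => B.polyEv c x ∈ B.gr n) hx (by simp)
    (fun a ha p => by rw [polyEv_tmul]; exact Submodule.smul_mem _ _ ha)
    (fun x y h h' => by rw [map_add]; exact add_mem h h')

lemma polyEv_polyD (c : k) (x : B.Poly) : B.polyEv c (B.polyD x) = B.d (B.polyEv c x) := by
  induction x using poly_induction with
  | zero => simp
  | tmul a p => simp [polyEv_tmul]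
  | add x y hx hy => simp [hx, hy]

variable (k) in
/-- The integration of polynomials from `0` to `1`. -/
noncomputable def integral : k[X] →ₗ[k] k :=
  Polynomial.lsum fun n => ((n : k) + 1)⁻¹ • LinearMap.id

lemma integral_monomial (n : ℕ) (c : k) :
    integral k (Polynomial.monomial n c) = ((n : k) + 1)⁻¹ * c := by
  rw [integral, Polynomial.lsum_apply, Polynomial.sum_monomial_index]
  · simp
  · simp

/-- Characteristic zero enters the whole argument here: the factor `n + 1` produced by
differentiation has to be invertible. -/
lemma integral_derivative [CharZero k] (p : k[X]) :
    integral k (Polynomial.derivative p) = p.eval 1 - p.eval 0 := by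
  induction p using Polynomial.induction_on' with
  | add p q hp hq => simp only [map_add, hp, hq, Polynomial.eval_add]; ring
  | monomial n c =>
    rw [Polynomial.derivative_monomial, integral_monomial, Polynomial.eval_monomial,
      Polynomial.eval_monomial]
    cases n with
    | zero => simp
    | succ n =>
      have : (n : k) + 1 ≠ 0 := by exact_mod_cast Nat.succ_ne_zero n
      simp
      field_simp

/-- The coefficientwise integration from `0` to `1`. -/
noncomputable def polyInt : B.Poly →ₗ[k] B.carrier :=
  (TensorProduct.rid k B.carrier).toLinearMap ∘ₗ
    (LinearMap.lTensor B.carrier (integral k) : B.carrier ⊗[k] k[X] →ₗ[k] B.carrier ⊗[k] k)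

lemma polyInt_tmul (a : B.carrier) (p : k[X]) : B.polyInt (tmul a p) = integral k p • a :=
  TensorProduct.rid_tmul _ _

lemma polyInt_polyD (x : B.Poly) : B.polyInt (B.polyD x) = B.d (B.polyInt x) := by
  induction x using poly_induction with
  | zero => simp
  | tmul a p => simp [polyInt_tmul]
  | add x y hx hy => simp [hx, hy]

lemma polyInt_polyDeriv [CharZero k] (x : B.Poly) :
    B.polyInt (B.polyDeriv x) = B.polyEv 1 x - B.polyEv 0 x := by
  induction x using poly_induction with
  | zero => simp
  | tmul a p => simp [polyInt_tmul, polyEv_tmul, integral_derivative, sub_smul]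
  | add x y hx hy => simp only [map_add, hx, hy]; abel

/-- The path object of `B`. -/
noncomputable def path : CDGA k := B.pathPre.toCDGA

/-- The matrix which represents a path. -/
noncomputable def pathVal : B.path.carrier →ₐ[k] B.PathMatrix := B.pathPre.val

lemma pathVal_injective : Function.Injective B.pathVal := B.pathPre.val_injective

lemma pathVal_mem {n : ℕ} {x : B.path.carrier} (hx : x ∈ B.path.gr n) :
    B.pathVal x ∈ B.pathGr n := hx

/-- Needed for all elements, not only homogeneous ones: it makes the upper left entry
multiplicative, so that `pathEv` is an algebra morphism. -/
lemma pathVal_apply_one_zero (x : B.path.carrier) : B.pathVal x 1 0 = 0 :=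
  B.path.homogeneous_induction x (fun _ _ h => h.2.2.1)
    (fun a b h h' => by rw [map_add, Matrix.add_apply, h, h', add_zero])

/-- The evaluation of paths at `c`. -/
noncomputable def pathEv (c : k) : B.path ⟶ B where
  toAlgHom := AlgHom.ofLinearMap
    ((B.polyEv c).toLinearMap ∘ₗ Matrix.entryLinearMap k B.Poly 0 0 ∘ₗ B.pathVal.toLinearMap)
    (by
      change B.polyEv c (B.pathVal 1 0 0) = 1
      rw [map_one, Matrix.one_apply_eq, map_one])
    (by
      intro x y
      change B.polyEv c (B.pathVal (x * y) 0 0) =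
        B.polyEv c (B.pathVal x 0 0) * B.polyEv c (B.pathVal y 0 0)
      rw [map_mul, Matrix.mul_apply, Fin.sum_univ_two, B.pathVal_apply_one_zero y, mul_zero,
        add_zero, map_mul])
  map_gr h := B.polyEv_mem c h.1
  map_d x := B.polyEv_polyD c _

/-- If `P + Q dt` is closed of degree `n`, then `(-1) ^ n P' + d Q = 0`. Integrating from `0` to `1`
gives `P(0) - P(1) = d ((-1) ^ n ∫ Q)`, so the two evaluations differ by a coboundary. -/
lemma cohomologyMap_pathEv [CharZero k] (n : ℕ) :
    cohomologyMap (B.pathEv 0) n = cohomologyMap (B.pathEv 1) n := by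
  ext x
  obtain ⟨x, hx, hd⟩ := x
  simp only [LinearMap.comp_apply, Submodule.mkQ_apply]
  rw [cohomologyMap_mk, cohomologyMap_mk, Submodule.Quotient.eq]
  have h01 : B.polyDeriv (B.pathVal x 1 1) + B.polyD (B.pathVal x 0 1) = 0 :=
    congrFun (congrFun (congrArg B.pathVal (show B.path.d x = 0 from hd)) 0) 1
  have h := congrArg B.polyInt h01
  rw [map_add, map_zero, polyInt_polyDeriv, polyInt_polyD, (B.pathVal_mem hx).2.2.2,
    map_sign_mul, map_sign_mul, ← mul_sub] at h
  refine ⟨(-1) ^ n * B.polyInt (B.pathVal x 0 1), ?_⟩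
  change _ = B.polyEv 0 (B.pathVal x 0 0) - B.polyEv 1 (B.pathVal x 0 0)
  rw [d_sign, ← neg_eq_of_add_eq_zero_right h, mul_neg, ← mul_assoc, ← pow_add,
    Even.neg_one_pow ⟨n, rfl⟩, one_mul, neg_sub]

/-- The straight line `a (1 - t) + b t` joins `a` to `b`. No closedness is required, since only
surjectivity of the pair of evaluations is at stake. -/
lemma exists_path {n : ℕ} {a b : B.carrier} (ha : a ∈ B.gr n) (hb : b ∈ B.gr n) :
    ∃ x ∈ B.path.gr n, (B.pathEv 0).toAlgHom x = a ∧ (B.pathEv 1).toAlgHom x = b := by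
  let P : B.Poly := tmul a (1 - Polynomial.X) + tmul b Polynomial.X
  have hP : P ∈ B.polyGr n := add_mem (tmul_mem ha _) (tmul_mem hb _)
  have hM : !![P, 0; 0, (-1) ^ n * P] ∈ B.pathGr n := ⟨hP, zero_mem _, rfl, rfl⟩
  refine ⟨B.pathPre.elt hM, hM, ?_, ?_⟩
  · change B.polyEv 0 P = a
    simp [P, polyEv_tmul]
  · change B.polyEv 1 P = b
    simp [P, polyEv_tmul]

/-- The constant paths. -/
noncomputable def pathConst : B ⟶ B.path :=
  B.pathPre.homTo B ((Matrix.diagonalAlgHom k).comp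
    (AlgHom.pi fun i : Fin 2 => if i = 0 then B.polyC else B.polyC.comp B.signHom))
    (fun {n a} ha => by
      refine ⟨?_, ?_, ?_, ?_⟩
      · exact tmul_mem ha 1
      · exact zero_mem _
      · rfl
      · change B.polyC (B.signHom a) = (-1) ^ n * B.polyC a
        rw [B.signHom_of_mem ha, map_sign_mul])
    (fun {n a} ha => by
      apply matrix_ext
      · rfl
      · change 0 = B.polyDeriv (B.polyC (B.signHom a)) + B.polyD 0
        rw [polyC_apply, polyDeriv_tmul, Polynomial.derivative_one, map_zero, add_zero]
        exact (TensorProduct.tmul_zero _ _).symm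
      · rfl
      · change B.polyC (B.signHom (B.d a)) = -B.polyD (B.polyC (B.signHom a))
        rw [B.signHom_of_mem ha, B.signHom_of_mem (B.d_mem ha), polyC_apply, polyC_apply,
          polyD_tmul, d_sign, pow_succ, mul_neg_one, neg_mul, neg_tmul])

lemma pathConst_pathEv (c : k) : B.pathConst ≫ B.pathEv c = 𝟙 B := by
  ext a
  change B.polyEv c (tmul a 1) = a
  rw [polyEv_tmul, Polynomial.eval_one, one_smul]

end PathMaps

/-! ### Functoriality of the path object, so that it can be applied pointwise to diagrams. -/

section PathFunctor

variable {A B C : CDGA k}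

/-- The map on polynomials induced by a morphism. -/
noncomputable def polyAlgMap (f : A ⟶ B) : A.Poly →ₐ[k] B.Poly :=
  (Algebra.TensorProduct.map f.toAlgHom (AlgHom.id k k[X]) :
    A.carrier ⊗[k] k[X] →ₐ[k] B.carrier ⊗[k] k[X])

@[simp]
lemma polyAlgMap_tmul (f : A ⟶ B) (a : A.carrier) (p : k[X]) :
    polyAlgMap f (tmul a p) = tmul (f.toAlgHom a) p := rfl

lemma polyAlgMap_mem (f : A ⟶ B) {n : ℕ} {x : A.Poly} (hx : x ∈ A.polyGr n) :
    polyAlgMap f x ∈ B.polyGr n :=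
  polyGr_induction (P := fun x => polyAlgMap f x ∈ B.polyGr n) hx (by simp)
    (fun a ha p => tmul_mem (f.map_gr ha) p)
    (fun x y h h' => by rw [map_add]; exact add_mem h h')

lemma polyAlgMap_mem_pred (f : A ⟶ B) {n : ℕ} {x : A.Poly} (hx : x ∈ A.polyGrPred n) :
    polyAlgMap f x ∈ B.polyGrPred n := by
  cases n with
  | zero =>
    obtain rfl : x = 0 := hx
    rw [map_zero]
    exact zero_mem _
  | succ n => exact polyAlgMap_mem f hx

lemma polyAlgMap_polyD (f : A ⟶ B) (x : A.Poly) :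
    polyAlgMap f (A.polyD x) = B.polyD (polyAlgMap f x) := by
  induction x using poly_induction with
  | zero => simp
  | tmul a p => simp [f.map_d]
  | add x y hx hy => simp [hx, hy]

lemma polyAlgMap_polyDeriv (f : A ⟶ B) (x : A.Poly) :
    polyAlgMap f (A.polyDeriv x) = B.polyDeriv (polyAlgMap f x) := by
  induction x using poly_induction with
  | zero => simp
  | tmul a p => simp
  | add x y hx hy => simp [hx, hy]

lemma polyAlgMap_polyEv (f : A ⟶ B) (c : k) (x : A.Poly) :
    B.polyEv c (polyAlgMap f x) = f.toAlgHom (A.polyEv c x) := by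
  induction x using poly_induction with
  | zero => simp
  | tmul a p => simp [polyEv_tmul]
  | add x y hx hy => simp [hx, hy]

lemma polyAlgMap_id (x : A.Poly) : polyAlgMap (𝟙 A) x = x := by
  induction x using poly_induction with
  | zero => simp
  | tmul a p => simp
  | add x y hx hy => simp [hx, hy]

lemma polyAlgMap_comp (f : A ⟶ B) (g : B ⟶ C) (x : A.Poly) :
    polyAlgMap (f ≫ g) x = polyAlgMap g (polyAlgMap f x) := by
  induction x using poly_induction with
  | zero => simp
  | tmul a p => simp
  | add x y hx hy => simp [hx, hy]

/-- The map on path objects induced by a morphism. -/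
noncomputable def pathMap (f : A ⟶ B) : A.path ⟶ B.path :=
  B.pathPre.homTo A.path ((polyAlgMap f).mapMatrix.comp A.pathVal)
    (fun {n x} hx => ⟨polyAlgMap_mem f hx.1, polyAlgMap_mem_pred f hx.2.1, by
      change polyAlgMap f (A.pathVal x 1 0) = 0
      rw [(A.pathVal_mem hx).2.2.1, map_zero], by
      change polyAlgMap f (A.pathVal x 1 1) = (-1) ^ n * polyAlgMap f (A.pathVal x 0 0)
      rw [(A.pathVal_mem hx).2.2.2]
      exact map_sign_mul (polyAlgMap f) n _⟩)
    (fun {n x} hx => by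
      apply matrix_ext
      · exact polyAlgMap_polyD f _
      · change polyAlgMap f (A.polyDeriv _ + A.polyD _) = B.polyDeriv (polyAlgMap f _) +
          B.polyD (polyAlgMap f _)
        rw [map_add, polyAlgMap_polyD, polyAlgMap_polyDeriv]
        rfl
      · exact map_zero (polyAlgMap f)
      · change polyAlgMap f (-A.polyD _) = -B.polyD (polyAlgMap f _)
        rw [map_neg, polyAlgMap_polyD]
        rfl)

variable (k) in
/-- The path object functor. -/
noncomputable def pathFunctor : CDGA k ⥤ CDGA k where
  obj B := B.path
  map f := pathMap f
  map_id A := by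
    ext x
    refine A.pathVal_injective (Matrix.ext fun i j => ?_)
    exact polyAlgMap_id _
  map_comp {A B C} f g := by
    ext x
    refine C.pathVal_injective (Matrix.ext fun i j => ?_)
    exact polyAlgMap_comp f g _

variable (k) in
/-- The evaluation of paths at `c`, as a natural transformation. -/
noncomputable def pathEvNat (c : k) : pathFunctor k ⟶ 𝟭 (CDGA k) where
  app B := B.pathEv c
  naturality A B f := by
    ext x
    exact polyAlgMap_polyEv f c _

variable (k) in
/-- The constant paths, as a natural transformation. -/
noncomputable def pathConstNat : 𝟭 (CDGA k) ⟶ pathFunctor k where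
  app B := B.pathConst
  naturality A B f := by
    refine hom_ext_of_homogeneous fun n a ha => B.pathVal_injective (matrix_ext ?_ ?_ ?_ ?_)
    · rfl
    · exact (map_zero (polyAlgMap f)).symm
    · exact (map_zero (polyAlgMap f)).symm
    · change tmul (B.signHom (f.toAlgHom a)) 1 = tmul (f.toAlgHom (A.signHom a)) 1
      rw [A.signHom_of_mem ha, B.signHom_of_mem (f.map_gr ha), map_sign_mul]

end PathFunctor

end CDGA

/-! ## Constructing cofibrantly generated model structures -/

section Generators

variable {C : Type v} [Category.{u} C]

/-- The model structure with given weak equivalences and generating (acyclic) cofibrations. -/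
@[reducible]
def modelCategoryOfGenerators (W I J : MorphismProperty C) [HasFiniteLimits C]
    [HasFiniteColimits C] [W.HasTwoOutOfThreeProperty] [I.HasSmallObjectArgument.{u}]
    [J.HasSmallObjectArgument.{u}] (hI : I.rlp = J.rlp ⊓ W) (hJ : J.rlp.llp ≤ W) :
    ModelCategory C :=
  letI : CategoryWithFibrations C := ⟨J.rlp⟩
  letI : CategoryWithCofibrations C := ⟨I.rlp.llp⟩
  letI : CategoryWithWeakEquivalences C := ⟨W⟩
  have hI' : trivialFibrations C = I.rlp := hI.symm
  have hc : cofibrations C = I.rlp.llp := rfl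
  have hf : fibrations C = J.rlp := rfl
  have hJ' : J.rlp.llp ≤ I.rlp.llp :=
    MorphismProperty.antitone_llp (hI.trans_le inf_le_left)
  -- Retract argument: factor `f` as a map in `J.rlp.llp` followed by one in `J.rlp`. By
  -- two-out-of-three the second map is an acyclic fibration, so `f` lifts against it and is a
  -- retract of the first.
  have ht : trivialCofibrations C = J.rlp.llp := by
    refine le_antisymm (fun A B f hf => ?_) (fun A B f hf => ⟨hJ' _ hf, hJ _ hf⟩)
    let fac := MorphismProperty.factorizationData J.rlp.llp J.rlp f
    have hp : I.rlp fac.p := by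
      rw [hI]
      exact ⟨fac.hp, W.of_precomp _ _ (hJ _ fac.hi) (by rw [fac.fac]; exact hf.2)⟩
    have : HasLiftingProperty f fac.p := hf.1 _ hp
    exact MorphismProperty.of_retract (RetractArrow.ofLeftLiftingProperty fac.fac) fac.hi
  have : (weakEquivalences C).HasTwoOutOfThreeProperty :=
    inferInstanceAs W.HasTwoOutOfThreeProperty
  have : MorphismProperty.IsWeakFactorizationSystem (cofibrations C) (trivialFibrations C) := by
    rw [hI', hc]
    exact ⟨MorphismProperty.rlp_llp_rlp _, rfl, inferInstance⟩
  have : MorphismProperty.IsWeakFactorizationSystem (trivialCofibrations C) (fibrations C) := by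
    rw [ht, hf]
    exact ⟨MorphismProperty.rlp_llp_rlp _, rfl, inferInstance⟩
  ModelCategory.mk' C

/-- Quillen's path object argument. -/
lemma llp_rlp_le_of_path (W J : MorphismProperty C) [HasTerminal C] [HasBinaryProducts C]
    (P : C → C) (c : ∀ B, B ⟶ P B) (e₀ e₁ : ∀ B, P B ⟶ B)
    (hc₀ : ∀ B, c B ≫ e₀ B = 𝟙 B) (hc₁ : ∀ B, c B ≫ e₁ B = 𝟙 B)
    (hterm : ∀ B, J.rlp (terminal.from B)) (hpath : ∀ B, J.rlp (prod.lift (e₀ B) (e₁ B)))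
    (hW : ∀ {A B : C} (f : A ⟶ B) (r : B ⟶ A) (h : B ⟶ P B), f ≫ r = 𝟙 A →
      h ≫ e₀ B = r ≫ f → h ≫ e₁ B = 𝟙 B → W f) : J.rlp.llp ≤ W := by
  intro A B f hf
  have := hf _ (hterm A)
  -- As `A` is fibrant, this square has a lift `r`, a retraction of `f`.
  have sq : CommSq (𝟙 A) f (terminal.from A) (terminal.from B) := ⟨Subsingleton.elim _ _⟩
  have := hf _ (hpath B)
  -- A lift in this square is a homotopy from `r ≫ f` to the identity, extending the constant
  -- homotopy on `A`.
  have sq' : CommSq (f ≫ c B) f (prod.lift (e₀ B) (e₁ B)) (prod.lift (sq.lift ≫ f) (𝟙 B)) := ⟨by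
    apply Limits.prod.hom_ext
    · rw [Category.assoc, prod.lift_fst, Category.assoc, hc₀, Category.assoc, prod.lift_fst,
        sq.fac_left_assoc, Category.comp_id, Category.id_comp]
    · rw [Category.assoc, prod.lift_snd, Category.assoc, hc₁, Category.assoc, prod.lift_snd]⟩
  obtain ⟨⟨h, -, hh⟩⟩ := (inferInstance : sq'.HasLift).exists_lift
  refine hW f sq.lift h sq.fac_left ?_ ?_
  · rw [← prod.lift_fst (e₀ B) (e₁ B), reassoc_of% hh, prod.lift_fst]
  · rw [← prod.lift_snd (e₀ B) (e₁ B), reassoc_of% hh, prod.lift_snd]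

/-- A set of morphisms permits the small object argument if their sources are small with respect
to sequential colimits. -/
lemma hasSmallObjectArgument_ofHoms {ι : Type} {A B : ι → C} (f : ∀ x, A x ⟶ B x)
    [HasColimits C] (h : ∀ x, ∀ F : (Cardinal.aleph0.{u}).ord.ToType ⥤ C,
      PreservesColimit F (coyoneda.obj (Opposite.op (A x)))) :
    MorphismProperty.HasSmallObjectArgument.{u} (.ofHoms f) :=
  ⟨Cardinal.aleph0, Cardinal.fact_isRegular_aleph0, Cardinal.orderBotAleph0OrdToType,
    letI := Cardinal.fact_isRegular_aleph0.{u}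
    letI := Cardinal.orderBotAleph0OrdToType.{u}
    { isSmall := MorphismProperty.isSmall_ofHoms.{u} f
      preservesColimit := by
        rintro _ _ _ _ _ ⟨x⟩ _ _
        exact h x _ }⟩

lemma rlp_ofHoms_iff {ι : Type*} {A B : ι → C} (f : ∀ x, A x ⟶ B x) {X Y : C} (p : X ⟶ Y) :
    (MorphismProperty.ofHoms f).rlp p ↔ ∀ x, HasLiftingProperty (f x) p :=
  ⟨fun h x => h _ ⟨x⟩, by
    rintro h _ _ _ ⟨x⟩
    exact h x⟩

end Generators

namespace CDGA

variable {k : Type u} [Field k]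

instance : Nonempty (Cardinal.aleph0.{u}).ord.ToType :=
  letI := Cardinal.orderBotAleph0OrdToType.{u}
  ⟨⊥⟩

lemma preservesColimit_ground (F : (Cardinal.aleph0.{u}).ord.ToType ⥤ CDGA k) :
    PreservesColimit F (coyoneda.obj (Opposite.op (ground k))) :=
  preservesColimit_of_isInitial (groundIsInitial k) F

/-! ## The model structure on cdga's -/

/-- The uniqueness hypothesis replaces terminality of `T`, so the statement applies directly to the
values of a terminal diagram. -/
lemma hasLiftingProperty_j_of_hom_ext {A T : CDGA k} (n : ℕ) (f : A ⟶ T)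
    (hT : ∀ g h : D k (n + 1) ⟶ T, g = h) : HasLiftingProperty (j k (n + 1)) f :=
  ⟨fun _ => ⟨⟨⟨diskHom A 0 (zero_mem _), (groundIsInitial k).hom_ext _ _, hT _ _⟩⟩⟩⟩

/-- `Q` plays the role of `B × B`, but only joint injectivity of the projections on maps from a disk
is assumed. This covers both a product of cdga's and a value of a product of diagrams. -/
lemma hasLiftingProperty_j_path {B Q : CDGA k} (n : ℕ) (q : B.path ⟶ Q) (p₀ p₁ : Q ⟶ B)
    (h₀ : q ≫ p₀ = B.pathEv 0) (h₁ : q ≫ p₁ = B.pathEv 1)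
    (hQ : ∀ g h : D k (n + 1) ⟶ Q, g ≫ p₀ = h ≫ p₀ → g ≫ p₁ = h ≫ p₁ → g = h) :
    HasLiftingProperty (j k (n + 1)) q := by
  refine ⟨fun {s t} _ => ?_⟩
  obtain ⟨x, hx, hx₀, hx₁⟩ := B.exists_path ((t ≫ p₀).map_gr (diskGen_mem n))
    ((t ≫ p₁).map_gr (diskGen_mem n))
  refine ⟨⟨⟨diskHom _ x hx, (groundIsInitial k).hom_ext _ _, hQ _ _ ?_ ?_⟩⟩⟩
  · rw [Category.assoc, h₀]
    exact disk_hom_ext (by rw [comp_toAlgHom, diskHom_gen, hx₀])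
  · rw [Category.assoc, h₁]
    exact disk_hom_ext (by rw [comp_toAlgHom, diskHom_gen, hx₁])

/-- The two evaluations agree on cohomology, so the homotopy `h` makes `r` a two-sided inverse of
`f` there. -/
lemma quasiIsos_of_path [CharZero k] {A B : CDGA k} (f : A ⟶ B) (r : B ⟶ A) (h : B ⟶ B.path)
    (hr : f ≫ r = 𝟙 A) (h₀ : h ≫ B.pathEv 0 = r ≫ f) (h₁ : h ≫ B.pathEv 1 = 𝟙 B) :
    quasiIsos k f := by
  intro n
  rw [Function.bijective_iff_has_inverse]
  refine ⟨cohomologyMap r n, fun x => ?_, fun x => ?_⟩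
  · rw [← LinearMap.comp_apply, ← cohomologyMap_comp, hr, cohomologyMap_id, LinearMap.id_apply]
  · rw [← LinearMap.comp_apply, ← cohomologyMap_comp, ← h₀, cohomologyMap_comp,
      cohomologyMap_pathEv, ← cohomologyMap_comp, h₁, cohomologyMap_id, LinearMap.id_apply]

variable (k) in
/-- The generating cofibrations of `CDGA_k`. -/
def generatingCofibrations : MorphismProperty (CDGA k) := .ofHoms (i k)

variable (k) in
/-- The generating acyclic cofibrations of `CDGA_k`. -/
def generatingAcyclicCofibrations : MorphismProperty (CDGA k) := .ofHoms fun n => j k (n + 1)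

lemma rlp_generatingAcyclicCofibrations :
    (generatingAcyclicCofibrations k).rlp = surjections k := by
  ext A B f
  rw [generatingAcyclicCofibrations, rlp_ofHoms_iff]
  exact forall_congr' fun n => hasLiftingProperty_j_iff f n

lemma rlp_generatingCofibrations :
    (generatingCofibrations k).rlp = surjections k ⊓ quasiIsos k := by
  ext A B f
  rw [generatingCofibrations, rlp_ofHoms_iff, rlp_i_iff]
  exact and_comm

lemma llp_rlp_generatingAcyclicCofibrations_le [CharZero k] [HasLimits (CDGA k)] :
    (generatingAcyclicCofibrations k).rlp.llp ≤ quasiIsos k := by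
  refine llp_rlp_le_of_path _ _ path pathConst (fun B => B.pathEv 0) (fun B => B.pathEv 1)
    (fun B => B.pathConst_pathEv 0) (fun B => B.pathConst_pathEv 1) (fun B => ?_) (fun B => ?_)
    quasiIsos_of_path
  · rw [generatingAcyclicCofibrations, rlp_ofHoms_iff]
    exact fun n => hasLiftingProperty_j_of_hom_ext n _ (fun _ _ => Subsingleton.elim _ _)
  · rw [generatingAcyclicCofibrations, rlp_ofHoms_iff]
    exact fun n => hasLiftingProperty_j_path n _ prod.fst prod.snd (prod.lift_fst _ _)
      (prod.lift_snd _ _) (fun _ _ => Limits.prod.hom_ext)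

variable (k) in
/-- The model structure on `CDGA_k`. -/
@[reducible]
noncomputable def modelCategory [CharZero k] [HasLimits (CDGA k)] [HasColimits (CDGA k)] :
    ModelCategory (CDGA k) :=
  have : (generatingCofibrations k).HasSmallObjectArgument :=
    hasSmallObjectArgument_ofHoms _ fun n F => preservesColimit_sphere F n
  have : (generatingAcyclicCofibrations k).HasSmallObjectArgument :=
    hasSmallObjectArgument_ofHoms _ fun _ F => preservesColimit_ground F
  modelCategoryOfGenerators (quasiIsos k) (generatingCofibrations k)
    (generatingAcyclicCofibrations k)
    (by rw [rlp_generatingCofibrations, rlp_generatingAcyclicCofibrations])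
    llp_rlp_generatingAcyclicCofibrations_le

end CDGA

namespace CoperverseCDGA

variable {k : Type u} [Field k] {t : ℕ}

/-! ## The model structure on coperverse cdga's -/

section

variable [HasColimits (CDGA k)]

variable (k t) in
/-- The adjunction between `F_p` and the evaluation at `p`. -/
noncomputable def adj (p : Perversity t) :
    F k t p ⊣ (evaluation (Perversity t) (CDGA k)).obj p :=
  evaluationAdjunctionRight (CDGA k) p

/-- Maps out of `F_p(A)` are maps from `A` to the value at `p`, and evaluation preserves colimits,
so smallness of `A` is inherited. -/
lemma preservesColimit_F (p : Perversity t) (A : CDGA k)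
    (h : ∀ G : (Cardinal.aleph0.{u}).ord.ToType ⥤ CDGA k,
      PreservesColimit G (coyoneda.obj (Opposite.op A)))
    (G : (Cardinal.aleph0.{u}).ord.ToType ⥤ CoperverseCDGA k t) :
    PreservesColimit G (coyoneda.obj (Opposite.op ((F k t p).obj A))) := by
  have := h (G ⋙ (evaluation (Perversity t) (CDGA k)).obj p)
  have : PreservesColimit G ((evaluation (Perversity t) (CDGA k)).obj p ⋙
      coyoneda.obj (Opposite.op A)) := inferInstance
  exact preservesColimit_of_natIso (F := (evaluation (Perversity t) (CDGA k)).obj p ⋙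
    coyoneda.obj (Opposite.op A)) G (NatIso.ofComponents
    (fun Y => (((adj k t p).homEquiv A Y).symm).toIso)
    (fun f => by
      ext g
      exact (adj k t p).homEquiv_naturality_right_symm
        (show A ⟶ ((evaluation (Perversity t) (CDGA k)).obj p).obj _ from g) f))

lemma smallObjectArgument_generatingCofibrations :
    MorphismProperty.HasSmallObjectArgument.{u} (generatingCofibrations k t) :=
  hasSmallObjectArgument_ofHoms _ fun x G =>
    preservesColimit_F x.1 _ (fun G => CDGA.preservesColimit_sphere G x.2) G

lemma smallObjectArgument_generatingAcyclicCofibrations :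
    MorphismProperty.HasSmallObjectArgument.{u} (generatingAcyclicCofibrations k t) :=
  hasSmallObjectArgument_ofHoms _ fun x G =>
    preservesColimit_F x.1 _ CDGA.preservesColimit_ground G

/-- Lifting problems against `F_p(j)` are transposed to lifting problems at `p` by the adjunction.
-/
lemma rlp_generatingAcyclicCofibrations_iff {X Y : CoperverseCDGA k t} (f : X ⟶ Y) :
    (generatingAcyclicCofibrations k t).rlp f ↔
      ∀ (p : Perversity t) (n : ℕ), HasLiftingProperty (CDGA.j k (n + 1)) (f.app p) := by
  rw [generatingAcyclicCofibrations, rlp_ofHoms_iff, Prod.forall]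
  exact forall_congr' fun p => forall_congr' fun n => (adj k t p).hasLiftingProperty_iff _ _

lemma rlp_generatingAcyclicCofibrations :
    (generatingAcyclicCofibrations k t).rlp = surjections k t := by
  ext X Y f
  rw [rlp_generatingAcyclicCofibrations_iff]
  exact forall_congr' fun p => forall_congr' fun n => CDGA.hasLiftingProperty_j_iff _ n

lemma rlp_generatingCofibrations_iff {X Y : CoperverseCDGA k t} (f : X ⟶ Y) :
    (generatingCofibrations k t).rlp f ↔
      ∀ p, CDGA.quasiIsos k (f.app p) ∧ CDGA.surjections k (f.app p) := by
  rw [generatingCofibrations, rlp_ofHoms_iff, Prod.forall]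
  refine forall_congr' fun p => ?_
  rw [← CDGA.rlp_i_iff]
  exact forall_congr' fun n => (adj k t p).hasLiftingProperty_iff _ _

lemma rlp_generatingCofibrations :
    (generatingCofibrations k t).rlp = surjections k t ⊓ quasiIsos k t := by
  ext X Y f
  rw [rlp_generatingCofibrations_iff, forall_and]
  exact and_comm

instance : (quasiIsos k t).HasTwoOutOfThreeProperty where
  comp_mem _ _ hf hg p := (CDGA.quasiIsos k).comp_mem _ _ (hf p) (hg p)
  of_postcomp _ _ hg h p := (CDGA.quasiIsos k).of_postcomp _ _ (hg p) (h p)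
  of_precomp _ _ hf h p := (CDGA.quasiIsos k).of_precomp _ _ (hf p) (h p)

/-- The path object argument again, with the path object taken pointwise. Uniqueness of maps into
values of terminal objects and products is checked by transposing along `F_p`, where the universal
properties in the diagram category apply. -/
lemma llp_rlp_generatingAcyclicCofibrations_le [CharZero k] [HasLimits (CDGA k)] :
    (generatingAcyclicCofibrations k t).rlp.llp ≤ quasiIsos k t := by
  refine llp_rlp_le_of_path _ _ (fun X => X ⋙ CDGA.pathFunctor k)
    (fun X => Functor.whiskerLeft X (CDGA.pathConstNat k))
    (fun X => Functor.whiskerLeft X (CDGA.pathEvNat k 0))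
    (fun X => Functor.whiskerLeft X (CDGA.pathEvNat k 1))
    (fun X => ?_) (fun X => ?_) (fun X => ?_) (fun X => ?_) ?_
  · ext p : 2
    exact (X.obj p).pathConst_pathEv 0
  · ext p : 2
    exact (X.obj p).pathConst_pathEv 1
  · rw [rlp_generatingAcyclicCofibrations_iff]
    exact fun p n => CDGA.hasLiftingProperty_j_of_hom_ext n _ fun g h =>
      ((adj k t p).homEquiv _ _).symm.injective (Subsingleton.elim _ _)
  · rw [rlp_generatingAcyclicCofibrations_iff]
    intro p n
    refine CDGA.hasLiftingProperty_j_path (B := X.obj p) n _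
      ((prod.fst : X ⨯ X ⟶ X).app p) ((prod.snd : X ⨯ X ⟶ X).app p) ?_ ?_ ?_
    · exact congrArg (fun g => g.app p) (prod.lift_fst
        (Functor.whiskerLeft X (CDGA.pathEvNat k 0)) (Functor.whiskerLeft X (CDGA.pathEvNat k 1)))
    · exact congrArg (fun g => g.app p) (prod.lift_snd
        (Functor.whiskerLeft X (CDGA.pathEvNat k 0)) (Functor.whiskerLeft X (CDGA.pathEvNat k 1)))
    · intro g h h₀ h₁
      apply ((adj k t p).homEquiv _ _).symm.injective
      apply Limits.prod.hom_ext
      · rw [← Adjunction.homEquiv_naturality_right_symm,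
          ← Adjunction.homEquiv_naturality_right_symm]
        exact congrArg _ h₀
      · rw [← Adjunction.homEquiv_naturality_right_symm,
          ← Adjunction.homEquiv_naturality_right_symm]
        exact congrArg _ h₁
  · intro X Y f r h hr h₀ h₁ p
    exact CDGA.quasiIsos_of_path (f.app p) (r.app p) (h.app p) (congrArg (fun g => g.app p) hr)
      (congrArg (fun g => g.app p) h₀) (congrArg (fun g => g.app p) h₁)

variable (k t) in
/-- The projective model structure on coperverse cdga's. -/
@[reducible]
noncomputable def modelCategory [CharZero k] [HasLimits (CDGA k)] :
    ModelCategory (CoperverseCDGA k t) :=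
  have := smallObjectArgument_generatingCofibrations (k := k) (t := t)
  have := smallObjectArgument_generatingAcyclicCofibrations (k := k) (t := t)
  modelCategoryOfGenerators (quasiIsos k t) (generatingCofibrations k t)
    (generatingAcyclicCofibrations k t)
    (by rw [rlp_generatingCofibrations, rlp_generatingAcyclicCofibrations])
    llp_rlp_generatingAcyclicCofibrations_le

end

end CoperverseCDGA

/-! ## Functors on a poset that are constant on a lower set -/

section PosetDiagrams

variable {P : Type w} [PartialOrder P] {E : Type u} [Category.{v} E]

section

variable [HasFiniteProducts E]

/-- The functor that is constant on a lower set `S` and terminal elsewhere. -/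
noncomputable def constOn (S : LowerSet P) (x : E) : P ⥤ E where
  -- A product over the proposition `q ∈ S` is `x` when it holds and the empty product, a terminal
  -- object, when it fails; no case distinction enters the functor.
  obj q := ∏ᶜ fun _ : PLift (q ∈ S) => x
  map f := Pi.lift fun h => Pi.π (fun _ => x) ⟨S.lower (leOfHom f) h.down⟩

/-- The canonical isomorphism `constOn S x q ⟶ x` for `q ∈ S`. -/
noncomputable def constOnπ {S : LowerSet P} (x : E) {q : P} (h : q ∈ S) :
    (constOn S x).obj q ⟶ x :=
  Pi.π (fun _ => x) (⟨h⟩ : PLift (q ∈ S))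

/-- Morphisms to `constOn S x q`. -/
noncomputable def constOnLift {S : LowerSet P} {x : E} {q : P} {A : E} (f : q ∈ S → (A ⟶ x)) :
    A ⟶ (constOn S x).obj q :=
  Pi.lift fun h => f h.down

variable {S S' : LowerSet P} {x y : E}

lemma constOnLift_π {q : P} {A : E} (f : q ∈ S → (A ⟶ x)) (h : q ∈ S) :
    constOnLift f ≫ constOnπ x h = f h :=
  Limits.Pi.lift_π _ _

lemma constOn_hom_ext {q : P} {A : E} {f g : A ⟶ (constOn S x).obj q}
    (h : ∀ h : q ∈ S, f ≫ constOnπ x h = g ≫ constOnπ x h) : f = g :=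
  Limits.Pi.hom_ext _ _ fun h' => h h'.down

lemma constOn_map_π {q q' : P} (f : q ⟶ q') (h : q' ∈ S) :
    (constOn S x).map f ≫ constOnπ x h = constOnπ x (S.lower (leOfHom f) h) :=
  Limits.Pi.lift_π _ _

/-- Morphisms to `constOn S x` are compatible families of morphisms to `x`. -/
noncomputable def toConstOn {F : P ⥤ E} (f : ∀ q, q ∈ S → (F.obj q ⟶ x))
    (hf : ∀ {q q' : P} (g : q ⟶ q') (h : q' ∈ S), F.map g ≫ f q' h = f q (S.lower (leOfHom g) h)) :
    F ⟶ constOn S x where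
  app q := constOnLift (f q)
  naturality q q' g := by
    apply constOn_hom_ext
    intro h
    rw [Category.assoc, Category.assoc, constOnLift_π, constOn_map_π, constOnLift_π, hf]

lemma toConstOn_π {F : P ⥤ E} (f : ∀ q, q ∈ S → (F.obj q ⟶ x))
    (hf : ∀ {q q' : P} (g : q ⟶ q') (h : q' ∈ S), F.map g ≫ f q' h = f q (S.lower (leOfHom g) h))
    {q : P} (h : q ∈ S) :
    (toConstOn f hf).app q ≫ constOnπ x h = f q h :=
  constOnLift_π _ _

lemma toConstOn_ext {F : P ⥤ E} {f g : F ⟶ constOn S x}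
    (h : ∀ (q : P) (h : q ∈ S), f.app q ≫ constOnπ x h = g.app q ≫ constOnπ x h) : f = g := by
  ext q
  exact constOn_hom_ext (h q)

/-- The restriction and change of value for the functors `constOn S x`. -/
noncomputable def constOnMap (hS : ∀ {q}, q ∈ S' → q ∈ S) (p : x ⟶ y) :
    constOn S x ⟶ constOn S' y :=
  toConstOn (fun _ h => constOnπ x (hS h) ≫ p) fun g h => by rw [reassoc_of% @constOn_map_π]

lemma constOnMap_π (hS : ∀ {q}, q ∈ S' → q ∈ S) (p : x ⟶ y) {q : P} (h : q ∈ S') :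
    (constOnMap hS p).app q ≫ constOnπ y h = constOnπ x (hS h) ≫ p :=
  toConstOn_π _ (fun g h => by rw [reassoc_of% @constOn_map_π]) _

lemma mem_Iic_of_mem_Iio {c q : P} (h : q ∈ LowerSet.Iio c) : q ∈ LowerSet.Iic c :=
  LowerSet.mem_Iic_iff.2 (LowerSet.mem_Iio_iff.1 h).le

variable [HasPullbacks E]

/-- For `p : x ⟶ y` this is the functor with value `x` at `q < c`, with value `y` at `c` and with
terminal values elsewhere. -/
noncomputable def constOnGlue (c : P) (p : x ⟶ y) : P ⥤ E :=
  pullback (constOnMap (S := LowerSet.Iic c) mem_Iic_of_mem_Iio (𝟙 y))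
    (constOnMap (S := LowerSet.Iio c) (fun h => h) p)

/-- The projection of `constOnGlue` to the functor with value `y` at `q ≤ c`. -/
noncomputable def constOnGlueFst (c : P) (p : x ⟶ y) :
    constOnGlue c p ⟶ constOn (LowerSet.Iic c) y :=
  pullback.fst _ _

/-- The projection of `constOnGlue` to the functor with value `x` at `q < c`. -/
noncomputable def constOnGlueSnd (c : P) (p : x ⟶ y) :
    constOnGlue c p ⟶ constOn (LowerSet.Iio c) x :=
  pullback.snd _ _

lemma isPullback_constOnGlue (c : P) (p : x ⟶ y) :
    IsPullback (constOnGlueFst c p) (constOnGlueSnd c p)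
      (constOnMap mem_Iic_of_mem_Iio (𝟙 y)) (constOnMap (fun h => h) p) :=
  IsPullback.of_hasPullback _ _

lemma constOnGlue_condition {c : P} (p : x ⟶ y) {q : P} (h : q ∈ LowerSet.Iio c) :
    (constOnGlueFst c p).app q ≫ constOnπ y (mem_Iic_of_mem_Iio h) =
      (constOnGlueSnd c p).app q ≫ constOnπ x h ≫ p := by
  have e := congrArg (fun g => NatTrans.app g q ≫ constOnπ y h) (isPullback_constOnGlue c p).w
  simpa only [NatTrans.comp_app, Category.assoc, constOnMap_π, Category.comp_id] using e

/-- The morphism from the functor with value `x` at `q ≤ c` to `constOnGlue c p`. -/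
noncomputable def toConstOnGlue (c : P) (p : x ⟶ y) :
    constOn (LowerSet.Iic c) x ⟶ constOnGlue c p :=
  (isPullback_constOnGlue c p).lift (constOnMap (fun h => h) p)
    (constOnMap mem_Iic_of_mem_Iio (𝟙 x)) (by
      apply toConstOn_ext
      intro q h
      simp only [NatTrans.comp_app, Category.assoc, constOnMap_π, Category.comp_id,
        reassoc_of% @constOnMap_π, Category.id_comp])

lemma toConstOnGlue_fst (c : P) (p : x ⟶ y) {q : P} (h : q ∈ LowerSet.Iic c) :
    (toConstOnGlue c p).app q ≫ (constOnGlueFst c p).app q ≫ constOnπ y h = constOnπ x h ≫ p := by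
  rw [← NatTrans.comp_app_assoc, toConstOnGlue, IsPullback.lift_fst, constOnMap_π]

lemma toConstOnGlue_snd (c : P) (p : x ⟶ y) {q : P} (h : q ∈ LowerSet.Iio c) :
    (toConstOnGlue c p).app q ≫ (constOnGlueSnd c p).app q ≫ constOnπ x h =
      constOnπ x (mem_Iic_of_mem_Iio h) := by
  rw [← NatTrans.comp_app_assoc, toConstOnGlue, IsPullback.lift_snd, constOnMap_π,
    Category.comp_id]

lemma constOnGlue_hom_ext {c : P} {p : x ⟶ y} {q : P} {A : E} {f g : A ⟶ (constOnGlue c p).obj q}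
    (h₁ : ∀ h : q ∈ LowerSet.Iic c, f ≫ (constOnGlueFst c p).app q ≫ constOnπ y h =
      g ≫ (constOnGlueFst c p).app q ≫ constOnπ y h)
    (h₂ : ∀ h : q ∈ LowerSet.Iio c, f ≫ (constOnGlueSnd c p).app q ≫ constOnπ x h =
      g ≫ (constOnGlueSnd c p).app q ≫ constOnπ x h) : f = g := by
  apply ((isPullback_constOnGlue c p).map ((evaluation P E).obj q)).hom_ext
  · apply constOn_hom_ext
    intro h
    simpa only [evaluation_obj_map, Category.assoc] using h₁ h
  · apply constOn_hom_ext
    intro h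
    simpa only [evaluation_obj_map, Category.assoc] using h₂ h

/-- The component is essentially an isomorphism at `q < c`, the map `p` at `c`, and a map of
terminal objects elsewhere. -/
lemma rlp_toConstOnGlue_app (A : MorphismProperty E) (c : P) {p : x ⟶ y}
    (hp : A.rlp p) (q : P) : A.rlp ((toConstOnGlue c p).app q) := by
  intro B B' i hi
  have hip := hp i hi
  constructor
  intro a b sq
  -- For `q < c` the lift is forced to be the second projection; at `c` it is a lift against `p`.
  have key : ∀ h : q ∈ LowerSet.Iic c, ∃ l : B' ⟶ x,
      i ≫ l = a ≫ constOnπ x h ∧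
      l ≫ p = b ≫ (constOnGlueFst c p).app q ≫ constOnπ y h ∧
      ∀ h' : q ∈ LowerSet.Iio c, l = b ≫ (constOnGlueSnd c p).app q ≫ constOnπ x h' := by
    intro h
    by_cases hlt : q ∈ LowerSet.Iio c
    · refine ⟨b ≫ (constOnGlueSnd c p).app q ≫ constOnπ x hlt, ?_, ?_, fun _ => rfl⟩
      · rw [← sq.w_assoc, toConstOnGlue_snd]
      · rw [constOnGlue_condition p hlt, Category.assoc, Category.assoc]
    · have sq' : CommSq (a ≫ constOnπ x h) i p
          (b ≫ (constOnGlueFst c p).app q ≫ constOnπ y h) := ⟨by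
        rw [← sq.w_assoc, toConstOnGlue_fst, Category.assoc]⟩
      exact ⟨sq'.lift, sq'.fac_left, sq'.fac_right, fun h' => absurd h' hlt⟩
  choose l hl₁ hl₂ hl₃ using key
  refine ⟨⟨⟨constOnLift l, ?_, ?_⟩⟩⟩
  · apply constOn_hom_ext
    intro h
    rw [Category.assoc, constOnLift_π, hl₁]
  · apply constOnGlue_hom_ext
    · intro h
      rw [Category.assoc, toConstOnGlue_fst, reassoc_of% @constOnLift_π, hl₂]
    · intro h
      rw [Category.assoc, toConstOnGlue_snd, constOnLift_π, hl₃ _ h]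

end

/-! ## Latching maps of functors on a poset -/

lemma identities_iff_eq {c c' : P} (f : c ⟶ c') : MorphismProperty.identities P f ↔ c = c' := by
  refine ⟨fun h => ?_, ?_⟩
  · obtain ⟨_⟩ := h
    rfl
  · rintro rfl
    rw [Subsingleton.elim f (𝟙 c)]
    exact MorphismProperty.id_mem _ c

/-- The object `c' ⟶ c` of the latching category. -/
def latchingMk {c c' : P} (h : c' < c) : LatchingCategory (⊤ : MorphismProperty P) c :=
  ⟨Over.mk (Y := (⟨c'⟩ : WideSubcategory (⊤ : MorphismProperty P))) ⟨homOfLE h.le, trivial⟩,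
    fun hid => h.ne ((identities_iff_eq _).1 hid)⟩

lemma latching_lt {c : P} (j : LatchingCategory (⊤ : MorphismProperty P) c) :
    j.obj.left.obj < c :=
  lt_of_le_of_ne (leOfHom j.obj.hom.hom) fun h => j.property ((identities_iff_eq _).2 h)

variable [HasColimitsOfSize.{w, w} E]

/-- The morphism `F(c') ⟶ L^c F` for `c' < c`. -/
noncomputable def latchingι (F : P ⥤ E) {c c' : P} (h : c' < c) : F.obj c' ⟶ latchingObj ⊤ F c :=
  colimit.ι (latchingFunctor ⊤ c ⋙ F) (latchingMk h)

lemma latchingι_latchingMap (F : P ⥤ E) {c c' : P} (h : c' < c) :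
    latchingι F h ≫ latchingMap ⊤ F c = F.map (homOfLE h.le) :=
  colimit.ι_desc _ _

lemma latchingι_latchingObjMap {F G : P ⥤ E} (φ : F ⟶ G) {c c' : P} (h : c' < c) :
    latchingι F h ≫ latchingObjMap ⊤ φ c = φ.app c' ≫ latchingι G h :=
  ι_colimMap _ _

lemma map_latchingι (F : P ⥤ E) {c c' c'' : P} (f : c'' ⟶ c') (h : c' < c) :
    F.map f ≫ latchingι F h = latchingι F ((leOfHom f).trans_lt h) :=
  colimit.w (latchingFunctor ⊤ c ⋙ F) (j := latchingMk h)
    (j' := latchingMk ((leOfHom f).trans_lt h))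
    ⟨Over.homMk (U := (latchingMk _).obj) (V := (latchingMk h).obj) ⟨f, trivial⟩⟩

lemma latchingObj_hom_ext {F : P ⥤ E} {c : P} {A : E} {f g : latchingObj ⊤ F c ⟶ A}
    (h : ∀ (c' : P) (h : c' < c), latchingι F h ≫ f = latchingι F h ≫ g) : f = g :=
  colimit.hom_ext fun j => h _ (latching_lt j)

/-- Morphisms out of the latching object. -/
noncomputable def latchingDesc {F : P ⥤ E} {c : P} {A : E} (f : ∀ c', c' < c → (F.obj c' ⟶ A))
    (hf : ∀ {c' c'' : P} (g : c'' ⟶ c') (h : c' < c),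
      F.map g ≫ f c' h = f c'' ((leOfHom g).trans_lt h)) : latchingObj ⊤ F c ⟶ A :=
  colimit.desc (latchingFunctor ⊤ c ⋙ F)
    { pt := A
      ι :=
        { app := fun j => f _ (latching_lt j)
          naturality := fun _ j' g => (hf g.hom.left.hom (latching_lt j')).trans
            (Category.comp_id _).symm } }

lemma latchingι_desc {F : P ⥤ E} {c : P} {A : E} (f : ∀ c', c' < c → (F.obj c' ⟶ A))
    (hf : ∀ {c' c'' : P} (g : c'' ⟶ c') (h : c' < c),
      F.map g ≫ f c' h = f c'' ((leOfHom g).trans_lt h)) {c' : P} (h : c' < c) :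
    latchingι F h ≫ latchingDesc f hf = f c' h :=
  colimit.ι_desc _ _

variable [HasPushouts E] {F G : P ⥤ E} (φ : F ⟶ G)

lemma inl_relativeLatchingMap (c : P) :
    pushout.inl _ _ ≫ relativeLatchingMap ⊤ φ c = φ.app c :=
  pushout.inl_desc _ _ _

lemma inr_relativeLatchingMap (c : P) :
    pushout.inr _ _ ≫ relativeLatchingMap ⊤ φ c = latchingMap ⊤ G c :=
  pushout.inr_desc _ _ _

/-- A map from the pushout to `x` is a map `F(c) ⟶ x` with a compatible family `G(q) ⟶ x` for `q <
c`. Lifting the relative latching map against `p` is thereby a lifting problem for `φ` against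
`toConstOnGlue c p`, which is pointwise in `A.rlp`. -/
lemma llp_relativeLatchingMap [HasFiniteProducts E] [HasPullbacks E] (A : MorphismProperty E)
    (hφ : ∀ {X Y : P ⥤ E} (p : X ⟶ Y), (∀ q, A.rlp (p.app q)) → HasLiftingProperty φ p) (c : P) :
    A.rlp.llp (relativeLatchingMap ⊤ φ c) := by
  intro x y p hp
  have := hφ (toConstOnGlue c p) (rlp_toConstOnGlue_app A c hp)
  constructor
  intro a b sq
  have h₁ : pushout.inl _ _ ≫ a ≫ p = φ.app c ≫ b := by
    rw [sq.w, reassoc_of% @inl_relativeLatchingMap]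
  have h₂ : pushout.inr _ _ ≫ a ≫ p = latchingMap ⊤ G c ≫ b := by
    rw [sq.w, reassoc_of% @inr_relativeLatchingMap]
  -- The transposed square: `α` comes from the `F(c)` leg of `a`, `β₁` from `b`, and `β₂` from the
  -- latching leg of `a`.
  let α : F ⟶ constOn (LowerSet.Iic c) x :=
    toConstOn (fun _ h => F.map (homOfLE (LowerSet.mem_Iic_iff.1 h)) ≫ pushout.inl _ _ ≫ a)
      fun g h => by
      rw [← F.map_comp_assoc]
      rfl
  let β₁ : G ⟶ constOn (LowerSet.Iic c) y :=
    toConstOn (fun q h => G.map (homOfLE (LowerSet.mem_Iic_iff.1 h)) ≫ b) fun g h => by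
      rw [← G.map_comp_assoc]
      rfl
  let β₂ : G ⟶ constOn (LowerSet.Iio c) x :=
    toConstOn (fun q h => latchingι G (LowerSet.mem_Iio_iff.1 h) ≫ pushout.inr _ _ ≫ a)
      fun g h => by
      rw [reassoc_of% @map_latchingι]
  let β : G ⟶ constOnGlue c p := (isPullback_constOnGlue c p).lift β₁ β₂ (by
    apply toConstOn_ext
    intro q h
    simp only [NatTrans.comp_app, Category.assoc, constOnMap_π, Category.comp_id, β₁, β₂,
      toConstOn_π, reassoc_of% @toConstOn_π, h₂, reassoc_of% @latchingι_latchingMap])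
  have hβ₁ : ∀ {q : P} (h : q ∈ LowerSet.Iic c), β.app q ≫ (constOnGlueFst c p).app q ≫
      constOnπ y h = G.map (homOfLE (LowerSet.mem_Iic_iff.1 h)) ≫ b := fun h => by
    rw [← NatTrans.comp_app_assoc, IsPullback.lift_fst, toConstOn_π]
  have hβ₂ : ∀ {q : P} (h : q ∈ LowerSet.Iio c), β.app q ≫ (constOnGlueSnd c p).app q ≫
      constOnπ x h = latchingι G (LowerSet.mem_Iio_iff.1 h) ≫ pushout.inr _ _ ≫ a := fun h => by
    rw [← NatTrans.comp_app_assoc, IsPullback.lift_snd, toConstOn_π]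
  have sq' : CommSq α φ (toConstOnGlue c p) β := ⟨by
    ext q
    apply constOnGlue_hom_ext
    · intro h
      rw [NatTrans.comp_app, NatTrans.comp_app, Category.assoc, Category.assoc,
        toConstOnGlue_fst, hβ₁, reassoc_of% @toConstOn_π, Category.assoc, Category.assoc, h₁,
        φ.naturality_assoc]
    · intro h
      rw [NatTrans.comp_app, NatTrans.comp_app, Category.assoc, Category.assoc,
        toConstOnGlue_snd, hβ₂, toConstOn_π, ← reassoc_of% @latchingι_latchingObjMap,
        ← pushout.condition_assoc, reassoc_of% @latchingι_latchingMap]⟩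
  have hc : c ∈ LowerSet.Iic c := LowerSet.mem_Iic_iff.2 (le_refl c)
  have hl₁ : ∀ (q : P), φ.app q ≫ sq'.lift.app q = α.app q := fun q => by
    rw [← NatTrans.comp_app, sq'.fac_left]
  have hl₂ : ∀ (q : P), sq'.lift.app q ≫ (toConstOnGlue c p).app q = β.app q := fun q => by
    rw [← NatTrans.comp_app, sq'.fac_right]
  refine ⟨⟨⟨sq'.lift.app c ≫ constOnπ x hc, ?_, ?_⟩⟩⟩
  · apply pushout.hom_ext
    · rw [reassoc_of% @inl_relativeLatchingMap, reassoc_of% (hl₁ c), toConstOn_π,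
        show homOfLE hc = 𝟙 c from rfl, F.map_id, Category.id_comp]
    -- Below `c` the second projection of the glued functor recovers `x`, so there the lift is
    -- determined by `β₂`.
    · rw [reassoc_of% @inr_relativeLatchingMap]
      apply latchingObj_hom_ext
      intro q h
      rw [reassoc_of% @latchingι_latchingMap, sq'.lift.naturality_assoc, constOn_map_π,
        ← toConstOnGlue_snd c p (LowerSet.mem_Iio_iff.2 h), reassoc_of% (hl₂ q), hβ₂]
  · rw [Category.assoc, ← toConstOnGlue_fst, reassoc_of% (hl₂ c), hβ₁,
      show homOfLE hc = 𝟙 c from rfl, G.map_id, Category.id_comp]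

variable {φ}

/-- Extension of a lift along a relative latching map. -/
lemma exists_lift_at {X Y : P ⥤ E} {p : X ⟶ Y} {a : F ⟶ X} {b : G ⟶ Y} (w : a ≫ p = φ ≫ b)
    (c : P) [HasLiftingProperty (relativeLatchingMap ⊤ φ c) (p.app c)]
    (l : ∀ q, q < c → (G.obj q ⟶ X.obj q)) (hl₁ : ∀ q h, φ.app q ≫ l q h = a.app q)
    (hl₂ : ∀ q h, l q h ≫ p.app q = b.app q)
    (hl₃ : ∀ {q q' : P} (g : q' ⟶ q) (h : q < c),
      G.map g ≫ l q h = l q' ((leOfHom g).trans_lt h) ≫ X.map g) :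
    ∃ m : G.obj c ⟶ X.obj c, φ.app c ≫ m = a.app c ∧ m ≫ p.app c = b.app c ∧
      ∀ q (h : q < c), G.map (homOfLE h.le) ≫ m = l q h ≫ X.map (homOfLE h.le) := by
  have hw : ∀ q, a.app q ≫ p.app q = φ.app q ≫ b.app q := fun q => by
    rw [← NatTrans.comp_app, w, NatTrans.comp_app]
  -- The lifts already chosen below `c` assemble to a map out of the latching object; a lift of the
  -- resulting square extends them to `c`.
  let L : latchingObj ⊤ G c ⟶ X.obj c :=
    latchingDesc (fun q h => l q h ≫ X.map (homOfLE h.le)) fun g h => by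
      rw [← Category.assoc, hl₃, Category.assoc, ← X.map_comp]
      rfl
  have sq : CommSq (pushout.desc (a.app c) L (by
      apply latchingObj_hom_ext
      intro q h
      rw [reassoc_of% @latchingι_latchingMap, reassoc_of% @latchingι_latchingObjMap, latchingι_desc,
        reassoc_of% (hl₁ q h), a.naturality])) (relativeLatchingMap ⊤ φ c) (p.app c) (b.app c) :=
    ⟨by
      apply pushout.hom_ext
      · rw [pushout.inl_desc_assoc, reassoc_of% @inl_relativeLatchingMap, hw]
      · rw [pushout.inr_desc_assoc, reassoc_of% @inr_relativeLatchingMap]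
        apply latchingObj_hom_ext
        intro q h
        rw [reassoc_of% @latchingι_latchingMap, reassoc_of% @latchingι_desc, Category.assoc,
          p.naturality,
          reassoc_of% (hl₂ q h), b.naturality]⟩
  refine ⟨sq.lift, ?_, sq.fac_right, fun q h => ?_⟩
  · have e := pushout.inl _ _ ≫= sq.fac_left
    rwa [reassoc_of% @inl_relativeLatchingMap, pushout.inl_desc] at e
  · have e := latchingι G h ≫= pushout.inr _ _ ≫= sq.fac_left
    rwa [reassoc_of% @inr_relativeLatchingMap, pushout.inr_desc, reassoc_of% @latchingι_latchingMap,
      latchingι_desc] at e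

/-- Induction on degree. Distinct elements of equal degree are incomparable, so the lifts at one
degree can be chosen independently, each compatible only with those of smaller degree. -/
lemma exists_lift_below {X Y : P ⥤ E} {p : X ⟶ Y} {a : F ⟶ X} {b : G ⟶ Y} (w : a ≫ p = φ ≫ b)
    (hφ : ∀ c, HasLiftingProperty (relativeLatchingMap ⊤ φ c) (p.app c)) {deg : P → ℕ}
    (hdeg : StrictMono deg) (n : ℕ) :
    ∃ l : ∀ q, deg q < n → (G.obj q ⟶ X.obj q), (∀ q h, φ.app q ≫ l q h = a.app q) ∧
      (∀ q h, l q h ≫ p.app q = b.app q) ∧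
      ∀ {q q' : P} (g : q' ⟶ q) (h : deg q < n),
        G.map g ≫ l q h = l q' ((hdeg.monotone (leOfHom g)).trans_lt h) ≫ X.map g := by
  induction n with
  | zero => exact ⟨fun _ h => absurd h (by omega), fun _ h => absurd h (by omega),
      fun _ h => absurd h (by omega), fun _ h => absurd h (by omega)⟩
  | succ n ih =>
    obtain ⟨l, hl₁, hl₂, hl₃⟩ := ih
    -- The new family must agree with `l` where `l` is defined; the last clause, stated with `l`,
    -- then becomes naturality of the new family.
    have key : ∀ c (hc : deg c < n + 1), ∃ m : G.obj c ⟶ X.obj c, φ.app c ≫ m = a.app c ∧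
        m ≫ p.app c = b.app c ∧ (∀ h : deg c < n, m = l c h) ∧
        ∀ q (h : q < c), G.map (homOfLE h.le) ≫ m =
          l q ((hdeg h).trans_le (Nat.le_of_lt_succ hc)) ≫ X.map (homOfLE h.le) := by
      intro c hc
      by_cases h : deg c < n
      · exact ⟨l c h, hl₁ c h, hl₂ c h, fun _ => rfl, fun q hq => hl₃ _ h⟩
      · have := hφ c
        obtain ⟨m, hm₁, hm₂, hm₃⟩ := exists_lift_at w c
          (fun q hq => l q ((hdeg hq).trans_le (Nat.le_of_lt_succ hc))) (fun q _ => hl₁ q _)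
          (fun q _ => hl₂ q _) (fun g _ => hl₃ g _)
        exact ⟨m, hm₁, hm₂, fun h' => absurd h' h, hm₃⟩
    choose m hm₁ hm₂ hm₃ hm₄ using key
    refine ⟨m, hm₁, hm₂, fun {q q'} g h => ?_⟩
    rcases (leOfHom g).eq_or_lt with rfl | hlt
    · rw [Subsingleton.elim g (𝟙 _), G.map_id, X.map_id, Category.id_comp, Category.comp_id]
    · rw [Subsingleton.elim g (homOfLE hlt.le), hm₄ q h q' hlt, hm₃]

lemma hasLiftingProperty_of_relativeLatchingMap {X Y : P ⥤ E} (p : X ⟶ Y)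
    (hφ : ∀ c, HasLiftingProperty (relativeLatchingMap ⊤ φ c) (p.app c)) {deg : P → ℕ}
    (hdeg : StrictMono deg) {n : ℕ} (hn : ∀ q, deg q < n) : HasLiftingProperty φ p := by
  constructor
  intro a b sq
  obtain ⟨l, hl₁, hl₂, hl₃⟩ := exists_lift_below sq.w hφ hdeg n
  refine ⟨⟨⟨⟨fun q => l q (hn q), fun _ _ g => hl₃ g (hn _)⟩, ?_, ?_⟩⟩⟩
  · ext q
    exact hl₁ q _
  · ext q
    exact hl₂ q _

end PosetDiagrams

/-! ## Matching maps for an inverse category that contains only the identities -/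

section Discrete

variable {C : Type w} [Category.{w} C] {E : Type u} [Category.{v} E]

/-- An object would be a morphism of the inverse category, hence an identity, which is also required
not to be one. -/
instance (c : C) : IsEmpty (MatchingCategory (MorphismProperty.identities C) c) :=
  ⟨fun f => f.property f.obj.hom.property⟩

/-- The matching objects for the identities are terminal. -/
noncomputable def isTerminalMatchingObj [HasLimitsOfSize.{w, w} E] (F : C ⥤ E) (c : C) :
    IsTerminal (matchingObj (MorphismProperty.identities C) F c) :=
  IsTerminal.ofUniqueHom (fun _ => limit.lift _ ⟨_, ⟨fun j => isEmptyElim j,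
    fun j => isEmptyElim j⟩⟩)
    fun _ _ => limit.hom_ext fun j => isEmptyElim j

lemma relativeMatchingMap_fst_isIso [HasLimitsOfSize.{w, w} E] [HasPullbacks E] {F G : C ⥤ E}
    (φ : F ⟶ G) (c : C) :
    IsIso (pullback.fst (matchingMap (MorphismProperty.identities C) G c)
      (matchingObjMap (MorphismProperty.identities C) φ c)) := by
  have : IsIso (matchingObjMap (MorphismProperty.identities C) φ c) :=
    isIso_of_isTerminal (isTerminalMatchingObj F c) (isTerminalMatchingObj G c) _
  infer_instance

/-- The matching objects being terminal, the pullback is the value of `G` at `c`, and the relative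
matching map is `φ.app c` up to this isomorphism. -/
lemma fibration_relativeMatchingMap_iff [HasLimitsOfSize.{w, w} E] [ModelCategory E] {F G : C ⥤ E}
    (φ : F ⟶ G) (c : C) :
    Fibration (relativeMatchingMap (MorphismProperty.identities C) φ c) ↔ Fibration (φ.app c) := by
  have := relativeMatchingMap_fst_isIso φ c
  have h : relativeMatchingMap (MorphismProperty.identities C) φ c ≫ pullback.fst _ _ = φ.app c :=
    pullback.lift_fst _ _ _
  rw [← h, fibration_iff, fibration_iff,
    MorphismProperty.cancel_right_of_respectsIso (fibrations E)]

end Discrete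

/-! ### The projective structure is the Reedy structure, and it is cofibrantly generated. -/

section Reedy

variable (k : Type u) [Field k] [CharZero k] (t : ℕ)

/-- In both categories cofibrations are the maps with the left lifting property against acyclic
fibrations, and acyclic fibrations of diagrams are pointwise (`hT`). The two latching lemmas then
translate between cofibrations of diagrams and relative latching maps. -/
lemma isReedyModelStructure [HasLimits (CDGA k)] [HasColimits (CDGA k)] :
    letI := CDGA.modelCategory k
    letI := CoperverseCDGA.modelCategory k t
    IsReedyModelStructure (E := CDGA k) (perversityReedy t) := by
  let _ := CDGA.modelCategory k
  let _ := CoperverseCDGA.modelCategory k t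
  have hW : weakEquivalences (CDGA k) = CDGA.quasiIsos k := rfl
  have hW' : weakEquivalences (CoperverseCDGA k t) = CoperverseCDGA.quasiIsos k t := rfl
  have hF : fibrations (CDGA k) = CDGA.surjections k := CDGA.rlp_generatingAcyclicCofibrations
  have hF' : fibrations (CoperverseCDGA k t) = CoperverseCDGA.surjections k t :=
    CoperverseCDGA.rlp_generatingAcyclicCofibrations
  have hC : cofibrations (CDGA k) = (CDGA.generatingCofibrations k).rlp.llp := rfl
  have hC' : cofibrations (CoperverseCDGA k t) =
    (CoperverseCDGA.generatingCofibrations k t).rlp.llp := rfl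
  have hT : ∀ {X Y : CoperverseCDGA k t} (p : X ⟶ Y),
      (CoperverseCDGA.generatingCofibrations k t).rlp p ↔
        ∀ q, (CDGA.generatingCofibrations k).rlp (p.app q) := fun p => by
    rw [CoperverseCDGA.rlp_generatingCofibrations_iff, CDGA.rlp_generatingCofibrations]
    exact forall_congr' fun q => and_comm
  refine ⟨fun φ => ?_, fun φ => ⟨fun h => ?_, fun h => ?_⟩, fun φ => ?_⟩
  · simp only [weakEquivalence_iff, hW]
    rw [hW']
    rfl
  · simp only [cofibration_iff, hC]
    rw [cofibration_iff, hC'] at h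
    exact llp_relativeLatchingMap φ _ fun p hp => h p ((hT p).2 hp)
  · simp only [cofibration_iff, hC] at h
    rw [cofibration_iff, hC']
    intro X Y p hp
    refine hasLiftingProperty_of_relativeLatchingMap p
      (fun c => h c _ ((hT p).1 hp c)) (deg := (perversityReedy t).deg) ?_ (n := t + 1) ?_
    · intro q q' hq
      -- The order on perversities is reversed, so `q < q'` means that the underlying number
      -- decreases and `t - p` increases.
      have h₁ : (OrderDual.ofDual q').val < (OrderDual.ofDual q).val := hq
      have h₂ := (OrderDual.ofDual q).isLt
      change t - (OrderDual.ofDual q).val < t - (OrderDual.ofDual q').val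
      omega
    · intro q
      change t - (OrderDual.ofDual q).val < t + 1
      omega
  · refine Iff.trans ?_ (forall_congr' fun c => (fibration_relativeMatchingMap_iff φ c).symm)
    simp only [fibration_iff, hF]
    rw [hF']
    rfl

end Reedy

lemma isCofibrantlyGenerated (k : Type u) [Field k] [CharZero k] (t : ℕ) [HasLimits (CDGA k)]
    [HasColimits (CDGA k)] :
    letI := CoperverseCDGA.modelCategory k t
    IsCofibrantlyGenerated (CoperverseCDGA k t) (CoperverseCDGA.generatingCofibrations k t)
      (CoperverseCDGA.generatingAcyclicCofibrations k t) := by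
  let _ := CoperverseCDGA.modelCategory k t
  have hI := CoperverseCDGA.smallObjectArgument_generatingCofibrations (k := k) (t := t)
  have hJ := CoperverseCDGA.smallObjectArgument_generatingAcyclicCofibrations (k := k) (t := t)
  have hJ' : fibrations (CoperverseCDGA k t) =
    (CoperverseCDGA.generatingAcyclicCofibrations k t).rlp := rfl
  have hI' : trivialFibrations (CoperverseCDGA k t) =
      (CoperverseCDGA.generatingCofibrations k t).rlp := by
    rw [CoperverseCDGA.rlp_generatingCofibrations,
      ← CoperverseCDGA.rlp_generatingAcyclicCofibrations]
    rfl
  refine ⟨inferInstance, inferInstance, MorphismProperty.isSmall_ofHoms.{u} _,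
    MorphismProperty.isSmall_ofHoms.{u} _, hI, hJ, hJ', hI', ?_, ?_⟩
  · rw [hI']
    exact inferInstanceAs (MorphismProperty.HasFunctorialFactorization
      (CoperverseCDGA.generatingCofibrations k t).rlp.llp _)
  -- Acyclic cofibrations are the maps with the left lifting property against fibrations, that is
  -- `J.rlp.llp`, for which the small object argument gives the factorization.
  · rw [← fibrations_llp, hJ']
    infer_instance

theorem mainTheorem5 (k : Type u) [Field k] [CharZero k] (t : ℕ) :
    ∃ (_ : HasLimits (CDGA k)) (_ : HasColimits (CDGA k))
      (_ : ModelCategory (CDGA k)) (_ : ModelCategory (CoperverseCDGA k t)),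
      -- the projective model structure on cdga's
      (weakEquivalences (CDGA k) = CDGA.quasiIsos k ∧
        fibrations (CDGA k) = CDGA.surjections k) ∧
      -- the projective model structure on coperverse cdga's
      (weakEquivalences (CoperverseCDGA k t) = CoperverseCDGA.quasiIsos k t ∧
        fibrations (CoperverseCDGA k t) = CoperverseCDGA.surjections k t) ∧
      IsReedyModelStructure (E := CDGA k) (perversityReedy t) ∧
      IsCofibrantlyGenerated (CoperverseCDGA k t)
        (CoperverseCDGA.generatingCofibrations k t)
        (CoperverseCDGA.generatingAcyclicCofibrations k t) := by
  have hl := CDGA.hasLimits k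
  have hc := CDGA.hasColimits k
  exact ⟨hl, hc, CDGA.modelCategory k, CoperverseCDGA.modelCategory k t,
    ⟨rfl, CDGA.rlp_generatingAcyclicCofibrations⟩,
    ⟨rfl, CoperverseCDGA.rlp_generatingAcyclicCofibrations⟩,
    isReedyModelStructure k t, isCofibrantlyGenerated k t⟩
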